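/- Let $N\in\mathbb N$, let $\alpha_i\in\mathbb R\setminus\{0\}$, $\beta_i\in\mathbb R$ with at least one $\beta_i\neq0$, and let $p_i>0$ be non-integer ($i=1,\dots,N$). Consider, for $u=u(t,x_1,\dots,x_N)>0$, the equation $$\mathcal E[u]:=u_t-\sum_{i=1}^N\alpha_i u^{\beta_i}\,D^{p_i}_{0,x_i}u=0,\qquad D^{p}_{0,x}f(x)=\frac1{\Gamma(1+[p]-p)}\frac{d^{[p]+1}}{dx^{[p]+1}}\int_0^x(x-s)^{[p]-p}f(s)\,ds .$$ **Symmetries.** Let $M=I\times\prod_i[0,b_i)\times U$ with $I\subseteq\mathbb R$ and $U\subseteq(0,\infty)$ nonempty open intervals and $0<b_i\le\infty$. A point symmetry on $M$ is an analytic vector field $\mathbf v=\tau\partial_t+\sum_i\xi^i\partial_{x_i}+\phi\,\partial_u$ on $M$ (coefficients functions of $(t,x,u)$, analytic up to the faces $x_i=0$) with $\xi^i|_{x_i=0}=0$ that satisfies the Lie condition $\mathrm{pr}^\infty\mathbf v[\mathcal E]\big|_{\mathcal E=0}=0$. Here, with $Q=\phi-\tau u_t-\sum_i\xi^iu_{x_i}$,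 $$\mathrm{pr}^\infty\mathbf v[\mathcal E][u]=\tfrac{d}{d\varepsilon}\Big|_{\varepsilon=0}\mathcal E[u+\varepsilon Q]+\tau\,\partial_t\mathcal E[u]+\sum_i\xi^i\,\partial_{x_i}\mathcal E[u],$$ and the condition is imposed at every point $(t,x)$ with $t\in I$, $0<x_i<b_i$, along every $U$-valued function $u$ analytic in a neighbourhood of $\{t\}\times\prod_i[0,x_i]$ with $\mathcal E[u](t,x)=0$. Put $$\mathbf v_1=\partial_t,\qquad \mathbf v_2=t\partial_t+\sum_i\frac{x_i}{p_i}\partial_{x_i},\qquad \mathbf v_3=u\partial_u+\sum_i\frac{\beta_ix_i}{p_i}\partial_{x_i}.$$ (a) Unless there is a $k$ with $\beta_k(p_k-1)=2p_k$ and $\beta_j=0$ for all $j\ne k$, the set of point symmetries on $M$ is the linear span of $\mathbf v_1,\mathbf v_2,\mathbf v_3$, and these three fields are linearly independent. (b) If there is such a $k$, the set of point symmetries on $M$ is the linear span of the linearly independent fields $\mathbf v_1,\mathbf v_2,\mathbf v_3$ and $\mathbf v_4=x_k^2\partial_{x_k}+(p_k-1)x_ku\,\partial_u$. **Reductions.**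 A differentiable function $u$ is called invariant under $\mathbf v$ if its characteristic $Q$ vanishes identically. Below, $x$ and $z$ range over open positive orthants and $v$ is differentiable and positive. 1. On $\{t\in\mathbb R,\ x_i>0\}$, $u$ is $\mathbf v_1$-invariant iff $u=v(x)$ for some function $v$; such a $u$ solves $\mathcal E[u]=0$ iff $\sum_i\alpha_iv^{\beta_i}D^{p_i}_{0,x_i}v=0$. 2. On $\{t>0,\ x_i>0\}$, $u$ is $\mathbf v_2$-invariant iff $u=v(z_1,\dots,z_N)$, $z_i=t^{-1/p_i}x_i$, for some function $v$; such a $u$ solves $\mathcal E[u]=0$ iff $\sum_i\big[\tfrac1{p_i}z_i\partial_{z_i}v+\alpha_iv^{\beta_i}D^{p_i}_{0,z_i}v\big]=0$. 3. Let $\beta_k\ne0$ and $\gamma_i=\frac{\beta_ip_k}{\beta_kp_i}$ for $i\neq k$. On $\{t\in\mathbb R,\ x_i>0\}$, $u$ is $\mathbf v_3$-invariant iff $u=x_k^{p_k/\beta_k}\,v\big(t,(z_i)_{i\ne k}\big)$, $z_i=x_ix_k^{-\gamma_i}$, for some function $v$. Put $$\mathfrak K_cf(z)=\int_1^\infty\frac{(\omega-1)^{[p_k]-p_k}}{\Gamma([p_k]+1-p_k)}\,f\big((z_i\omega^{\gamma_i})_{i\ne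 k}\big)\,\omega^{p_k-[p_k]-2-c}\,d\omega .$$ If $\mathfrak K_{p_k/\beta_k}[v(t,\cdot)]$ is of class $C^{[p_k]+1}$ for every $t$, then such a $u$ solves $\mathcal E[u]=0$ iff $$\partial_tv=\alpha_kv^{\beta_k}\prod_{j=0}^{[p_k]}\Big(1-p_k+\tfrac{p_k}{\beta_k}+j-\sum_{i\ne k}\gamma_iz_i\partial_{z_i}\Big)\mathfrak K_{p_k/\beta_k}[v]+\sum_{i\neq k}\alpha_iv^{\beta_i}D^{p_i}_{0,z_i}v ;$$ and, for any $l\ne k$ with $\beta_l\ne0$, iff $$\partial_tv=\alpha_kv^{\beta_k}z_l^{p_l/\beta_l}\prod_{j=0}^{[p_k]}\Big(1-p_k+j-\sum_{i\ne k}\gamma_iz_i\partial_{z_i}\Big)\mathfrak K_{0}\big[z_l^{-p_l/\beta_l}v\big]+\sum_{i\neq k}\alpha_iv^{\beta_i}D^{p_i}_{0,z_i}v .$$ -/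

import Mathlib

open Set

noncomputable section

namespace FracDiff

/-! ### Riemann-Liouville operators -/

/-- The integer attached to an order: the floor of `p` if `0 ≤ p`, and `-1` if `p < 0`. -/
def rlFloor (p : ℝ) : ℤ := if 0 ≤ p then ⌊p⌋ else -1

/-- The Riemann-Liouville operator of order `p` with terminals `(a, x)`:
`1 / Γ(1 + [p] - p) * (d/dx)^([p] + 1) ∫_a^x (x - s)^([p] - p) f(s) ds`. -/
def riemannLiouville (a p : ℝ) (f : ℝ → ℝ) (x : ℝ) : ℝ :=
  (Real.Gamma (1 + (rlFloor p : ℝ) - p))⁻¹ *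
    iteratedDeriv (rlFloor p + 1).toNat
      (fun y => ∫ s in a..y, (y - s) ^ ((rlFloor p : ℝ) - p) * f s) x

/-- The Riemann-Liouville operator of order `p` and lower terminal `a` in the variable `x i`. -/
def partialRL {ι : Type} [DecidableEq ι] (a p : ℝ) (i : ι) (f : (ι → ℝ) → ℝ) (x : ι → ℝ) : ℝ :=
  riemannLiouville a p (fun s => f (Function.update x i s)) (x i)

/-! ### The equation -/

/-- The space of independent variables `(t, x)`. -/
abbrev Base (N : ℕ) : Type := ℝ × (Fin N → ℝ)

/-- The space of independent and dependent variables `((t, x), u)`. A vector field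
`τ ∂_t + ∑ ξ^i ∂_{x_i} + φ ∂_u` is the map `V : Total N → Total N`, `V = ((τ, ξ), φ)`. -/
abbrev Total (N : ℕ) : Type := Base N × ℝ

/-- `u_t - ∑ α_i u^{β_i} D^{p_i}_{0, x_i} u`, evaluated at a point `P = (t, x)`. -/
def diffusion {N : ℕ} (α β p : Fin N → ℝ) (u : Base N → ℝ) (P : Base N) : ℝ :=
  deriv (fun s => u (s, P.2)) P.1 -
    ∑ i, α i * u P ^ β i * partialRL 0 (p i) i (fun y => u (P.1, y)) P.2

/-! ### Prolongation and point symmetries -/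

/-- The characteristic `Q = φ - τ u_t - ∑ ξ^i u_{x_i}` of `V` along `u`. -/
def characteristic {N : ℕ} (V : Total N → Total N) (u : Base N → ℝ) (P : Base N) : ℝ :=
  (V (P, u P)).2 - fderiv ℝ u P (V (P, u P)).1

/-- The infinite prolongation of `V` applied to a (possibly nonlocal) operator `E`, evaluated along
`u` at `P`: the linearisation of `E` at `u` in the direction of the characteristic, plus the total
derivative of `E[u]` along `(τ, ξ)`. For `E[u] = D^σ u` this is `D^σ Q + ∑ ξ^i D_i D^σ u`. -/
def prolong {N : ℕ} (V : Total N → Total N) (E : (Base N → ℝ) → Base N → ℝ)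
    (u : Base N → ℝ) (P : Base N) : ℝ :=
  deriv (fun ε : ℝ => E (fun q => u q + ε * characteristic V u q) P) 0 +
    fderiv ℝ (E u) P (V (P, u P)).1

/-- The box `{t} × ∏ [0, x_i]` on which the value at `P = (t, x)` of Riemann-Liouville operators
with lower terminals `0` depends. -/
def box {N : ℕ} (P : Base N) : Set (Base N) :=
  {q | q.1 = P.1 ∧ ∀ i, 0 ≤ q.2 i ∧ q.2 i ≤ P.2 i}

/-- The domain `I × ∏ [0, b_i) × U` of the variables `(t, x, u)`; `b_i = ⊤` is allowed. -/
def domain {N : ℕ} (I : Set ℝ) (b : Fin N → EReal) (U : Set ℝ) : Set (Total N) :=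
  {q | q.1.1 ∈ I ∧ (∀ i, 0 ≤ q.1.2 i ∧ ((q.1.2 i : ℝ) : EReal) < b i) ∧ q.2 ∈ U}

/-- Infinitesimal point symmetries of `E = 0` on `domain I b U`: analytic vector fields on the
domain that preserve the terminals `x_i = 0` and satisfy the Lie condition, that is, the prolonged
field annihilates `E` on `E = 0`: at every point `P` with `x_i > 0` and along every analytic local
section `u` over (a neighbourhood of) `box P` for which `E[u](P) = 0`. -/
structure IsPointSymmetry {N : ℕ} (E : (Base N → ℝ) → Base N → ℝ)
    (I : Set ℝ) (b : Fin N → EReal) (U : Set ℝ) (V : Total N → Total N) : Prop where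
  analytic : AnalyticOnNhd ℝ V (domain I b U)
  terminal : ∀ q ∈ domain I b U, ∀ i, q.1.2 i = 0 → (V q).1.2 i = 0
  lie : ∀ P : Base N, P.1 ∈ I → (∀ i, 0 < P.2 i ∧ ((P.2 i : ℝ) : EReal) < b i) →
    ∀ u : Base N → ℝ, AnalyticOnNhd ℝ u (box P) → (∀ q ∈ box P, u q ∈ U) →
      E u P = 0 → prolong V E u P = 0

/-- The set of point symmetries of `E = 0`, as vector fields on `domain I b U`. -/
def symmetryAlgebra {N : ℕ} (E : (Base N → ℝ) → Base N → ℝ)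
    (I : Set ℝ) (b : Fin N → EReal) (U : Set ℝ) : Set (domain I b U → Total N) :=
  {W | ∃ V, IsPointSymmetry E I b U V ∧ (domain I b U).domRestrict V = W}

/-! ### The generators -/

/-- `∂_t` -/
def gen₁ {N : ℕ} : Total N → Total N := fun _ => ((1, 0), 0)

/-- `t ∂_t + ∑ (x_i / p_i) ∂_{x_i}` -/
def gen₂ {N : ℕ} (p : Fin N → ℝ) : Total N → Total N :=
  fun q => ((q.1.1, fun i => q.1.2 i / p i), 0)

/-- `u ∂_u + ∑ (β_i x_i / p_i) ∂_{x_i}` -/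
def gen₃ {N : ℕ} (β p : Fin N → ℝ) : Total N → Total N :=
  fun q => ((0, fun i => β i * q.1.2 i / p i), q.2)

/-- `x_k ^ 2 ∂_{x_k} + (p_k - 1) x_k u ∂_u` -/
def gen₄ {N : ℕ} (p : Fin N → ℝ) (k : Fin N) : Total N → Total N :=
  fun q => ((0, Pi.single k (q.1.2 k ^ 2)), (p k - 1) * q.1.2 k * q.2)

/-! ### Invariant functions and reduced equations -/

/-- The open positive orthant. -/
def orthant (ι : Type) : Set (ι → ℝ) := {z | ∀ i, 0 < z i}

/-- `∑ α_i v^{β_i} D^{p_i}_{0, x_i} v` -/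
def stationaryReduced {N : ℕ} (α β p : Fin N → ℝ) (v : (Fin N → ℝ) → ℝ) (x : Fin N → ℝ) : ℝ :=
  ∑ i, α i * v x ^ β i * partialRL 0 (p i) i v x

/-- `u(t, x) = v(t^{-1/p_1} x_1, …, t^{-1/p_N} x_N)` -/
def similarityAnsatz {N : ℕ} (p : Fin N → ℝ) (v : (Fin N → ℝ) → ℝ) (P : Base N) : ℝ :=
  v (fun i => P.1 ^ (-(1 / p i)) * P.2 i)

/-- `∑ ((1 / p_i) z_i ∂_{z_i} v + α_i v^{β_i} D^{p_i}_{0, z_i} v)` -/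
def similarityReduced {N : ℕ} (α β p : Fin N → ℝ) (v : (Fin N → ℝ) → ℝ) (z : Fin N → ℝ) : ℝ :=
  ∑ i, (1 / p i * z i * fderiv ℝ v z (Pi.single i 1) +
    α i * v z ^ β i * partialRL 0 (p i) i v z)

/-- The exponents `γ_i = β_i p_k / (β_k p_i)`, `i ≠ k`. -/
def scalingExp {N : ℕ} (β p : Fin N → ℝ) (k : Fin N) (i : {i : Fin N // i ≠ k}) : ℝ :=
  β i * p k / (β k * p i)

/-- `u(t, x) = x_k^{p_k/β_k} v(t, (x_i x_k^{-γ_i})_{i ≠ k})` -/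
def scalingAnsatz {N : ℕ} (β p : Fin N → ℝ) (k : Fin N)
    (v : ℝ × ({i : Fin N // i ≠ k} → ℝ) → ℝ) (P : Base N) : ℝ :=
  P.2 k ^ (p k / β k) * v (P.1, fun i => P.2 i * P.2 k ^ (-scalingExp β p k i))

/-- The Erdélyi-Kober type operator
`K f(z) = ∫_1^∞ (ω - 1)^([p] - p) / Γ([p] + 1 - p) * f(z_i ω^{γ_i}) * ω^(p - [p] - 2 - c) dω`;
the weight `c` is `0` in the basic case. -/
def erdelyiKober {ι : Type} (p c : ℝ) (γ : ι → ℝ) (f : (ι → ℝ) → ℝ) (z : ι → ℝ) : ℝ :=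
  ∫ ω in Ioi (1 : ℝ), (ω - 1) ^ ((⌊p⌋ : ℝ) - p) / Real.Gamma ((⌊p⌋ : ℝ) + 1 - p) *
    f (fun i => z i * ω ^ γ i) * ω ^ (p - (⌊p⌋ : ℝ) - 2 - c)

/-- `∏_{j < m} (c + j - ∑ γ_i z_i ∂_{z_i})` applied to `g`. -/
def eulerProd {ι : Type} [Fintype ι] [DecidableEq ι] (γ : ι → ℝ) (c : ℝ) :
    ℕ → ((ι → ℝ) → ℝ) → (ι → ℝ) → ℝ
  | 0, g => g
  | m + 1, g => fun z => (c + m) * eulerProd γ c m g z -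
      ∑ i, γ i * z i * fderiv ℝ (eulerProd γ c m g) z (Pi.single i 1)

/-- `v_t - α_k v^{β_k} ∏_{j=0}^{[p_k]} (1 - p_k + p_k/β_k + j - ∑ γ_i z_i ∂_{z_i}) K v
  - ∑_{i ≠ k} α_i v^{β_i} D^{p_i}_{0, z_i} v`, where `K` has the weight `p_k/β_k`. -/
def scalingReduced {N : ℕ} (α β p : Fin N → ℝ) (k : Fin N)
    (v : ℝ × ({i : Fin N // i ≠ k} → ℝ) → ℝ) (t : ℝ) (z : {i : Fin N // i ≠ k} → ℝ) : ℝ :=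
  deriv (fun s => v (s, z)) t -
    α k * v (t, z) ^ β k *
      eulerProd (scalingExp β p k) (1 - p k + p k / β k) (⌊p k⌋₊ + 1)
        (erdelyiKober (p k) (p k / β k) (scalingExp β p k) (fun y => v (t, y))) z -
    ∑ i : {i : Fin N // i ≠ k},
      α i * v (t, z) ^ β i * partialRL 0 (p i) i (fun y => v (t, y)) z

/-- The same operator written with the unweighted `K` and a second index `l`, `β_l ≠ 0`:
the middle term is `α_k v^{β_k} z_l^{p_l/β_l} ∏_{j=0}^{[p_k]} (1 - p_k + j - ∑ γ_i z_i ∂_{z_i})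
K[z_l^{-p_l/β_l} v]`. -/
def scalingReduced' {N : ℕ} (α β p : Fin N → ℝ) (k : Fin N) (l : {i : Fin N // i ≠ k})
    (v : ℝ × ({i : Fin N // i ≠ k} → ℝ) → ℝ) (t : ℝ) (z : {i : Fin N // i ≠ k} → ℝ) : ℝ :=
  deriv (fun s => v (s, z)) t -
    α k * v (t, z) ^ β k * (z l ^ (p l / β l) *
      eulerProd (scalingExp β p k) (1 - p k) (⌊p k⌋₊ + 1)
        (erdelyiKober (p k) 0 (scalingExp β p k)
          (fun y => y l ^ (-(p l / β l)) * v (t, y))) z) -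
    ∑ i : {i : Fin N // i ≠ k},
      α i * v (t, z) ^ β i * partialRL 0 (p i) i (fun y => v (t, y)) z

end FracDiff

end

open FracDiff

/-!
Why the theorem is true.

*The generators are symmetries.* On functions analytic up to the terminal, `D^p` is an Abel integral
followed by `[p] + 1` derivatives, and it obeys the Euler identity `riemannLiouville_euler`
and the projective identity `riemannLiouville_projective`. In the prolongation of a field `V`
(`prolong_diffusion`) the second derivatives of `u` transverse to `x_i` combine with the
characteristic into one derivative `D^{p_i}` of a remainder living on the segment from the face
`x_i = 0` to the point. If `ξ^i` is quadratic along that segment, without constant term, and `φ` is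
`u` times the matching affine function, the two identities evaluate this derivative, and only
algebraic conditions on the coefficients remain (`prolong_diffusion_of_projective`).

*There are no others.* The Lie condition at `P` is tested along functions `f(x_i) + κ (t - t_P)`
whose slope `κ` in time is chosen so that the equation holds at `P`; `f` is then arbitrary.
Perturbations vanishing to high order at the endpoint of the segment turn `D^p` and `D^(p+1)` into
proper integrals against one and the same kernel of constant sign
(`riemannLiouville_sub_pow_mul`); this is where the order must not be an integer. The perturbation
may be chosen proportional to the expression one wants to vanish, so that the Lie condition becomes
the vanishing of the integral of a square.

* Perturbations `ρ(x_i) l(q - P)`, with `l` a linear form killing `∂_{x_i}`, show that `τ` and the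
  `ξ^j` with `j ≠ i` depend neither on `x_i` nor on `u` (`transverse_eq`).
* Perturbations of `f` itself give, after an integration by parts that uses `ξ^i = 0` on the face,
  a pointwise equation relating the coefficients at any point of the segment to those at its
  endpoint (`segment_equation`).
* Varying the slope and the end values of `f` removes `u` from `ξ^i` and makes `φ` affine in `u`,
  and linear as soon as some `β_k` is nonzero. What is left says that the difference quotients of
  `ξ^i / x_i` do not depend on their upper endpoint, hence `ξ^i` is quadratic along each coordinate
  line (`projective_profile`).
* Inserting these profiles into the Lie condition shows that `ξ` and `φ` do not depend on time.
  Comparing the profiles in the various directions leaves the combinations of the generators, the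
  quadratic one only in the exceptional case (`SymmetrySetting.exists_eq_genSpan`); by continuity
  this extends to the faces.

*Reductions.* A function is invariant under a field if and only if it is constant, or for `v₃`
homogeneous, along its flow; following the flow to a cross-section gives the stated form of `u`.
The reduced equations come from the scaling law of `D^p` and, in the direction `x_k` of the third
reduction, from the substitution `s = y / ω`, which turns the Abel integral into the operator
`𝔎` (`abel_rpow_mul_comp`). Each derivative in `y` then contributes one first-order Euler factor.
These factors commute, so they can be put into the stated order
(`eulerProd_succ'`, `iteratedDeriv_rpow_mul_comp`), and conjugation by a power of `z_l` shifts their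
constants (`eulerProd_rpow_mul`), which relates the two forms of the reduced equation.
-/

noncomputable section

namespace FracDiff

open Set Filter Topology MeasureTheory
open scoped ContDiff

/-! ### Abel integrals -/

/-- The Abel integral `∫_0^y (y - s)^a f(s) ds`. -/
def abel (a : ℝ) (f : ℝ → ℝ) (y : ℝ) : ℝ := ∫ s in (0 : ℝ)..y, (y - s) ^ a * f s

theorem eventually_analyticOnNhd_prod {X : Type*} [NormedAddCommGroup X] [NormedSpace ℝ X]
    {W : X × ℝ → ℝ} {h : X} {K : Set ℝ} (hK : IsCompact K)
    (hW : ∀ s ∈ K, AnalyticAt ℝ W (h, s)) :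
    ∀ᶠ h' in 𝓝 h, ∀ s ∈ K, AnalyticAt ℝ W (h', s) := by
  refine hK.eventually_forall_of_forall_eventually fun s hs => ?_
  exact (hW s hs).eventually_analyticAt

/-- A property that holds on `[0, x]` and near `x` holds on `[0, y]` for `y` near `x`. -/
theorem eventually_forall_Icc {Q : ℝ → Prop} {x : ℝ} (h : ∀ s ∈ Icc 0 x, Q s)
    (hx : ∀ᶠ s in 𝓝 x, Q s) : ∀ᶠ y in 𝓝 x, ∀ s ∈ Icc 0 y, Q s := by
  obtain ⟨δ, hδ, hQ⟩ := Metric.eventually_nhds_iff.1 hx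
  filter_upwards [Metric.ball_mem_nhds x hδ] with y hy s hs
  rcases le_or_gt s x with hsx | hsx
  · exact h s ⟨hs.1, hsx⟩
  · refine hQ ?_
    rw [Metric.mem_ball, Real.dist_eq, abs_lt] at hy
    rw [Real.dist_eq, abs_lt]
    constructor <;> linarith [hs.2]

theorem eventually_analyticOnNhd_Icc {f : ℝ → ℝ} {x : ℝ} (hx : 0 < x)
    (hf : AnalyticOnNhd ℝ f (Icc 0 x)) : ∀ᶠ y in 𝓝 x, AnalyticOnNhd ℝ f (Icc 0 y) :=
  eventually_forall_Icc hf (hf x ⟨hx.le, le_rfl⟩).eventually_analyticAt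

theorem intervalIntegrable_one_sub_rpow {a : ℝ} (ha : -1 < a) :
    IntervalIntegrable (fun σ : ℝ => (1 - σ) ^ a) volume 0 1 := by
  have := (intervalIntegral.intervalIntegrable_rpow' ha (a := 0) (b := 1)).comp_sub_left 1
  simpa using this.symm

theorem intervalIntegrable_sub_rpow {a : ℝ} (ha : -1 < a) (y : ℝ) :
    IntervalIntegrable (fun s : ℝ => (y - s) ^ a) volume 0 y := by
  have := (intervalIntegral.intervalIntegrable_rpow' ha (a := 0) (b := y)).comp_sub_left y
  simpa using this.symm

theorem intervalIntegrable_abel {a : ℝ} (ha : -1 < a) {y : ℝ} (hy : 0 ≤ y) {f : ℝ → ℝ}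
    (hf : ContinuousOn f (Icc 0 y)) :
    IntervalIntegrable (fun s : ℝ => (y - s) ^ a * f s) volume 0 y :=
  (intervalIntegrable_sub_rpow ha y).mul_continuousOn (by rwa [uIcc_of_le hy])

/-- Rescaling to a fixed interval, which makes the Abel integral differentiable in its endpoint in
spite of the singular kernel. -/
theorem abel_eq_scaled (a : ℝ) (f : ℝ → ℝ) {y : ℝ} (hy : 0 < y) :
    abel a f y = y ^ (a + 1) * ∫ σ in (0 : ℝ)..1, (1 - σ) ^ a * f (y * σ) := by
  have h1 : abel a f y = y * ∫ σ in (0 : ℝ)..1, (y - y * σ) ^ a * f (y * σ) := by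
    rw [intervalIntegral.mul_integral_comp_mul_left (f := fun s => (y - s) ^ a * f s)]
    simp [abel]
  rw [h1, Real.rpow_add hy, Real.rpow_one, mul_comm (y ^ a) y, mul_assoc,
    ← intervalIntegral.integral_const_mul (y ^ a)]
  congr 1
  refine intervalIntegral.integral_congr fun σ hσ => ?_
  rw [uIcc_of_le zero_le_one] at hσ
  have : y - y * σ = y * (1 - σ) := by ring
  simp only [this]
  rw [Real.mul_rpow hy.le (by linarith [hσ.2])]
  ring

/-- Differentiation of a weighted integral over `[0, 1]` with respect to a parameter. -/
theorem hasFDerivAt_weighted_integral {X : Type*} [NormedAddCommGroup X] [NormedSpace ℝ X]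
    {a : ℝ} (ha : -1 < a) {W : X × ℝ → ℝ} {h : X}
    (hW : ∀ s ∈ Icc (0 : ℝ) 1, AnalyticAt ℝ W (h, s)) :
    HasFDerivAt (fun h' => ∫ σ in (0 : ℝ)..1, (1 - σ) ^ a * W (h', σ))
      (∫ σ in (0 : ℝ)..1, (1 - σ) ^ a • (fderiv ℝ W (h, σ)).comp (ContinuousLinearMap.inl ℝ X ℝ)) h
    ∧ IntervalIntegrable (fun σ => (1 - σ) ^ a •
        (fderiv ℝ W (h, σ)).comp (ContinuousLinearMap.inl ℝ X ℝ)) volume 0 1 := by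
  set G : X → ℝ → X →L[ℝ] ℝ := fun h' σ =>
    (fderiv ℝ W (h', σ)).comp (ContinuousLinearMap.inl ℝ X ℝ) with hG
  have hGc : ∀ h', (∀ s ∈ Icc (0 : ℝ) 1, AnalyticAt ℝ W (h', s)) →
      ContinuousOn (G h') (Icc 0 1) := by
    intro h' hA s hs
    have h1 : ContinuousAt (fderiv ℝ W) (h', s) := (hA s hs).fderiv.continuousAt
    have h2 : ContinuousAt (fun σ : ℝ => fderiv ℝ W (h', σ)) s :=
      h1.comp (f := fun σ : ℝ => (h', σ)) (by fun_prop)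
    exact (h2.clm_comp continuousAt_const).continuousWithinAt
  obtain ⟨C, hC⟩ := isCompact_Icc.exists_bound_of_continuousOn (hGc h hW)
  have hC' : ∀ᶠ h' in 𝓝 h, ∀ s ∈ Icc (0 : ℝ) 1, ‖G h' s‖ ≤ C + 1 := by
    refine isCompact_Icc.eventually_forall_of_forall_eventually fun s hs => ?_
    have h1 : ContinuousAt (fderiv ℝ W) (h, s) := (hW s hs).fderiv.continuousAt
    have h2 : ContinuousAt (fun z : X × ℝ => ‖G z.1 z.2‖) (h, s) :=
      (ContinuousAt.clm_comp h1 continuousAt_const).norm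
    filter_upwards [h2.eventually (gt_mem_nhds (lt_of_le_of_lt (hC s hs) (lt_add_one C)))]
      with z hz using hz.le
  have hev := (eventually_analyticOnNhd_prod isCompact_Icc hW).and hC'
  have hWc : ∀ h', (∀ s ∈ Icc (0 : ℝ) 1, AnalyticAt ℝ W (h', s)) →
      ContinuousOn (fun s => W (h', s)) (Icc 0 1) := fun h' hA s hs =>
    ((hA s hs).continuousAt.comp (f := fun σ : ℝ => (h', σ)) (by fun_prop)).continuousWithinAt
  have hw := intervalIntegrable_one_sub_rpow ha
  have hint : IntervalIntegrable (fun σ => (1 - σ) ^ a • G h σ) volume 0 1 :=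
    hw.smul_continuousOn (by rw [uIcc_of_le zero_le_one]; exact hGc h hW)
  refine ⟨?_, hint⟩
  refine (intervalIntegral.hasFDerivAt_integral_of_dominated_of_fderiv_le (𝕜 := ℝ)
    (F := fun h' σ => (1 - σ) ^ a * W (h', σ)) (F' := fun h' σ => (1 - σ) ^ a • G h' σ)
    (bound := fun σ => |(1 - σ) ^ a| * (C + 1)) hev ?_ ?_ ?_ ?_ ?_ ?_)
  · filter_upwards [hev] with h' hh
    exact (hw.mul_continuousOn
      (by rw [uIcc_of_le zero_le_one]; exact hWc h' hh.1)).aestronglyMeasurable_restrict_uIoc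
  · exact hw.mul_continuousOn (by rw [uIcc_of_le zero_le_one]; exact hWc h hW)
  · exact hint.aestronglyMeasurable_restrict_uIoc
  · refine Eventually.of_forall fun σ hσ h' hh => ?_
    rw [uIoc_of_le zero_le_one] at hσ
    rw [norm_smul, Real.norm_eq_abs]
    exact mul_le_mul_of_nonneg_left (hh.2 σ ⟨hσ.1.le, hσ.2⟩) (abs_nonneg _)
  · exact hw.abs.mul_const _
  · refine Eventually.of_forall fun σ hσ h' hh => ?_
    rw [uIoc_of_le zero_le_one] at hσ
    have h1 : HasFDerivAt W (fderiv ℝ W (h', σ)) (h', σ) :=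
      (hh.1 σ ⟨hσ.1.le, hσ.2⟩).differentiableAt.hasFDerivAt
    have h2 : HasFDerivAt (fun z : X => W (z, σ)) (G h' σ) h' :=
      h1.comp h' (hasFDerivAt_prodMk_left h' σ)
    simpa using h2.const_mul ((1 - σ) ^ a)

/-- The derivative of an Abel integral is `x⁻¹` times an Abel integral with the same exponent. -/
theorem hasDerivAt_abel {a : ℝ} (ha : -1 < a) {f : ℝ → ℝ} {x : ℝ} (hx : 0 < x)
    (hf : AnalyticOnNhd ℝ f (Icc 0 x)) :
    HasDerivAt (abel a f) (x⁻¹ * abel a (fun s => (a + 1) * f s + s * deriv f s) x) x := by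
  have hmem : ∀ s ∈ Icc (0 : ℝ) 1, x * s ∈ Icc 0 x := fun s hs =>
    ⟨by have := hs.1; positivity, by nlinarith [hs.2]⟩
  have hW : ∀ s ∈ Icc (0 : ℝ) 1, AnalyticAt ℝ (fun q : ℝ × ℝ => f (q.1 * q.2)) (x, s) := by
    intro s hs
    exact (hf _ (hmem s hs)).comp (f := fun q : ℝ × ℝ => q.1 * q.2) (by fun_prop)
  obtain ⟨h1, h1i⟩ := hasFDerivAt_weighted_integral ha hW
  have h2 := h1.hasDerivAt
  rw [ContinuousLinearMap.intervalIntegral_apply h1i] at h2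
  have h3 : (∫ σ in (0 : ℝ)..1, ((1 - σ) ^ a • (fderiv ℝ (fun q : ℝ × ℝ => f (q.1 * q.2)) (x,
      σ)).comp
      (ContinuousLinearMap.inl ℝ ℝ ℝ)) 1) =
      ∫ σ in (0 : ℝ)..1, (1 - σ) ^ a * (σ * deriv f (x * σ)) := by
    refine intervalIntegral.integral_congr fun σ hσ => ?_
    rw [uIcc_of_le zero_le_one] at hσ
    have hd : HasFDerivAt (fun q : ℝ × ℝ => f (q.1 * q.2)) _ (x, σ) :=
      (hf _ (hmem σ hσ)).differentiableAt.hasFDerivAt.comp (x, σ)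
        (hasFDerivAt_fst.mul hasFDerivAt_snd)
    simp only [hd.fderiv]
    simp
  rw [h3] at h2
  have h4 := (Real.hasDerivAt_rpow_const (x := x) (p := a + 1) (Or.inl hx.ne')).mul h2
  have h5 : HasDerivAt (abel a f) _ x := h4.congr_of_eventuallyEq (by
    filter_upwards [eventually_gt_nhds hx] with y hy
    rw [abel_eq_scaled a f hy]; rfl)
  convert h5 using 1
  have hfc : ContinuousOn (fun σ => f (x * σ)) (Icc 0 1) := fun s hs =>
    ((hf _ (hmem s hs)).continuousAt.comp (f := fun σ => x * σ) (by fun_prop)).continuousWithinAt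
  have hfc' : ContinuousOn (fun σ => σ * deriv f (x * σ)) (Icc 0 1) := fun s hs =>
    (continuousAt_id.mul ((hf _ (hmem s hs)).deriv.continuousAt.comp
      (f := fun σ => x * σ) (by fun_prop))).continuousWithinAt
  rw [abel_eq_scaled _ _ hx]
  have hw := intervalIntegrable_one_sub_rpow ha
  have h6 : (∫ σ in (0 : ℝ)..1, (1 - σ) ^ a * ((a + 1) * f (x * σ) + x * σ * deriv f (x * σ))) =
      (a + 1) * (∫ σ in (0 : ℝ)..1, (1 - σ) ^ a * f (x * σ)) +
      x * ∫ σ in (0 : ℝ)..1, (1 - σ) ^ a * (σ * deriv f (x * σ)) := by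
    rw [← intervalIntegral.integral_const_mul, ← intervalIntegral.integral_const_mul,
      ← intervalIntegral.integral_add]
    · refine intervalIntegral.integral_congr fun σ _ => ?_
      ring
    · exact (hw.mul_continuousOn (by rwa [uIcc_of_le zero_le_one])).const_mul _
    · exact (hw.mul_continuousOn (by rwa [uIcc_of_le zero_le_one])).const_mul _
  rw [h6, add_sub_cancel_right, Real.rpow_add_one hx.ne']
  field_simp

/-- The differential operators `Θ_m = ∏_{j < m} (a + 1 - j + s d/ds)`, for which
`(d/dx)^m ∫_0^x (x - s)^a f = x^(-m) ∫_0^x (x - s)^a Θ_m f`. -/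
def thetaIter (a : ℝ) : ℕ → (ℝ → ℝ) → ℝ → ℝ
  | 0, f => f
  | m + 1, f => fun s => (a + 1 - m) * thetaIter a m f s + s * deriv (thetaIter a m f) s

theorem analyticAt_thetaIter (a : ℝ) (m : ℕ) {f : ℝ → ℝ} {s : ℝ} (hf : AnalyticAt ℝ f s) :
    AnalyticAt ℝ (thetaIter a m f) s := by
  induction m with
  | zero => exact hf
  | succ m ih => simp only [thetaIter]; fun_prop

/-! ### Derivatives of Abel integrals -/

theorem iteratedDeriv_abel {a : ℝ} (ha : -1 < a) (m : ℕ) {f : ℝ → ℝ} {x : ℝ} (hx : 0 < x)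
    (hf : AnalyticOnNhd ℝ f (Icc 0 x)) :
    iteratedDeriv m (abel a f) x = (x ^ m)⁻¹ * abel a (thetaIter a m f) x := by
  induction m generalizing x with
  | zero => simp [thetaIter]
  | succ m ih =>
    have hev : iteratedDeriv m (abel a f) =ᶠ[𝓝 x]
        fun y => (y ^ m)⁻¹ * abel a (thetaIter a m f) y := by
      filter_upwards [eventually_gt_nhds hx, eventually_analyticOnNhd_Icc hx hf] with y hy hfy
      exact ih hy hfy
    have h0 : AnalyticOnNhd ℝ (thetaIter a m f) (Icc 0 x) := fun s hs =>
      analyticAt_thetaIter a m (hf s hs)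
    have hd := ((hasDerivAt_pow m x).fun_inv (pow_ne_zero m hx.ne')).fun_mul
        (hasDerivAt_abel ha hx h0)
    rw [iteratedDeriv_succ, hev.deriv_eq, hd.deriv]
    have hw : ∀ g : ℝ → ℝ, AnalyticOnNhd ℝ g (Icc 0 x) →
        IntervalIntegrable (fun s : ℝ => (x - s) ^ a * g s) volume 0 x := fun g hg =>
      intervalIntegrable_abel ha hx.le hg.continuousOn
    have h1 : abel a (thetaIter a (m + 1) f) x =
        abel a (fun s => (a + 1) * thetaIter a m f s + s * deriv (thetaIter a m f) s) x -
          m * abel a (thetaIter a m f) x := by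
      simp only [abel]
      rw [← intervalIntegral.integral_const_mul, ← intervalIntegral.integral_sub]
      · refine intervalIntegral.integral_congr fun s _ => ?_
        simp only [thetaIter]; ring
      · exact hw _ fun s hs => by have := h0 s hs; fun_prop
      · exact (hw _ h0).const_mul _
    rw [h1]
    cases m with
    | zero => simp
    | succ k => simp only [Nat.add_sub_cancel]; field_simp; push_cast; ring

/-- An Abel integral of an analytic function is smooth away from the terminal. -/
theorem contDiffAt_abel {a : ℝ} (ha : -1 < a) {f : ℝ → ℝ} {x : ℝ} (hx : 0 < x)
    (hf : AnalyticOnNhd ℝ f (Icc 0 x)) : ContDiffAt ℝ ∞ (abel a f) x := by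
  -- the derivative is of the same form on all of `O`, so smoothness follows by induction
  set O : Set ℝ := {y | 0 < y ∧ AnalyticOnNhd ℝ f (Icc 0 y)} with hO
  have hOo : IsOpen O := by
    rw [isOpen_iff_mem_nhds]
    intro y hy
    filter_upwards [eventually_gt_nhds hy.1, eventually_analyticOnNhd_Icc hy.1 hy.2] with z h1 h2
      using ⟨h1, h2⟩
  have key : ∀ (m : ℕ) (g : ℝ → ℝ), (∀ y ∈ O, AnalyticOnNhd ℝ g (Icc 0 y)) →
      ContDiffOn ℝ m (abel a g) O := by
    intro m
    induction m with
    | zero =>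
      intro g hg
      rw [Nat.cast_zero, contDiffOn_zero]
      exact fun y hy => (hasDerivAt_abel ha hy.1 (hg y hy)).continuousAt.continuousWithinAt
    | succ m ih =>
      intro g hg
      rw [Nat.cast_add, Nat.cast_one, contDiffOn_succ_iff_deriv_of_isOpen hOo]
      refine ⟨fun y hy => (hasDerivAt_abel ha hy.1 (hg y hy)).differentiableAt.differentiableWithinAt,
        by simp, ?_⟩
      refine ContDiffOn.congr (f := fun y => y⁻¹ * abel a (fun s =>
          (a + 1) * g s + s * deriv g s) y)
        ?_ (fun y hy => (hasDerivAt_abel ha hy.1 (hg y hy)).deriv)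
      refine ContDiffOn.mul (contDiffOn_inv ℝ |>.mono fun y hy => hy.1.ne') (ih _ ?_)
      intro y hy s hs
      have := hg y hy s hs
      fun_prop
  rw [contDiffAt_infty]
  intro m
  exact (key m f fun y hy => hy.2).contDiffAt (hOo.mem_nhds ⟨hx, hf⟩)

theorem abel_add {a : ℝ} (ha : -1 < a) {f g : ℝ → ℝ} {x : ℝ} (hx : 0 ≤ x)
    (hf : ContinuousOn f (Icc 0 x)) (hg : ContinuousOn g (Icc 0 x)) :
    abel a (fun s => f s + g s) x = abel a f x + abel a g x := by
  simp only [abel, mul_add]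
  exact intervalIntegral.integral_add (intervalIntegrable_abel ha hx hf)
    (intervalIntegrable_abel ha hx hg)

theorem abel_const_mul (a c : ℝ) (f : ℝ → ℝ) :
    abel a (fun s => c * f s) = fun x => c * abel a f x := by
  funext x
  simp only [abel, ← intervalIntegral.integral_const_mul]
  congr 1; funext s; ring

/-- Splitting `c - s = (c - y) + (y - s)` raises the exponent of the kernel by one. -/
theorem abel_succ_apply {a : ℝ} (ha : -1 < a) {g : ℝ → ℝ} {y : ℝ} (hy : 0 ≤ y)
    (hg : ContinuousOn g (Icc 0 y)) (c : ℝ) :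
    abel a (fun s => (c - s) * g s) y = (c - y) * abel a g y + abel (a + 1) g y := by
  have hi := intervalIntegrable_abel ha hy hg
  have hi' := intervalIntegrable_abel (show -1 < a + 1 by linarith) hy hg
  simp only [abel]
  rw [← intervalIntegral.integral_const_mul, ← intervalIntegral.integral_add (hi.const_mul _) hi']
  refine intervalIntegral.integral_congr_ae (Eventually.of_forall fun s hs => ?_)
  rw [uIoc_of_le hy] at hs
  rcases hs.2.eq_or_lt with h | h
  · subst h; rcases eq_or_ne a 0 with rfl | h0
    · simp
    · simp [Real.zero_rpow h0, Real.zero_rpow (show a + 1 ≠ 0 by linarith)]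
  · rw [Real.rpow_add_one (by linarith)]; ring

theorem abel_id_mul {a : ℝ} (ha : -1 < a) {g : ℝ → ℝ} {y : ℝ} (hy : 0 ≤ y)
    (hg : ContinuousOn g (Icc 0 y)) :
    abel a (fun s => s * g s) y = y * abel a g y - abel (a + 1) g y := by
  have h := abel_succ_apply ha hy hg 0
  have h2 := congrFun (abel_const_mul a (-1) (fun s => (0 - s) * g s)) y
  have h3 : (fun s => -1 * ((0 - s) * g s)) = fun s => s * g s := by funext s; ring
  rw [h3] at h2
  rw [h2, h]; ring

/-- Integration by parts; the boundary term at `y` vanishes because `a + 1 > 0`. -/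
theorem integral_deriv_mul_rpow {a : ℝ} (ha : -1 < a) {g : ℝ → ℝ} {y : ℝ} (hy : 0 < y)
    (hg : AnalyticOnNhd ℝ g (Icc 0 y)) :
    abel (a + 1) (deriv g) y = (a + 1) * abel a g y - y ^ (a + 1) * g 0 := by
  have hc : ContinuousOn (fun s => (y - s) ^ (a + 1) * g s) (Icc 0 y) := by
    refine ContinuousOn.mul (ContinuousOn.rpow_const (by fun_prop) ?_) hg.continuousOn
    intro s _; right; linarith
  have hd : ∀ s ∈ Ioo 0 y, HasDerivAt (fun s => (y - s) ^ (a + 1) * g s)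
      ((y - s) ^ (a + 1) * deriv g s - (a + 1) * ((y - s) ^ a * g s)) s := by
    intro s hs
    have h1 : HasDerivAt (fun s => (y - s) ^ (a + 1)) _ s :=
      ((hasDerivAt_id s).const_sub y).rpow_const (p := a + 1)
        (Or.inl (by simp only [id]; linarith [hs.2]))
    refine (h1.fun_mul (hg s ⟨hs.1.le, hs.2.le⟩).differentiableAt.hasDerivAt).congr_deriv ?_
    rw [add_sub_cancel_right]; simp only [id]; ring
  have hi := intervalIntegrable_abel ha hy.le hg.continuousOn
  have hi' := intervalIntegrable_abel (show -1 < a + 1 by linarith) hy.le hg.deriv.continuousOn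
  have := intervalIntegral.integral_eq_sub_of_hasDerivAt_of_le hy.le hc hd
    (hi'.sub (hi.const_mul _))
  rw [intervalIntegral.integral_sub hi' (hi.const_mul _), intervalIntegral.integral_const_mul]
    at this
  rw [sub_self, sub_zero, Real.zero_rpow (show a + 1 ≠ 0 by linarith), zero_mul, zero_sub] at this
  unfold abel
  linarith

/-- The Abel integral of the Euler derivative `s f'(s)`. -/
theorem abel_euler {a : ℝ} (ha : -1 < a) {f : ℝ → ℝ} {y : ℝ} (hy : 0 < y)
    (hf : AnalyticOnNhd ℝ f (Icc 0 y)) :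
    abel a (fun s => s * deriv f s) y = y * deriv (abel a f) y - (a + 1) * abel a f y := by
  rw [(hasDerivAt_abel ha hy hf).deriv, abel_add ha hy.le (f := fun s => (a + 1) * f s)
    (g := fun s => s * deriv f s) (continuousOn_const.mul hf.continuousOn)
        (continuousOn_id.mul hf.deriv.continuousOn),
    abel_const_mul]
  field_simp
  ring

theorem hasDerivAt_abel_succ {a : ℝ} (ha : -1 < a) {g : ℝ → ℝ} {y : ℝ} (hy : 0 < y)
    (hg : AnalyticOnNhd ℝ g (Icc 0 y)) : HasDerivAt (abel (a + 1) g) ((a + 1) * abel a g y) y := by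
  have ha' : -1 < a + 1 := by linarith
  have h := hasDerivAt_abel ha' hy hg
  have h1 := abel_euler ha' hy hg
  have h2 := abel_id_mul ha' hy.le hg.deriv.continuousOn
  have h3 := integral_deriv_mul_rpow ha' hy hg
  have h4 := integral_deriv_mul_rpow ha hy hg
  have h5 : y * deriv (abel (a + 1) g) y = y * ((a + 1) * abel a g y) := by
    rw [h2, h3, h4, Real.rpow_add_one hy.ne' (a + 1)] at h1
    linarith
  rw [← mul_left_cancel₀ hy.ne' h5]
  exact h.differentiableAt.hasDerivAt

theorem iteratedDeriv_abel_succ {a : ℝ} (ha : -1 < a) (m : ℕ) {g : ℝ → ℝ} {y : ℝ} (hy : 0 < y)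
    (hg : AnalyticOnNhd ℝ g (Icc 0 y)) :
    iteratedDeriv (m + 1) (abel (a + 1) g) y = (a + 1) * iteratedDeriv m (abel a g) y := by
  rw [iteratedDeriv_succ', ← iteratedDeriv_const_mul_field]
  refine Filter.EventuallyEq.iteratedDeriv_eq m ?_
  filter_upwards [eventually_gt_nhds hy, eventually_analyticOnNhd_Icc hy hg] with z hz hgz
  exact (hasDerivAt_abel_succ ha hz hgz).deriv

theorem contDiffAt_iteratedDeriv {g : ℝ → ℝ} {x : ℝ} {j k m : ℕ} (hg : ContDiffAt ℝ k g x)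
    (h : j + m ≤ k) : ContDiffAt ℝ j (iteratedDeriv m g) x := by
  rw [iteratedDeriv_eq_equiv_comp]
  exact (LinearIsometryEquiv.contDiff _).contDiffAt.comp x
    (hg.iteratedFDeriv_right (by norm_cast))

theorem differentiableAt_iteratedDeriv {g : ℝ → ℝ} {x : ℝ} {k m : ℕ} (hg : ContDiffAt ℝ k g x)
    (h : m < k) : DifferentiableAt ℝ (iteratedDeriv m g) x :=
  (contDiffAt_iteratedDeriv (j := 1) hg (by omega)).differentiableAt (by simp)

/-- Leibniz rule for `(c + e y) g(y)`. -/
theorem iteratedDeriv_affine_mul (c e : ℝ) (m : ℕ) {g : ℝ → ℝ} {x : ℝ} (hg : ContDiffAt ℝ ∞ g x) :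
    iteratedDeriv (m + 1) (fun y => (c + e * y) * g y) x =
      (c + e * x) * iteratedDeriv (m + 1) g x + (m + 1) * e * iteratedDeriv m g x := by
  have hev : ∀ᶠ y in 𝓝 x, ContDiffAt ℝ ((m + 1 : ℕ) : WithTop ℕ∞) g y :=
    (hg.of_le (mod_cast le_top)).eventually (by simp)
  clear hg
  induction m generalizing x with
  | zero =>
    have h := hev.self_of_nhds
    have hd : HasDerivAt (fun y => (c + e * y) * g y) (e * g x + (c + e * x) * deriv g x) x := by
      have h1 : HasDerivAt (fun y => c + e * y) e x := by
        simpa using ((hasDerivAt_id x).const_mul e).const_add c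
      exact h1.mul (h.differentiableAt (by simp)).hasDerivAt
    simp [iteratedDeriv_one, hd.deriv]; ring
  | succ m ih =>
    rw [iteratedDeriv_succ]
    have h1 : iteratedDeriv (m + 1) (fun y => (c + e * y) * g y) =ᶠ[𝓝 x] fun y =>
        (c + e * y) * iteratedDeriv (m + 1) g y + (m + 1) * e * iteratedDeriv m g y := by
      filter_upwards [hev.eventually_nhds] with y hy
      exact ih (hy.mono fun z hz => hz.of_le (by exact_mod_cast Nat.le_succ _))
    rw [h1.deriv_eq]
    have hx := hev.self_of_nhds
    have d1 : HasDerivAt (iteratedDeriv (m + 1) g) (iteratedDeriv (m + 1 + 1) g x) x := by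
      rw [iteratedDeriv_succ (n := m + 1)]
      exact (differentiableAt_iteratedDeriv (k := m + 1 + 1) (m := m + 1) hx (by omega)).hasDerivAt
    have d0 : HasDerivAt (iteratedDeriv m g) (iteratedDeriv (m + 1) g x) x := by
      rw [iteratedDeriv_succ]
      exact (differentiableAt_iteratedDeriv (k := m + 1 + 1) (m := m) hx (by omega)).hasDerivAt
    have h2 : HasDerivAt (fun y => c + e * y) e x := by
      simpa using ((hasDerivAt_id x).const_mul e).const_add c
    have h3 := (h2.fun_mul d1).fun_add (d0.const_mul ((m + 1) * e))
    rw [h3.deriv]; push_cast; ring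

/-! ### Analytic dependence on parameters -/

@[fun_prop]
theorem _root_.AnalyticAt.prodFst {X Y Z : Type*} [NormedAddCommGroup X] [NormedSpace ℝ X]
    [NormedAddCommGroup Y] [NormedSpace ℝ Y] [NormedAddCommGroup Z] [NormedSpace ℝ Z]
    {f : X → Y × Z} {x : X} (hf : AnalyticAt ℝ f x) : AnalyticAt ℝ (fun x => (f x).1) x :=
  (ContinuousLinearMap.fst ℝ Y Z).analyticAt _ |>.comp hf

@[fun_prop]
theorem _root_.AnalyticAt.prodSnd {X Y Z : Type*} [NormedAddCommGroup X] [NormedSpace ℝ X]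
    [NormedAddCommGroup Y] [NormedSpace ℝ Y] [NormedAddCommGroup Z] [NormedSpace ℝ Z]
    {f : X → Y × Z} {x : X} (hf : AnalyticAt ℝ f x) : AnalyticAt ℝ (fun x => (f x).2) x :=
  (ContinuousLinearMap.snd ℝ Y Z).analyticAt _ |>.comp hf

theorem analyticAt_fderiv_apply {X : Type*} [NormedAddCommGroup X] [NormedSpace ℝ X]
    {f : X → ℝ} {x : X} (hf : AnalyticAt ℝ f x) (v : X) :
    AnalyticAt ℝ (fun y => fderiv ℝ f y v) x :=
  (ContinuousLinearMap.apply ℝ ℝ v).analyticAt _ |>.comp hf.fderiv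

/-- `Θ_m` applied in one variable preserves joint analyticity in all variables. -/
theorem thetaIter_param {X : Type*} [NormedAddCommGroup X] [NormedSpace ℝ X] (a : ℝ) (m : ℕ)
    {W : X × ℝ → ℝ} {q : X × ℝ} (hW : AnalyticAt ℝ W q) :
    AnalyticAt ℝ (fun q : X × ℝ => thetaIter a m (fun s => W (q.1, s)) q.2) q := by
  induction m generalizing q with
  | zero => simpa [thetaIter] using hW
  | succ m ih =>
    set G := fun q : X × ℝ => thetaIter a m (fun s => W (q.1, s)) q.2 with hG
    have h1 : AnalyticAt ℝ (fun q : X × ℝ => (a + 1 - m) * G q + q.2 * fderiv ℝ G q (0, 1)) q := by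
      have h3 := analyticAt_fderiv_apply (ih hW) (0, 1)
      have h4 := ih hW
      fun_prop
    refine h1.congr ?_
    filter_upwards [hW.eventually_analyticAt] with z hz
    have h5 : HasDerivAt (fun s => G (z.1, s)) (fderiv ℝ G z (0, 1)) z.2 :=
      (ih hz).differentiableAt.hasFDerivAt.comp_hasDerivAt (x := z.2) (f := fun s => (z.1, s))
        ((hasDerivAt_const z.2 z.1).prodMk (hasDerivAt_id _))
    simp only [thetaIter]
    rw [← h5.deriv]

theorem hasDerivAt_fst_of_analyticAt {G : ℝ × ℝ → ℝ} {e s : ℝ} (hG : AnalyticAt ℝ G (e, s)) :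
    HasDerivAt (fun ε => G (ε, s)) (fderiv ℝ G (e, s) (1, 0)) e :=
  hG.differentiableAt.hasFDerivAt.comp_hasDerivAt (x := e) (f := fun ε => (ε, s))
    ((hasDerivAt_id e).prodMk (hasDerivAt_const e s))

theorem hasDerivAt_snd_of_analyticAt {G : ℝ × ℝ → ℝ} {e s : ℝ} (hG : AnalyticAt ℝ G (e, s)) :
    HasDerivAt (fun s => G (e, s)) (fderiv ℝ G (e, s) (0, 1)) s :=
  hG.differentiableAt.hasFDerivAt.comp_hasDerivAt (x := s) (f := fun s => (e, s))
    ((hasDerivAt_const s e).prodMk (hasDerivAt_id s))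

theorem deriv_deriv_comm {G : ℝ × ℝ → ℝ} {e s : ℝ} (hG : AnalyticAt ℝ G (e, s)) :
    deriv (fun ε => deriv (fun s' => G (ε, s')) s) e =
      deriv (fun s' => deriv (fun ε => G (ε, s')) e) s := by
  have hev := hG.eventually_analyticAt
  have h1 : (fun ε => deriv (fun s' => G (ε, s')) s) =ᶠ[𝓝 e] fun ε => fderiv ℝ G (ε, s) (0, 1) := by
    have hc : ContinuousAt (fun ε : ℝ => (ε, s)) e := by fun_prop
    filter_upwards [hc.eventually hev] with ε hε using (hasDerivAt_snd_of_analyticAt hε).deriv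
  have h2 : (fun s' => deriv (fun ε => G (ε, s')) e) =ᶠ[𝓝 s] fun s' => fderiv ℝ G (e, s') (1,
      0) := by
    have hc : ContinuousAt (fun s' : ℝ => (e, s')) s := by fun_prop
    filter_upwards [hc.eventually hev] with ε hε using (hasDerivAt_fst_of_analyticAt hε).deriv
  have hd := hG.fderiv.differentiableAt.hasFDerivAt
  have h3 : HasDerivAt (fun ε => fderiv ℝ G (ε, s)) (fderiv ℝ (fderiv ℝ G) (e, s) (1, 0)) e :=
    hd.comp_hasDerivAt (x := e) (f := fun ε => (ε, s))
      ((hasDerivAt_id e).prodMk (hasDerivAt_const e s))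
  have h4 : HasDerivAt (fun s' => fderiv ℝ G (e, s')) (fderiv ℝ (fderiv ℝ G) (e, s) (0, 1)) s :=
    hd.comp_hasDerivAt (x := s) (f := fun s' => (e, s'))
      ((hasDerivAt_const s e).prodMk (hasDerivAt_id s))
  have h3' := h3.clm_apply (hasDerivAt_const e ((0, 1) : ℝ × ℝ))
  have h4' := h4.clm_apply (hasDerivAt_const s ((1, 0) : ℝ × ℝ))
  rw [h1.deriv_eq, h2.deriv_eq, h3'.deriv, h4'.deriv]
  simp only [map_zero, add_zero]
  exact (ContDiffAt.isSymmSndFDerivAt_of_omega hG.contDiffAt).eq _ _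

/-- `Θ_m` commutes with differentiation in a parameter. -/
theorem deriv_thetaIter (a : ℝ) (m : ℕ) {W : ℝ × ℝ → ℝ} {e s : ℝ} (hW : AnalyticAt ℝ W (e, s)) :
    deriv (fun ε => thetaIter a m (fun s => W (ε, s)) s) e =
      thetaIter a m (fun s => deriv (fun ε => W (ε, s)) e) s := by
  induction m generalizing s with
  | zero => rfl
  | succ m ih =>
    have hG := thetaIter_param a m hW
    have h1 := hasDerivAt_fst_of_analyticAt hG
    have hdd := deriv_deriv_comm hG
    simp only at hdd h1
    have h3 : DifferentiableAt ℝ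
        (fun ε => deriv (fun s' => thetaIter a m (fun s => W (ε, s)) s') s) e := by
      have hfd := hG.fderiv.differentiableAt.clm_apply (differentiableAt_const ((0, 1) : ℝ × ℝ))
      have hc : ContinuousAt (fun ε : ℝ => (ε, s)) e := by fun_prop
      have hcd : DifferentiableAt ℝ (fun ε : ℝ => (ε, s)) e := by fun_prop
      refine (hfd.comp e (f := fun ε : ℝ => (ε, s)) hcd).congr_of_eventuallyEq ?_
      filter_upwards [hc.eventually hG.eventually_analyticAt] with ε hε
      exact (hasDerivAt_snd_of_analyticAt hε).deriv
    simp only [thetaIter]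
    rw [deriv_fun_add (h1.differentiableAt.const_mul _) (h3.const_mul _),
      deriv_const_mul_field, deriv_const_mul_field, ih hW, hdd]
    congr 2
    refine Filter.EventuallyEq.deriv_eq ?_
    have hc : ContinuousAt (fun s' : ℝ => (e, s')) s := by fun_prop
    filter_upwards [hc.eventually hW.eventually_analyticAt] with s' hs' using ih hs'

/-! ### Riemann-Liouville operators on analytic functions -/

/-- The exponent `[p] - p` of the kernel. -/
def rlExp (p : ℝ) : ℝ := (rlFloor p : ℝ) - p

/-- The order `[p] + 1` of the outer derivative. -/
def rlOrd (p : ℝ) : ℕ := (rlFloor p + 1).toNat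

theorem riemannLiouville_eq (p : ℝ) (f : ℝ → ℝ) (x : ℝ) :
    riemannLiouville 0 p f x =
      (Real.Gamma (rlExp p + 1))⁻¹ * iteratedDeriv (rlOrd p) (abel (rlExp p) f) x := by
  unfold riemannLiouville rlExp rlOrd abel
  rw [show 1 + (rlFloor p : ℝ) - p = (rlFloor p : ℝ) - p + 1 by ring]

theorem rlFloor_add_one {p : ℝ} (hp : 0 ≤ p) : rlFloor (p + 1) = rlFloor p + 1 := by
  simp [rlFloor, hp, show 0 ≤ p + 1 by linarith]

theorem rlFloor_nonneg {p : ℝ} (hp : 0 ≤ p) : 0 ≤ rlFloor p := by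
  simp [rlFloor, hp, Int.floor_nonneg]

theorem rlExp_gt {p : ℝ} (hp : 0 ≤ p) : -1 < rlExp p := by
  have := Int.lt_floor_add_one p
  simp only [rlExp, rlFloor, hp, if_true]; linarith

theorem rlExp_add_one {p : ℝ} (hp : 0 ≤ p) : rlExp (p + 1) = rlExp p := by
  simp [rlExp, rlFloor_add_one hp]

theorem rlOrd_add_one {p : ℝ} (hp : 0 ≤ p) : rlOrd (p + 1) = rlOrd p + 1 := by
  have := rlFloor_nonneg hp
  simp only [rlOrd, rlFloor_add_one hp]; omega

/-- The order of the outer derivative exceeds the exponent of the kernel by `p + 1`. -/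
theorem rlOrd_cast {p : ℝ} (hp : 0 ≤ p) : (rlOrd p : ℝ) = rlExp p + p + 1 := by
  have h : ((rlOrd p : ℕ) : ℤ) = rlFloor p + 1 := by
    have := rlFloor_nonneg hp
    simp only [rlOrd]; omega
  have h2 : ((rlOrd p : ℕ) : ℝ) = ((rlFloor p + 1 : ℤ) : ℝ) := by exact_mod_cast congrArg (Int.cast (R := ℝ)) h
  rw [h2, rlExp]; push_cast; ring

theorem rlOrd_pos {p : ℝ} (hp : 0 ≤ p) : 0 < rlOrd p := by
  have := rlFloor_nonneg hp
  simp only [rlOrd]; omega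

theorem rlOrd_eq {p : ℝ} (hp : 0 ≤ p) : rlOrd p = ⌊p⌋₊ + 1 := by
  have := Int.natCast_floor_eq_floor hp
  simp only [rlOrd, rlFloor, hp, if_true]; omega

theorem gamma_rlExp_pos {p : ℝ} (hp : 0 ≤ p) : 0 < Real.Gamma (rlExp p + 1) :=
  Real.Gamma_pos_of_pos (by have := rlExp_gt hp; linarith)

/-- `D^p f (x)` depends only on the values of `f` on `(0, y)` for `y` near `x`. -/
theorem riemannLiouville_congr {p : ℝ} {f g : ℝ → ℝ} {x : ℝ} (hx : 0 < x)
    (h : ∀ᶠ y in 𝓝 x, ∀ s ∈ Ioo 0 y, f s = g s) :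
    riemannLiouville 0 p f x = riemannLiouville 0 p g x := by
  rw [riemannLiouville_eq, riemannLiouville_eq]
  congr 1
  refine Filter.EventuallyEq.iteratedDeriv_eq _ ?_
  filter_upwards [h, eventually_gt_nhds hx] with y hy hy0
  unfold abel
  refine intervalIntegral.integral_congr_ae ?_
  filter_upwards [Measure.ae_ne volume y] with s hs hs'
  rw [uIoc_of_le hy0.le] at hs'
  rw [hy s ⟨hs'.1, lt_of_le_of_ne hs'.2 hs⟩]

theorem riemannLiouville_const_mul (p c : ℝ) (f : ℝ → ℝ) (x : ℝ) :
    riemannLiouville 0 p (fun s => c * f s) x = c * riemannLiouville 0 p f x := by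
  rw [riemannLiouville_eq, riemannLiouville_eq, abel_const_mul, iteratedDeriv_const_mul_field]
  ring

theorem riemannLiouville_add {p : ℝ} (hp : 0 ≤ p) {f g : ℝ → ℝ} {x : ℝ} (hx : 0 < x)
    (hf : AnalyticOnNhd ℝ f (Icc 0 x)) (hg : AnalyticOnNhd ℝ g (Icc 0 x)) :
    riemannLiouville 0 p (fun s => f s + g s) x =
      riemannLiouville 0 p f x + riemannLiouville 0 p g x := by
  have ha := rlExp_gt hp
  rw [riemannLiouville_eq, riemannLiouville_eq, riemannLiouville_eq, ← mul_add]
  congr 1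
  rw [← iteratedDeriv_fun_add ((contDiffAt_abel ha hx hf).of_le (mod_cast le_top))
    ((contDiffAt_abel ha hx hg).of_le (mod_cast le_top))]
  refine Filter.EventuallyEq.iteratedDeriv_eq _ ?_
  filter_upwards [eventually_gt_nhds hx, eventually_analyticOnNhd_Icc hx hf,
    eventually_analyticOnNhd_Icc hx hg] with y hy h1 h2
  exact abel_add ha hy.le h1.continuousOn h2.continuousOn

theorem riemannLiouville_sub {p : ℝ} (hp : 0 ≤ p) {f g : ℝ → ℝ} {x : ℝ} (hx : 0 < x)
    (hf : AnalyticOnNhd ℝ f (Icc 0 x)) (hg : AnalyticOnNhd ℝ g (Icc 0 x)) :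
    riemannLiouville 0 p (fun s => f s - g s) x =
      riemannLiouville 0 p f x - riemannLiouville 0 p g x := by
  have h := riemannLiouville_add hp hx hf (g := fun s => (-1) * g s)
    (fun s hs => by have := hg s hs; fun_prop)
  rw [riemannLiouville_const_mul] at h
  simp only [neg_one_mul, ← sub_eq_add_neg] at h
  exact h

theorem hasDerivAt_riemannLiouville {p : ℝ} (hp : 0 ≤ p) {f : ℝ → ℝ} {x : ℝ} (hx : 0 < x)
    (hf : AnalyticOnNhd ℝ f (Icc 0 x)) :
    HasDerivAt (riemannLiouville 0 p f) (riemannLiouville 0 (p + 1) f x) x := by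
  have h1 : DifferentiableAt ℝ (iteratedDeriv (rlOrd p) (abel (rlExp p) f)) x :=
    differentiableAt_iteratedDeriv (k := rlOrd p + 1)
      ((contDiffAt_abel (rlExp_gt hp) hx hf).of_le (mod_cast le_top)) (Nat.lt_succ_self _)
  have h2 := h1.hasDerivAt.const_mul (Real.Gamma (rlExp p + 1))⁻¹
  rw [← iteratedDeriv_succ] at h2
  rw [riemannLiouville_eq (p + 1), rlExp_add_one hp, rlOrd_add_one hp]
  exact h2.congr_of_eventuallyEq (Eventually.of_forall fun y => riemannLiouville_eq p f y)

/-- `D^p` as a weighted integral over a fixed interval, without outer derivatives. -/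
theorem riemannLiouville_scaled {p : ℝ} (hp : 0 ≤ p) {f : ℝ → ℝ} {x : ℝ} (hx : 0 < x)
    (hf : AnalyticOnNhd ℝ f (Icc 0 x)) :
    riemannLiouville 0 p f x = (Real.Gamma (rlExp p + 1))⁻¹ * (x ^ rlOrd p)⁻¹ * x ^ (rlExp p + 1) *
      ∫ σ in (0 : ℝ)..1, (1 - σ) ^ rlExp p * thetaIter (rlExp p) (rlOrd p) f (x * σ) := by
  rw [riemannLiouville_eq, iteratedDeriv_abel (rlExp_gt hp) _ hx hf, abel_eq_scaled _ _ hx]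
  ring

theorem eventually_analyticOnNhd_Icc_param {X : Type*} [NormedAddCommGroup X] [NormedSpace ℝ X]
    {W : X × ℝ → ℝ} {h : X} {x : ℝ} (hx : 0 < x) (hW : ∀ s ∈ Icc (0 : ℝ) x, AnalyticAt ℝ W (h, s)) :
    ∀ᶠ q : X × ℝ in 𝓝 (h, x), ∀ s ∈ Icc (0 : ℝ) q.2, AnalyticAt ℝ W (q.1, s) := by
  have hW' : ∀ σ ∈ Icc (0 : ℝ) 1, ∀ᶠ z : (X × ℝ) × ℝ in 𝓝 ((h, x), σ),
      AnalyticAt ℝ W (z.1.1, z.1.2 * z.2) := by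
    intro σ hσ
    have h1 : AnalyticAt ℝ W (h, x * σ) :=
      hW _ ⟨by have := hσ.1; positivity, by nlinarith [hσ.2]⟩
    have hc : ContinuousAt (fun z : (X × ℝ) × ℝ => (z.1.1, z.1.2 * z.2)) ((h, x), σ) := by fun_prop
    exact hc.eventually h1.eventually_analyticAt
  have hpos : ∀ᶠ q : X × ℝ in 𝓝 (h, x), 0 < q.2 :=
    continuousAt_snd.eventually (eventually_gt_nhds hx)
  filter_upwards [isCompact_Icc.eventually_forall_of_forall_eventually
    (P := fun (q : X × ℝ) (σ : ℝ) => AnalyticAt ℝ W (q.1, q.2 * σ)) hW', hpos] with q hq hq0 s hs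
  have := hq (s / q.2) ⟨by have := hs.1; positivity, by rw [div_le_one hq0]; exact hs.2⟩
  rwa [mul_div_cancel₀ _ hq0.ne'] at this

theorem analyticOnNhd_slice {X : Type*} [NormedAddCommGroup X] [NormedSpace ℝ X]
    {W : X × ℝ → ℝ} {h : X} {K : Set ℝ} (hW : ∀ s ∈ K, AnalyticAt ℝ W (h, s)) :
    AnalyticOnNhd ℝ (fun s => W (h, s)) K := fun s hs =>
  (hW s hs).comp (f := fun s => (h, s)) (by fun_prop)

/-- Joint differentiability of a Riemann-Liouville derivative in the variable and in parameters. -/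
theorem differentiableAt_riemannLiouville_param {X : Type*} [NormedAddCommGroup X]
    [NormedSpace ℝ X] {p : ℝ} (hp : 0 ≤ p) {W : X × ℝ → ℝ} {h : X} {x : ℝ} (hx : 0 < x)
    (hW : ∀ s ∈ Icc (0 : ℝ) x, AnalyticAt ℝ W (h, s)) :
    DifferentiableAt ℝ (fun q : X × ℝ => riemannLiouville 0 p (fun s => W (q.1, s)) q.2) (h,
        x) := by
  set a := rlExp p with hadef
  have ha : -1 < a := rlExp_gt hp
  have h1 : ∀ σ ∈ Icc (0 : ℝ) 1, AnalyticAt ℝ (fun z : (X × ℝ) × ℝ =>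
      thetaIter a (rlOrd p) (fun s => W (z.1.1, s)) (z.1.2 * z.2)) ((h, x), σ) := by
    intro σ hσ
    have h2 := thetaIter_param a (rlOrd p)
      (hW (x * σ) ⟨by have := hσ.1; positivity, by nlinarith [hσ.2]⟩)
    exact h2.comp_of_eq (f := fun z : (X × ℝ) × ℝ => (z.1.1, z.1.2 * z.2)) (by fun_prop) rfl
  have h2 := (hasFDerivAt_weighted_integral ha h1).1.differentiableAt
  have h3 : DifferentiableAt ℝ (fun q : X × ℝ =>
      (Real.Gamma (a + 1))⁻¹ * (q.2 ^ rlOrd p)⁻¹ * q.2 ^ (a + 1)) (h, x) := by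
    refine DifferentiableAt.fun_mul (DifferentiableAt.const_mul ?_ _) ?_
    · exact DifferentiableAt.fun_inv (by fun_prop) (pow_ne_zero _ hx.ne')
    · exact DifferentiableAt.rpow_const (by fun_prop) (Or.inl hx.ne')
  refine (h3.fun_mul h2).congr_of_eventuallyEq ?_
  have hpos : ∀ᶠ q : X × ℝ in 𝓝 (h, x), 0 < q.2 :=
    continuousAt_snd.eventually (eventually_gt_nhds hx)
  filter_upwards [eventually_analyticOnNhd_Icc_param hx hW, hpos] with q hq hq0
  exact riemannLiouville_scaled hp hq0 (analyticOnNhd_slice hq)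

/-- Differentiation of a Riemann-Liouville derivative with respect to a parameter. -/
theorem hasDerivAt_riemannLiouville_param {p : ℝ} (hp : 0 ≤ p) {W : ℝ × ℝ → ℝ} {e x : ℝ}
    (hx : 0 < x) (hW : ∀ s ∈ Icc (0 : ℝ) x, AnalyticAt ℝ W (e, s)) :
    HasDerivAt (fun ε => riemannLiouville 0 p (fun s => W (ε, s)) x)
      (riemannLiouville 0 p (fun s => deriv (fun ε => W (ε, s)) e) x) e := by
  set a := rlExp p with hadef
  have ha : -1 < a := rlExp_gt hp
  have hmem : ∀ σ ∈ Icc (0 : ℝ) 1, x * σ ∈ Icc 0 x := fun σ hσ =>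
    ⟨by have := hσ.1; positivity, by nlinarith [hσ.2]⟩
  have h1 : ∀ σ ∈ Icc (0 : ℝ) 1, AnalyticAt ℝ (fun z : ℝ × ℝ =>
      thetaIter a (rlOrd p) (fun s => W (z.1, s)) (x * z.2)) (e, σ) := by
    intro σ hσ
    have h2 := thetaIter_param a (rlOrd p) (hW (x * σ) (hmem σ hσ))
    exact h2.comp_of_eq (f := fun z : ℝ × ℝ => (z.1, x * z.2)) (by fun_prop) rfl
  obtain ⟨h2, h2i⟩ := hasFDerivAt_weighted_integral ha h1
  have h3 := h2.hasDerivAt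
  rw [ContinuousLinearMap.intervalIntegral_apply h2i] at h3
  have h4 : AnalyticOnNhd ℝ (fun s => deriv (fun ε => W (ε, s)) e) (Icc 0 x) := by
    intro s hs
    have h5 : AnalyticAt ℝ (fun s => fderiv ℝ W (e, s) (1, 0)) s :=
      (analyticAt_fderiv_apply (hW s hs) (1, 0)).comp (f := fun s : ℝ => (e, s)) (by fun_prop)
    refine h5.congr ?_
    have hc : ContinuousAt (fun s' : ℝ => (e, s')) s := by fun_prop
    filter_upwards [hc.eventually (hW s hs).eventually_analyticAt] with s' hs'
    exact (hasDerivAt_fst_of_analyticAt hs').deriv.symm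
  rw [riemannLiouville_scaled hp hx h4]
  have h5 : (∫ σ in (0 : ℝ)..1, (1 - σ) ^ a *
      thetaIter a (rlOrd p) (fun s => deriv (fun ε => W (ε, s)) e) (x * σ)) =
      ∫ σ in (0 : ℝ)..1, ((1 - σ) ^ a • (fderiv ℝ (fun z : ℝ × ℝ =>
      thetaIter a (rlOrd p) (fun s => W (z.1, s)) (x * z.2)) (e, σ)).comp
      (ContinuousLinearMap.inl ℝ ℝ ℝ)) 1 := by
    refine intervalIntegral.integral_congr fun σ hσ => ?_
    rw [uIcc_of_le zero_le_one] at hσ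
    have := (hasDerivAt_fst_of_analyticAt (h1 σ hσ)).deriv
    simp only at this
    simp only [← deriv_thetaIter a (rlOrd p) (hW (x * σ) (hmem σ hσ)), this]
    simp
  rw [← hadef, h5]
  refine (h3.const_mul _).congr_of_eventuallyEq ?_
  have hc : ContinuousAt (fun ε : ℝ => (ε, x)) e := by fun_prop
  filter_upwards [hc.eventually (eventually_analyticOnNhd_Icc_param hx hW)] with ε hε
  exact riemannLiouville_scaled hp hx (analyticOnNhd_slice hε)

/-- `D^p (s f') = x D^(p+1) f + p D^p f`. -/
theorem riemannLiouville_euler {p : ℝ} (hp : 0 ≤ p) {f : ℝ → ℝ} {x : ℝ} (hx : 0 < x)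
    (hf : AnalyticOnNhd ℝ f (Icc 0 x)) :
    riemannLiouville 0 p (fun s => s * deriv f s) x =
      x * riemannLiouville 0 (p + 1) f x + p * riemannLiouville 0 p f x := by
  have ha := rlExp_gt hp
  have hord := rlOrd_cast hp
  rw [riemannLiouville_eq, riemannLiouville_eq, riemannLiouville_eq, rlExp_add_one hp,
    rlOrd_add_one hp]
  set a := rlExp p
  obtain ⟨m, hm⟩ : ∃ m, rlOrd p = m + 1 := ⟨rlOrd p - 1, by have := rlOrd_pos hp; omega⟩
  rw [hm] at hord ⊢
  have hs := contDiffAt_abel ha hx hf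
  have hs' : ContDiffAt ℝ ∞ (deriv (abel a f)) x := by
    rw [contDiffAt_infty]
    intro k
    have := contDiffAt_iteratedDeriv (j := k) (m := 1) (k := k + 1)
      (hs.of_le (mod_cast le_top)) le_rfl
    rwa [iteratedDeriv_one] at this
  have h1 : iteratedDeriv (m + 1) (abel a fun s => s * deriv f s) x =
      iteratedDeriv (m + 1) (fun y => (0 + 1 * y) * deriv (abel a f) y -
          (a + 1) * abel a f y) x := by
    refine Filter.EventuallyEq.iteratedDeriv_eq _ ?_
    filter_upwards [eventually_gt_nhds hx, eventually_analyticOnNhd_Icc hx hf] with y hy hfy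
    rw [abel_euler ha hy hfy]; ring
  have hsm : ContDiffAt ℝ ∞ (fun y : ℝ => 0 + 1 * y) x := by fun_prop
  rw [h1, iteratedDeriv_fun_sub ((hsm.mul hs').of_le (mod_cast le_top))
    ((contDiffAt_const.mul hs).of_le (mod_cast le_top)), iteratedDeriv_const_mul_field,
    iteratedDeriv_affine_mul 0 1 m hs', ← iteratedDeriv_succ', ← iteratedDeriv_succ']
  push_cast at hord
  linear_combination ((Real.Gamma (a + 1))⁻¹ * iteratedDeriv (m + 1) (abel a f) x) * hord

/-- The projective identity `D^p ((p - 1) s f - s² f') = - x² D^(p+1) f - (p + 1) x D^p f`. -/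
theorem riemannLiouville_projective {p : ℝ} (hp : 0 ≤ p) {f : ℝ → ℝ} {x : ℝ} (hx : 0 < x)
    (hf : AnalyticOnNhd ℝ f (Icc 0 x)) :
    riemannLiouville 0 p (fun s => (p - 1) * (s * f s) - s * (s * deriv f s)) x =
      -(x ^ 2 * riemannLiouville 0 (p + 1) f x) - (p + 1) * x * riemannLiouville 0 p f x := by
  have ha := rlExp_gt hp
  have hord := rlOrd_cast hp
  -- Leibniz rule for multiplication by `s` under the Abel integral
  have key : ∀ {g : ℝ → ℝ}, AnalyticOnNhd ℝ g (Icc 0 x) → ∀ m,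
      iteratedDeriv (m + 1) (abel (rlExp p) fun s => s * g s) x =
        x * iteratedDeriv (m + 1) (abel (rlExp p) g) x +
          (m - rlExp p) * iteratedDeriv m (abel (rlExp p) g) x := by
    intro g hg m
    have hs := contDiffAt_abel ha hx hg
    have hs1 := contDiffAt_abel (show -1 < rlExp p + 1 by linarith) hx hg
    have hsm : ContDiffAt ℝ ∞ (fun y : ℝ => 0 + 1 * y) x := by fun_prop
    have h1 : iteratedDeriv (m + 1) (abel (rlExp p) fun s => s * g s) x =
        iteratedDeriv (m + 1) (fun y => (0 + 1 * y) * abel (rlExp p) g y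
          - abel (rlExp p + 1) g y) x := by
      refine Filter.EventuallyEq.iteratedDeriv_eq _ ?_
      filter_upwards [eventually_gt_nhds hx, eventually_analyticOnNhd_Icc hx hg] with y hy hgy
      rw [abel_id_mul ha hy.le hgy.continuousOn]; ring
    rw [h1, iteratedDeriv_fun_sub ((hsm.mul hs).of_le (mod_cast le_top))
      (hs1.of_le (mod_cast le_top)), iteratedDeriv_affine_mul 0 1 m hs,
      iteratedDeriv_abel_succ ha m hx hg]
    ring
  have hg : AnalyticOnNhd ℝ (fun s => s * deriv f s) (Icc 0 x) := fun s hs => by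
    have := hf s hs; fun_prop
  have hg1 : AnalyticOnNhd ℝ (fun s => s * f s) (Icc 0 x) := fun s hs => by
    have := hf s hs; fun_prop
  have hg2 : AnalyticOnNhd ℝ (fun s => s * (s * deriv f s)) (Icc 0 x) := fun s hs => by
    have := hf s hs; fun_prop
  rw [riemannLiouville_sub hp hx (f := fun s => (p - 1) * (s * f s))
    (fun s hs => analyticAt_const.mul (hg1 s hs)) hg2,
    riemannLiouville_const_mul]
  have he := riemannLiouville_euler hp hx hf
  simp only [riemannLiouville_eq, rlExp_add_one hp, rlOrd_add_one hp] at he ⊢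
  obtain ⟨m, hm⟩ : ∃ m, rlOrd p = m + 1 := ⟨rlOrd p - 1, by have := rlOrd_pos hp; omega⟩
  rw [hm] at hord he ⊢
  rw [key hg m, key hf m]
  -- the Euler identity with one outer derivative less
  have he' : iteratedDeriv m (abel (rlExp p) fun s => s * deriv f s) x =
      x * iteratedDeriv (m + 1) (abel (rlExp p) f) x +
        (m - rlExp p - 1) * iteratedDeriv m (abel (rlExp p) f) x := by
    have hs := contDiffAt_abel ha hx hf
    have hs' : ContDiffAt ℝ ∞ (deriv (abel (rlExp p) f)) x := by
      rw [contDiffAt_infty]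
      intro k
      have := contDiffAt_iteratedDeriv (j := k) (m := 1) (k := k + 1)
        (hs.of_le (mod_cast le_top)) le_rfl
      rwa [iteratedDeriv_one] at this
    have h1 : iteratedDeriv m (abel (rlExp p) fun s => s * deriv f s) x =
        iteratedDeriv m (fun y => (0 + 1 * y) * deriv (abel (rlExp p) f) y
          - (rlExp p + 1) * abel (rlExp p) f y) x := by
      refine Filter.EventuallyEq.iteratedDeriv_eq _ ?_
      filter_upwards [eventually_gt_nhds hx, eventually_analyticOnNhd_Icc hx hf] with y hy hfy
      rw [abel_euler ha hy hfy]; ring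
    have hsm : ContDiffAt ℝ ∞ (fun y : ℝ => 0 + 1 * y) x := by fun_prop
    rw [h1, iteratedDeriv_fun_sub ((hsm.mul hs').of_le (mod_cast le_top))
      ((contDiffAt_const.mul hs).of_le (mod_cast le_top)), iteratedDeriv_const_mul_field]
    cases m with
    | zero => simp; ring
    | succ k =>
      rw [iteratedDeriv_affine_mul 0 1 k hs', ← iteratedDeriv_succ', ← iteratedDeriv_succ']
      push_cast; ring
  push_cast at hord
  have hG := gamma_rlExp_pos hp
  have he2 : iteratedDeriv (m + 1) (abel (rlExp p) fun s => s * deriv f s) x =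
      x * iteratedDeriv (m + 1 + 1) (abel (rlExp p) f) x +
        p * iteratedDeriv (m + 1) (abel (rlExp p) f) x := by
    have : (Real.Gamma (rlExp p + 1))⁻¹ ≠ 0 := inv_ne_zero hG.ne'
    apply mul_left_cancel₀ this
    rw [he]; ring
  rw [he', he2]
  have hm' : (m : ℝ) = rlExp p + p := by linarith
  rw [hm']
  ring

/-- A factor vanishing at the endpoint `x` absorbs one of the derivatives taken at `x`. -/
theorem iteratedDeriv_abel_sub_mul {a : ℝ} (ha : -1 < a) (m : ℕ) {g : ℝ → ℝ} {x : ℝ} (hx : 0 < x)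
    (hg : AnalyticOnNhd ℝ g (Icc 0 x)) :
    iteratedDeriv (m + 1) (abel a fun s => (x - s) * g s) x =
      (a - m) * iteratedDeriv m (abel a g) x := by
  have hs := contDiffAt_abel ha hx hg
  have hs1 := contDiffAt_abel (show -1 < a + 1 by linarith) hx hg
  have hsm : ContDiffAt ℝ ∞ (fun y : ℝ => x + (-1) * y) x := by fun_prop
  have h1 : iteratedDeriv (m + 1) (abel a fun s => (x - s) * g s) x =
      iteratedDeriv (m + 1) (fun y => (x + (-1) * y) * abel a g y + abel (a + 1) g y) x := by
    refine Filter.EventuallyEq.iteratedDeriv_eq _ ?_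
    filter_upwards [eventually_gt_nhds hx, eventually_analyticOnNhd_Icc hx hg] with y hy hgy
    rw [abel_succ_apply ha hy.le hgy.continuousOn]; ring
  rw [h1, iteratedDeriv_fun_add ((hsm.mul hs).of_le (mod_cast le_top))
    (hs1.of_le (mod_cast le_top)), iteratedDeriv_affine_mul x (-1) m hs,
    iteratedDeriv_abel_succ ha m hx hg]
  ring

theorem iteratedDeriv_abel_sub_pow_mul {a : ℝ} (ha : -1 < a) (m : ℕ) {g : ℝ → ℝ} {x : ℝ}
    (hx : 0 < x) (hg : AnalyticOnNhd ℝ g (Icc 0 x)) :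
    iteratedDeriv m (abel a fun s => (x - s) ^ m * g s) x =
      (∏ j ∈ Finset.range m, (a - j)) * abel a g x := by
  induction m with
  | zero => simp
  | succ m ih =>
    have h := iteratedDeriv_abel_sub_mul ha m hx (g := fun s => (x - s) ^ m * g s)
      (fun s hs => by have := hg s hs; fun_prop)
    rw [ih] at h
    rw [Finset.prod_range_succ, mul_comm _ (a - m), mul_assoc, ← h]
    congr 2; funext s; ring

/-- On functions vanishing to high order at `x`, the Riemann-Liouville derivatives of orders `p`
and `p + 1` at `x` are proper integrals with proportional kernels. -/
theorem riemannLiouville_sub_pow_mul {p : ℝ} (hp : 0 < p ∧ ∀ n : ℕ, p ≠ n) :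
    ∃ c : ℝ, c ≠ 0 ∧ ∀ {x : ℝ}, 0 < x → ∀ {g : ℝ → ℝ}, AnalyticOnNhd ℝ g (Icc 0 x) →
      riemannLiouville 0 p (fun s => (x - s) ^ rlOrd p * g s) x = c * abel (rlExp p) g x ∧
      riemannLiouville 0 (p + 1) (fun s => (x - s) ^ (rlOrd p + 1) * g s) x =
        -(p + 1) * c * abel (rlExp p) g x := by
  have ha := rlExp_gt hp.1.le
  have hord := rlOrd_cast hp.1.le
  have hG := gamma_rlExp_pos hp.1.le
  refine ⟨(Real.Gamma (rlExp p + 1))⁻¹ * ∏ j ∈ Finset.range (rlOrd p), (rlExp p - j), ?_, ?_⟩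
  -- a vanishing factor `[p] - p - j` would make `p` the natural number `[p] - j`
  · refine mul_ne_zero (inv_ne_zero hG.ne') (Finset.prod_ne_zero_iff.2 fun j hj h => ?_)
    rw [Finset.mem_range] at hj
    refine hp.2 (rlOrd p - 1 - j) ?_
    rw [Nat.cast_sub (by omega), Nat.cast_sub (by omega)]
    push_cast; linarith
  · intro x hx g hg
    rw [riemannLiouville_eq, riemannLiouville_eq, rlExp_add_one hp.1.le, rlOrd_add_one hp.1.le,
      iteratedDeriv_abel_sub_pow_mul ha _ hx hg, iteratedDeriv_abel_sub_pow_mul ha _ hx hg,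
      Finset.prod_range_succ, hord]
    constructor <;> ring

/-- The kernel of the Abel integral is positive, so the integral of a square detects zero. -/
theorem eqOn_zero_of_abel_sq {a : ℝ} (ha : -1 < a) {g : ℝ → ℝ} {x : ℝ} (hx : 0 < x)
    (hg : ContinuousOn g (Icc 0 x)) (h : abel a (fun s => g s * g s) x = 0) :
    ∀ s ∈ Icc 0 x, g s = 0 := by
  have hi := intervalIntegrable_abel ha hx.le (hg.mul hg)
  have h0 : 0 ≤ᵐ[volume.restrict (Ioc 0 x)] fun s => (x - s) ^ a * (g s * g s) := by
    filter_upwards [ae_restrict_mem measurableSet_Ioc] with s hs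
    exact mul_nonneg (Real.rpow_nonneg (by linarith [hs.2]) _) (mul_self_nonneg _)
  have h1 := (intervalIntegral.integral_eq_zero_iff_of_le_of_nonneg_ae hx.le h0 hi).1 h
  have h2 : g =ᵐ[volume.restrict (Icc 0 x)] fun _ => 0 := by
    rw [← restrict_Ioc_eq_restrict_Icc]
    filter_upwards [h1, ae_restrict_mem measurableSet_Ioc,
      ae_restrict_of_ae (Measure.ae_ne volume x)] with s hs hm hne
    have : 0 < (x - s) ^ a := Real.rpow_pos_of_pos (by
      have := lt_of_le_of_ne hm.2 hne; linarith) _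
    simpa [this.ne'] using hs
  exact Measure.eqOn_Icc_of_ae_eq volume hx.ne h2 hg continuousOn_const

section

/-! ### Riemann-Liouville derivatives along segments -/

variable {N : ℕ}

@[fun_prop]
theorem analyticAt_piApply {ι : Type*} [Fintype ι] (i : ι) (x : ι → ℝ) :
    AnalyticAt ℝ (fun x : ι → ℝ => x i) x :=
  (ContinuousLinearMap.proj (R := ℝ) (φ := fun _ : ι => ℝ) i).analyticAt _

/-- Evaluation of an analytic family of linear forms at an analytic family of vectors. -/
theorem analyticAt_clm_apply {X Y : Type*} [NormedAddCommGroup X] [NormedSpace ℝ X]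
    [NormedAddCommGroup Y] [NormedSpace ℝ Y] {L : X → Y →L[ℝ] ℝ} {g : X → Y} {x : X}
    (hL : AnalyticAt ℝ L x) (hg : AnalyticAt ℝ g x) : AnalyticAt ℝ (fun y => L y (g y)) x :=
  ((ContinuousLinearMap.id ℝ (Y →L[ℝ] ℝ)).analyticAt_bilinear (L x, g x)).comp
    (f := fun y => (L y, g y)) (AnalyticAt.prod hL hg)

/-- The coordinate vector `∂_{x_i}`. -/
def dir (i : Fin N) : Base N := (0, Pi.single i 1)

/-- The line through `P` in the direction `x_i`, parametrised by the value of `x_i`. -/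
def seg (P : Base N) (i : Fin N) (s : ℝ) : Base N := (P.1, Function.update P.2 i s)

theorem seg_eq (P : Base N) (i : Fin N) (s : ℝ) : seg P i s = P + (s - P.2 i) • dir i := by
  refine Prod.ext (by simp [seg, dir]) (funext fun j => ?_)
  rcases eq_or_ne j i with rfl | h
  · simp [seg, dir]
  · simp [seg, dir, h]

@[simp] theorem seg_self (P : Base N) (i : Fin N) : seg P i (P.2 i) = P := by simp [seg]

@[simp] theorem seg_fst (P : Base N) (i : Fin N) (s : ℝ) : (seg P i s).1 = P.1 := rfl

@[simp] theorem seg_snd_self (P : Base N) (i : Fin N) (s : ℝ) : (seg P i s).2 i = s := by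
  simp [seg]

theorem seg_snd_of_ne (P : Base N) {i j : Fin N} (h : j ≠ i) (s : ℝ) :
    (seg P i s).2 j = P.2 j := by simp [seg, h]

@[simp] theorem seg_seg (P : Base N) (i : Fin N) (s s' : ℝ) :
    seg (seg P i s) i s' = seg P i s' := by simp [seg]

theorem seg_add_smul (P w : Base N) {i : Fin N} (hw : w.2 i = 0) (h s : ℝ) :
    seg (P + h • w) i s = seg P i s + h • w := by
  refine Prod.ext (by simp [seg]) (funext fun j => ?_)
  rcases eq_or_ne j i with rfl | hj
  · simp [seg, hw]
  · simp [seg, hj]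

theorem seg_mem_box {P : Base N} (hP : ∀ i, 0 < P.2 i) (i : Fin N) {s : ℝ}
    (hs : s ∈ Icc 0 (P.2 i)) : seg P i s ∈ box P := by
  refine ⟨rfl, fun j => ?_⟩
  rcases eq_or_ne j i with rfl | h
  · simpa using hs
  · rw [seg_snd_of_ne P h]; exact ⟨(hP j).le, le_rfl⟩

theorem self_mem_box {P : Base N} (hP : ∀ i, 0 < P.2 i) : P ∈ box P :=
  ⟨rfl, fun i => ⟨(hP i).le, le_rfl⟩⟩

theorem analyticAt_seg (P : Base N) (i : Fin N) (s : ℝ) : AnalyticAt ℝ (seg P i) s := by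
  have h : seg P i = fun s => P + (s - P.2 i) • dir i := funext (seg_eq P i)
  rw [h]; fun_prop

theorem hasDerivAt_seg (P : Base N) (i : Fin N) (s : ℝ) : HasDerivAt (seg P i) (dir i) s := by
  have h : seg P i = fun s => P + (s - P.2 i) • dir i := funext (seg_eq P i)
  rw [h]
  simpa using (((hasDerivAt_id s).sub_const (P.2 i)).smul_const (dir i)).const_add P

theorem analyticAt_seg_param (i : Fin N) (q : Base N × ℝ) :
    AnalyticAt ℝ (fun q : Base N × ℝ => seg q.1 i q.2) q := by
  have h : (fun q : Base N × ℝ => seg q.1 i q.2) = fun q => q.1 + (q.2 - q.1.2 i) • dir i :=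
    funext fun q => seg_eq q.1 i q.2
  rw [h]; fun_prop

/-- The Riemann-Liouville derivative `D^p_{0, x_i}` of a function of all the variables. -/
def rlDeriv (p : ℝ) (i : Fin N) (w : Base N → ℝ) (P : Base N) : ℝ :=
  riemannLiouville 0 p (fun s => w (seg P i s)) (P.2 i)

theorem diffusion_eq (α β p : Fin N → ℝ) (u : Base N → ℝ) (P : Base N) :
    diffusion α β p u P = deriv (fun s => u (s, P.2)) P.1 -
      ∑ i, α i * u P ^ β i * rlDeriv (p i) i u P := rfl

theorem analyticOnNhd_seg {P : Base N} (hP : ∀ i, 0 < P.2 i) {w : Base N → ℝ}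
    (hw : AnalyticOnNhd ℝ w (box P)) (i : Fin N) :
    AnalyticOnNhd ℝ (fun s => w (seg P i s)) (Icc 0 (P.2 i)) := fun s hs =>
  (hw _ (seg_mem_box hP i hs)).comp (f := seg P i) (analyticAt_seg P i s)

theorem eventually_analyticAt_seg {P : Base N} (hP : ∀ i, 0 < P.2 i) {w : Base N → ℝ}
    (hw : AnalyticOnNhd ℝ w (box P)) (i : Fin N) :
    ∀ᶠ y in 𝓝 (P.2 i), ∀ s ∈ Icc 0 y, AnalyticAt ℝ w (seg P i s) := by
  refine eventually_forall_Icc (fun s hs => hw _ (seg_mem_box hP i hs)) ?_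
  have hc : ContinuousAt (seg P i) (P.2 i) := (analyticAt_seg P i _).continuousAt
  refine hc.eventually ?_
  rw [seg_self]
  exact (hw _ (self_mem_box hP)).eventually_analyticAt

theorem differentiableAt_rlDeriv {p : ℝ} (hp : 0 ≤ p) {P : Base N} (hP : ∀ i, 0 < P.2 i)
    {w : Base N → ℝ} (hw : AnalyticOnNhd ℝ w (box P)) (i : Fin N) :
    DifferentiableAt ℝ (rlDeriv p i w) P := by
  have h := differentiableAt_riemannLiouville_param hp (hP i) (h := P)
    (W := fun q : Base N × ℝ => w (seg q.1 i q.2)) (fun s hs =>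
      (hw _ (seg_mem_box hP i hs)).comp (f := fun q : Base N × ℝ => seg q.1 i q.2)
        (analyticAt_seg_param i (P, s)))
  have hd : DifferentiableAt ℝ (fun Q : Base N => (Q, Q.2 i)) P := by fun_prop
  exact DifferentiableAt.comp P (f := fun Q : Base N => (Q, Q.2 i))
    (g := fun q : Base N × ℝ => riemannLiouville 0 p (fun s => w (seg q.1 i s)) q.2) h hd

/-- Along `x_i` itself, differentiation raises the order of `D^p_{0, x_i}` by one. -/
theorem fderiv_rlDeriv_dir {p : ℝ} (hp : 0 ≤ p) {P : Base N} (hP : ∀ i, 0 < P.2 i)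
    {w : Base N → ℝ} (hw : AnalyticOnNhd ℝ w (box P)) (i : Fin N) :
    fderiv ℝ (rlDeriv p i w) P (dir i) = rlDeriv (p + 1) i w P := by
  have h0 : HasFDerivAt (rlDeriv p i w) (fderiv ℝ (rlDeriv p i w) P) (seg P i (P.2 i)) := by
    rw [seg_self]; exact (differentiableAt_rlDeriv hp hP hw i).hasFDerivAt
  have h1 := h0.comp_hasDerivAt (P.2 i) (hasDerivAt_seg P i (P.2 i))
  have h2 := hasDerivAt_riemannLiouville hp (hP i) (analyticOnNhd_seg hP hw i)
  refine h1.unique (h2.congr_of_eventuallyEq (Eventually.of_forall fun s => ?_))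
  simp [rlDeriv, Function.comp]

/-- Derivatives transverse to `x_i` commute with `D^p_{0, x_i}`. -/
theorem fderiv_rlDeriv_transverse {p : ℝ} (hp : 0 ≤ p) {P : Base N} (hP : ∀ i, 0 < P.2 i)
    {w : Base N → ℝ} (hw : AnalyticOnNhd ℝ w (box P)) (i : Fin N) {e : Base N} (he : e.2 i = 0) :
    fderiv ℝ (rlDeriv p i w) P e = rlDeriv p i (fun q => fderiv ℝ w q e) P := by
  have hline : ∀ (Q : Base N) (h : ℝ), HasDerivAt (fun h : ℝ => Q + h • e) e h := fun Q h => by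
    simpa using ((hasDerivAt_id h).smul_const e).const_add Q
  have h0 : HasFDerivAt (rlDeriv p i w) (fderiv ℝ (rlDeriv p i w) P) (P + (0 : ℝ) • e) := by
    rw [zero_smul, add_zero]; exact (differentiableAt_rlDeriv hp hP hw i).hasFDerivAt
  have h1 := h0.comp_hasDerivAt (0 : ℝ) (hline P 0)
  have h2 := hasDerivAt_riemannLiouville_param hp (hP i) (e := 0)
    (W := fun q : ℝ × ℝ => w (seg P i q.2 + q.1 • e)) (fun s hs => by
      have ha := hw _ (seg_mem_box hP i hs)
      have hc : AnalyticAt ℝ (fun q : ℝ × ℝ => seg P i q.2 + q.1 • e) (0, s) := by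
        have h3 : (fun q : ℝ × ℝ => seg P i q.2 + q.1 • e) =
          fun q => P + (q.2 - P.2 i) • dir i + q.1 • e := funext fun q => by rw [seg_eq]
        rw [h3]; fun_prop
      exact ha.comp_of_eq (f := fun q : ℝ × ℝ => seg P i q.2 + q.1 • e) hc (by simp))
  have h3 := h1.unique (h2.congr_of_eventuallyEq (Eventually.of_forall fun h => ?_))
  · rw [h3]
    refine riemannLiouville_congr (hP i) ?_
    filter_upwards [eventually_analyticAt_seg hP hw i] with y hy s hs
    have h4 : HasFDerivAt w (fderiv ℝ w (seg P i s)) (seg P i s + (0 : ℝ) • e) := by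
      rw [zero_smul, add_zero]; exact (hy s ⟨hs.1.le, hs.2.le⟩).differentiableAt.hasFDerivAt
    exact (h4.comp_hasDerivAt (0 : ℝ) (hline _ 0)).deriv
  · simp [rlDeriv, Function.comp, seg_add_smul P e he, he]

end

/-! ### The prolonged diffusion operator -/

section

variable {N : ℕ}

theorem analyticAt_graph {w : Base N → ℝ} {V : Total N → Total N} {q : Base N}
    (hw : AnalyticAt ℝ w q) (hV : AnalyticAt ℝ V (q, w q)) :
    AnalyticAt ℝ (fun q => V (q, w q)) q :=
  hV.comp (f := fun q => (q, w q)) (by fun_prop)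

theorem analyticAt_characteristic {w : Base N → ℝ} {V : Total N → Total N} {q : Base N}
    (hw : AnalyticAt ℝ w q) (hV : AnalyticAt ℝ V (q, w q)) :
    AnalyticAt ℝ (characteristic V w) q := by
  have h := analyticAt_graph hw hV
  exact h.prodSnd.sub (analyticAt_clm_apply hw.fderiv h.prodFst)

theorem hasDerivAt_time {w : Base N → ℝ} {P : Base N} (hw : DifferentiableAt ℝ w P) :
    HasDerivAt (fun s => w (s, P.2)) (fderiv ℝ w P (1, 0)) P.1 := by
  have h : HasDerivAt (fun s : ℝ => (s, P.2)) ((1, 0) : Base N) P.1 :=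
    (hasDerivAt_id P.1).prodMk (hasDerivAt_const P.1 P.2)
  exact hw.hasFDerivAt.comp_hasDerivAt (f := fun s : ℝ => (s, P.2)) P.1 h

/-- The remainder whose Riemann-Liouville derivative along `x_i` enters the prolongation:
`φ - du(V - V_P + ξ^i_P ∂_{x_i})` along the segment through `P`. -/
def segRemainder (V : Total N → Total N) (u : Base N → ℝ) (P : Base N) (i : Fin N) (s : ℝ) : ℝ :=
  (V (seg P i s, u (seg P i s))).2 - fderiv ℝ u (seg P i s)
    ((V (seg P i s, u (seg P i s))).1 - (V (P, u P)).1 + (V (P, u P)).1.2 i • dir i)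

variable {α β p : Fin N → ℝ}

/-- The linearisation of the diffusion operator at `u` in the direction `w`. -/
theorem hasDerivAt_diffusion_line (hp : ∀ i, 0 ≤ p i) {P : Base N} (hP : ∀ i, 0 < P.2 i)
    {u w : Base N → ℝ} (hu : AnalyticOnNhd ℝ u (box P)) (hw : AnalyticOnNhd ℝ w (box P))
    (hu0 : 0 < u P) :
    HasDerivAt (fun ε : ℝ => diffusion α β p (fun q => u q + ε * w q) P)
      (fderiv ℝ w P (1, 0) - ∑ i, α i * (β i * u P ^ (β i - 1) * w P * rlDeriv (p i) i u P
        + u P ^ β i * rlDeriv (p i) i w P)) 0 := by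
  have hPb := self_mem_box hP
  have h1 : (fun ε : ℝ => diffusion α β p (fun q => u q + ε * w q) P) = fun ε =>
      (fderiv ℝ u P (1, 0) + ε * fderiv ℝ w P (1, 0)) - ∑ i, α i * (u P + ε * w P) ^ β i *
        (rlDeriv (p i) i u P + ε * rlDeriv (p i) i w P) := by
    funext ε
    rw [diffusion_eq]
    congr 1
    · exact ((hasDerivAt_time (hu _ hPb).differentiableAt).fun_add
        ((hasDerivAt_time (hw _ hPb).differentiableAt).const_mul ε)).deriv
    · refine Finset.sum_congr rfl fun i _ => ?_
      congr 1
      unfold rlDeriv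
      rw [riemannLiouville_add (hp i) (hP i) (analyticOnNhd_seg hP hu i)
        (g := fun s => ε * w (seg P i s))
        (fun s hs => analyticAt_const.mul (analyticOnNhd_seg hP hw i s hs)),
        riemannLiouville_const_mul]
  rw [h1]
  have hlin : ∀ c d : ℝ, HasDerivAt (fun ε : ℝ => c + ε * d) d 0 := fun c d => by
    simpa using ((hasDerivAt_id (0 : ℝ)).mul_const d).const_add c
  refine (hlin _ _).fun_sub (HasDerivAt.fun_sum fun i _ => ?_)
  have h2 := (((hlin (u P) (w P)).rpow_const (p := β i) (Or.inl (by simpa using hu0.ne'))).const_mul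
    (α i)).fun_mul (hlin (rlDeriv (p i) i u P) (rlDeriv (p i) i w P))
  refine h2.congr_deriv ?_
  simp only [zero_mul, add_zero]
  ring

/-- The total derivative of `E[u]` along a vector `v`. -/
theorem fderiv_diffusion (hp : ∀ i, 0 ≤ p i) {P : Base N} (hP : ∀ i, 0 < P.2 i)
    {u : Base N → ℝ} (hu : AnalyticOnNhd ℝ u (box P)) (hu0 : 0 < u P) (v : Base N) :
    fderiv ℝ (diffusion α β p u) P v = fderiv ℝ (fun q => fderiv ℝ u q (1, 0)) P v -
      ∑ i, α i * (β i * u P ^ (β i - 1) * fderiv ℝ u P v * rlDeriv (p i) i u P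
        + u P ^ β i * fderiv ℝ (rlDeriv (p i) i u) P v) := by
  have hPb := self_mem_box hP
  have hev : diffusion α β p u =ᶠ[𝓝 P] fun Q => fderiv ℝ u Q (1, 0) -
      ∑ i, α i * u Q ^ β i * rlDeriv (p i) i u Q := by
    filter_upwards [(hu _ hPb).eventually_analyticAt] with Q hQ
    rw [diffusion_eq, (hasDerivAt_time hQ.differentiableAt).deriv]
  rw [hev.fderiv_eq]
  have h1 := (analyticAt_fderiv_apply (hu _ hPb) (1, 0)).differentiableAt.hasFDerivAt
  have h2 := (hu _ hPb).differentiableAt.hasFDerivAt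
  have h3 := h1.fun_sub (HasFDerivAt.fun_sum (u := Finset.univ) fun i _ =>
    ((h2.rpow_const (p := β i) (Or.inl hu0.ne')).const_mul (α i)).fun_mul
      (differentiableAt_rlDeriv (hp i) hP hu i).hasFDerivAt)
  rw [h3.fderiv]
  simp only [sub_apply, sum_apply, add_apply, smul_apply, smul_eq_mul]
  congr 1
  refine Finset.sum_congr rfl fun i _ => ?_
  ring

/-- The prolongation of a vector field applied to the diffusion operator. The terms containing
second derivatives of `u` in the `x`-directions combine, on each segment, with the characteristic
to a single Riemann-Liouville derivative. -/
theorem prolong_diffusion (hp : ∀ i, 0 ≤ p i) {P : Base N} (hP : ∀ i, 0 < P.2 i)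
    {u : Base N → ℝ} {V : Total N → Total N} (hu : AnalyticOnNhd ℝ u (box P)) (hu0 : 0 < u P)
    (hV : ∀ q ∈ box P, AnalyticAt ℝ V (q, u q)) :
    prolong V (diffusion α β p) u P =
      fderiv ℝ (characteristic V u) P (1, 0)
      + fderiv ℝ (fun q => fderiv ℝ u q (1, 0)) P (V (P, u P)).1
      - ∑ i, α i * (β i * u P ^ (β i - 1) * (V (P, u P)).2 * rlDeriv (p i) i u P
        + u P ^ β i * (riemannLiouville 0 (p i) (segRemainder V u P i) (P.2 i)
          + (V (P, u P)).1.2 i * rlDeriv (p i + 1) i u P)) := by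
  have hQ : AnalyticOnNhd ℝ (characteristic V u) (box P) := fun q hq =>
    analyticAt_characteristic (hu q hq) (hV q hq)
  unfold prolong
  rw [(hasDerivAt_diffusion_line hp hP hu hQ hu0).deriv, fderiv_diffusion hp hP hu hu0]
  set v := (V (P, u P)).1 with hv
  -- split `v` into its part transverse to `x_i` and its part along `x_i`
  have hsplit : ∀ i, fderiv ℝ (rlDeriv (p i) i u) P v =
      rlDeriv (p i) i (fun q => fderiv ℝ u q (v - v.2 i • dir i)) P
        + v.2 i * rlDeriv (p i + 1) i u P := by
    intro i
    rw [← fderiv_rlDeriv_transverse (hp i) hP hu i (e := v - v.2 i • dir i) (by simp [dir]),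
      ← fderiv_rlDeriv_dir (hp i) hP hu i, ← smul_eq_mul, ← map_smul, ← map_add, sub_add_cancel]
  have hR : ∀ i, riemannLiouville 0 (p i) (segRemainder V u P i) (P.2 i) =
      rlDeriv (p i) i (characteristic V u) P
        + rlDeriv (p i) i (fun q => fderiv ℝ u q (v - v.2 i • dir i)) P := by
    intro i
    unfold rlDeriv
    rw [← riemannLiouville_add (hp i) (hP i) (analyticOnNhd_seg hP hQ i)
      (analyticOnNhd_seg hP (fun q hq => analyticAt_fderiv_apply (hu q hq) _) i)]
    congr 1
    funext s
    simp only [segRemainder, characteristic, ← hv]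
    simp only [map_add, map_sub]
    ring
  simp only [hR, hsplit]
  have hφ : (V (P, u P)).2 = characteristic V u P + fderiv ℝ u P v := by
    simp [characteristic, hv]
  rw [hφ, sub_add_sub_comm, ← Finset.sum_add_distrib]
  congr 1
  refine Finset.sum_congr rfl fun i _ => ?_
  ring

/-- The second time derivatives in the prolongation cancel. -/
theorem fderiv_characteristic_time {P : Base N} {u : Base N → ℝ} {V : Total N → Total N}
    (hu : AnalyticAt ℝ u P) (hV : AnalyticAt ℝ V (P, u P)) :
    fderiv ℝ (characteristic V u) P (1, 0)
      + fderiv ℝ (fun q => fderiv ℝ u q (1, 0)) P (V (P, u P)).1 =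
    (fderiv ℝ V (P, u P) ((1, 0), fderiv ℝ u P (1, 0))).2 -
      fderiv ℝ u P (fderiv ℝ V (P, u P) ((1, 0), fderiv ℝ u P (1, 0))).1 := by
  have hG : HasFDerivAt (fun q => V (q, u q)) _ P :=
    hV.differentiableAt.hasFDerivAt.comp P (f := fun q => (q, u q))
      ((hasFDerivAt_id P).prodMk hu.differentiableAt.hasFDerivAt)
  have hdu := hu.fderiv.differentiableAt.hasFDerivAt
  have hc : HasFDerivAt (characteristic V u) _ P := hG.snd.sub (hdu.clm_apply hG.fst)
  have hd := hdu.clm_apply (hasFDerivAt_const ((1, 0) : Base N) P)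
  rw [hc.fderiv, hd.fderiv]
  have hsymm := (ContDiffAt.isSymmSndFDerivAt_of_omega hu.contDiffAt).eq (1, 0) (V (P, u P)).1
  simp [hsymm]
  ring

/-- The prolongation for a field that is projective along all segments through `P`: `ξ^i` equal to
`c_i s + a_i s²` at parameter `s`, and `φ` equal to `u` times an affine function of slope
`(p_i - 1) a_i`. If the coefficients satisfy the algebraic determining equations, only the explicit
time dependence of the field is left. -/
theorem prolong_diffusion_of_projective (hp : ∀ i, 0 ≤ p i) {P : Base N} (hP : ∀ i, 0 < P.2 i)
    {u : Base N → ℝ} {V : Total N → Total N} (hu : AnalyticOnNhd ℝ u (box P)) (hu0 : 0 < u P)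
    (hV : ∀ q ∈ box P, AnalyticAt ℝ V (q, u q)) (hE : diffusion α β p u P = 0)
    {A T : ℝ} {c a : Fin N → ℝ} (hφ : (V (P, u P)).2 = A * u P)
    (hξ : ∀ i, (V (P, u P)).1.2 i = c i * P.2 i + a i * P.2 i ^ 2)
    (hseg : ∀ i, ∀ᶠ y in 𝓝 (P.2 i), ∀ s ∈ Ioo 0 y, V (seg P i s, u (seg P i s)) =
      (((V (P, u P)).1.1, Function.update (V (P, u P)).1.2 i (c i * s + a i * s ^ 2)),
        (A + (p i - 1) * a i * (s - P.2 i)) * u (seg P i s)))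
    (hβ : ∀ i, β i * A = p i * (c i + 2 * a i * P.2 i) - T) :
    prolong V (diffusion α β p) u P =
      (fderiv ℝ V (P, u P) ((1, 0), fderiv ℝ u P (1, 0))).2 -
      fderiv ℝ u P (fderiv ℝ V (P, u P) ((1, 0), fderiv ℝ u P (1, 0))).1 -
      (A - T) * fderiv ℝ u P (1, 0) := by
  have hPb := self_mem_box hP
  rw [prolong_diffusion hp hP hu hu0 hV, fderiv_characteristic_time (hu _ hPb) (hV _ hPb)]
  congr 1
  have hut : fderiv ℝ u P (1, 0) = ∑ i, α i * u P ^ β i * rlDeriv (p i) i u P := by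
    rw [diffusion_eq, (hasDerivAt_time (hu _ hPb).differentiableAt).deriv] at hE
    linarith
  rw [hut, Finset.mul_sum]
  refine Finset.sum_congr rfl fun i _ => ?_
  have hf := analyticOnNhd_seg hP hu i
  -- the remainder is a combination of the arguments of the Euler and projective identities
  have hR : riemannLiouville 0 (p i) (segRemainder V u P i) (P.2 i) =
      riemannLiouville 0 (p i) (fun s => ((A - (p i - 1) * a i * P.2 i) * u (seg P i s)
        - c i * (s * deriv (fun s => u (seg P i s)) s))
        + a i * ((p i - 1) * (s * u (seg P i s))
          - s * (s * deriv (fun s => u (seg P i s)) s))) (P.2 i) := by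
    refine riemannLiouville_congr (hP i) ?_
    filter_upwards [hseg i, eventually_analyticAt_seg hP hu i] with y hy hay s hs
    have hd : deriv (fun s => u (seg P i s)) s = fderiv ℝ u (seg P i s) (dir i) :=
      ((hay s ⟨hs.1.le, hs.2.le⟩).differentiableAt.hasFDerivAt.comp_hasDerivAt s
        (hasDerivAt_seg P i s)).deriv
    have hv : (V (seg P i s, u (seg P i s))).1 - (V (P, u P)).1 + (V (P, u P)).1.2 i • dir i =
        (c i * s + a i * s ^ 2) • dir i := by
      rw [hy s hs]
      refine Prod.ext (by simp [dir]) (funext fun j => ?_)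
      rcases eq_or_ne j i with rfl | hj
      · simp [dir]
      · simp [dir, hj]
    rw [segRemainder, hv, map_smul, hd, hy s hs, smul_eq_mul]
    ring
  have hf1 : AnalyticOnNhd ℝ (fun s => s * deriv (fun s => u (seg P i s)) s) (Icc 0 (P.2 i)) :=
    fun s hs => analyticAt_id.mul (hf s hs).deriv
  rw [hR, riemannLiouville_add (hp i) (hP i)
      (f := fun s => (A - (p i - 1) * a i * P.2 i) * u (seg P i s)
        - c i * (s * deriv (fun s => u (seg P i s)) s))
      (g := fun s => a i * ((p i - 1) * (s * u (seg P i s))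
          - s * (s * deriv (fun s => u (seg P i s)) s)))
      (fun s hs => (analyticAt_const.mul (hf s hs)).sub (analyticAt_const.mul (hf1 s hs)))
      (fun s hs => analyticAt_const.mul ((analyticAt_const.mul (analyticAt_id.mul (hf s hs))).sub
        (analyticAt_id.mul (hf1 s hs)))),
    riemannLiouville_sub (hp i) (hP i) (f := fun s => (A - (p i - 1) * a i * P.2 i) * u (seg P i s))
      (g := fun s => c i * (s * deriv (fun s => u (seg P i s)) s))
      (fun s hs => analyticAt_const.mul (hf s hs)) (fun s hs => analyticAt_const.mul (hf1 s hs)),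
    riemannLiouville_const_mul, riemannLiouville_const_mul, riemannLiouville_const_mul,
    riemannLiouville_euler (hp i) (hP i) hf, riemannLiouville_projective (hp i) (hP i) hf, hφ, hξ]
  have hpow : u P ^ (β i - 1) * u P = u P ^ β i := by
    rw [← Real.rpow_add_one hu0.ne', sub_add_cancel]
  simp only [rlDeriv]
  have := hβ i
  rw [← hpow]
  linear_combination (α i * (u P ^ (β i - 1) * u P) *
    riemannLiouville 0 (p i) (fun s => u (seg P i s)) (P.2 i)) * this

end

/-! ### The generators are point symmetries -/

section

variable {N : ℕ} {α β p : Fin N → ℝ}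

/-- The linear combination `c₁ v₁ + c₂ v₂ + c₃ v₃ + c₄ v₄`. -/
def genSpan (β p : Fin N → ℝ) (k : Fin N) (c₁ c₂ c₃ c₄ : ℝ) : Total N → Total N :=
  c₁ • gen₁ + c₂ • gen₂ p + c₃ • gen₃ β p + c₄ • gen₄ p k

theorem genSpan_apply (β p : Fin N → ℝ) (k : Fin N) (c₁ c₂ c₃ c₄ : ℝ) (q : Total N) :
    genSpan β p k c₁ c₂ c₃ c₄ q = ((c₁ + c₂ * q.1.1, fun i => (c₂ + c₃ * β i) / p i * q.1.2 i +
      Pi.single (M := fun _ => ℝ) k c₄ i * q.1.2 i ^ 2), (c₃ + (p k - 1) * c₄ * q.1.2 k) * q.2) :=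
          by
  refine Prod.ext (Prod.ext ?_ (funext fun i => ?_)) ?_
  · simp [genSpan, gen₁, gen₂, gen₃, gen₄]
  · rcases eq_or_ne i k with rfl | h
    · simp [genSpan, gen₁, gen₂, gen₃, gen₄]; ring
    · simp [genSpan, gen₁, gen₂, gen₃, gen₄, h]; ring
  · simp [genSpan, gen₁, gen₂, gen₃, gen₄]; ring

theorem analyticAt_genSpan (β p : Fin N → ℝ) (k : Fin N) (c₁ c₂ c₃ c₄ : ℝ) (q : Total N) :
    AnalyticAt ℝ (genSpan β p k c₁ c₂ c₃ c₄) q := by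
  rw [show genSpan β p k c₁ c₂ c₃ c₄ = _ from funext (genSpan_apply β p k c₁ c₂ c₃ c₄)]
  refine AnalyticAt.prod (AnalyticAt.prod (by fun_prop) (AnalyticAt.pi fun i => ?_)) ?_ <;> fun_prop

theorem fderiv_genSpan (β p : Fin N → ℝ) (k : Fin N) (c₁ c₂ c₃ c₄ : ℝ) (q : Total N) (κ : ℝ) :
    fderiv ℝ (genSpan β p k c₁ c₂ c₃ c₄) q ((1, 0), κ) =
      ((c₂, 0), (c₃ + (p k - 1) * c₄ * q.1.2 k) * κ) := by
  have hl : HasDerivAt (fun h : ℝ => q + h • (((1, 0), κ) : Total N)) ((1, 0), κ) 0 := by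
    simpa using ((hasDerivAt_id (0 : ℝ)).smul_const (((1, 0), κ) : Total N)).const_add q
  have h0 : HasFDerivAt (genSpan β p k c₁ c₂ c₃ c₄)
      (fderiv ℝ (genSpan β p k c₁ c₂ c₃ c₄) q) (q + (0 : ℝ) • (((1, 0), κ) : Total N)) := by
    rw [zero_smul, add_zero]
    exact (analyticAt_genSpan β p k c₁ c₂ c₃ c₄ q).differentiableAt.hasFDerivAt
  refine (h0.comp_hasDerivAt (0 : ℝ) hl).unique ?_
  have h1 : (genSpan β p k c₁ c₂ c₃ c₄ ∘ fun h : ℝ => q + h • (((1, 0), κ) : Total N)) =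
      fun h => genSpan β p k c₁ c₂ c₃ c₄ q +
        h • (((c₂, 0), (c₃ + (p k - 1) * c₄ * q.1.2 k) * κ) : Total N) := by
    funext h
    simp only [Function.comp, genSpan_apply]
    refine Prod.ext (Prod.ext ?_ (funext fun i => ?_)) ?_
    · simp; ring
    · simp
    · simp; ring
  have h2 := ((hasDerivAt_id (0 : ℝ)).smul_const
    (((c₂, 0), (c₃ + (p k - 1) * c₄ * q.1.2 k) * κ) : Total N)).const_add
      (genSpan β p k c₁ c₂ c₃ c₄ q)
  rw [one_smul] at h2
  rw [h1]
  exact h2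

/-- The fields `v₁, v₂, v₃` are point symmetries, and so is `v₄` under the exceptional relation
between the exponents. -/
theorem isPointSymmetry_genSpan (hp : ∀ i, 0 < p i) {I : Set ℝ} {b : Fin N → EReal} {U : Set ℝ}
    (hU : U ⊆ Ioi 0) (k : Fin N) (c₁ c₂ c₃ c₄ : ℝ)
    (h₄ : c₄ = 0 ∨ β k * (p k - 1) = 2 * p k ∧ ∀ j, j ≠ k → β j = 0) :
    IsPointSymmetry (diffusion α β p) I b U (genSpan β p k c₁ c₂ c₃ c₄) where
  analytic q _ := analyticAt_genSpan β p k c₁ c₂ c₃ c₄ q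
  terminal q _ i hi := by simp [genSpan_apply, hi]
  lie P _ hP u hu hUu hE := by
    have hP0 : ∀ i, 0 < P.2 i := fun i => (hP i).1
    have hu0 : 0 < u P := hU (hUu P (self_mem_box hP0))
    rw [prolong_diffusion_of_projective (fun i => (hp i).le) hP0 hu hu0
      (fun q _ => analyticAt_genSpan β p k c₁ c₂ c₃ c₄ _) hE
      (A := c₃ + (p k - 1) * c₄ * P.2 k) (T := c₂) (c := fun i => (c₂ + c₃ * β i) / p i)
      (a := Pi.single k c₄) (by simp [genSpan_apply]) (by simp [genSpan_apply]) ?_ ?_,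
      fderiv_genSpan]
    · rw [show ((c₂, 0) : Base N) = c₂ • (1, 0) by simp, map_smul]
      simp only [smul_eq_mul]
      ring
    · refine fun i => Eventually.of_forall fun y s _ => ?_
      simp only [genSpan_apply]
      refine Prod.ext (Prod.ext rfl (funext fun j => ?_)) ?_
      · rcases eq_or_ne j i with rfl | h
        · simp
        · simp [h, seg_snd_of_ne P h]
      · rcases eq_or_ne i k with rfl | h
        · simp; ring_nf; simp
        · simp [h, seg_snd_of_ne P h.symm]
    · intro i
      have hpi := (hp i).ne'
      rcases h₄ with rfl | ⟨hk, hj⟩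
      · simp; field_simp; ring
      · rcases eq_or_ne i k with rfl | h
        · simp only [Pi.single_eq_same]
          field_simp
          linear_combination (c₄ * P.2 i) * hk
        · simp [h, hj i h]
          field_simp
          simp

end

/-! ### Determining equations: coefficients transverse to a segment -/

section

variable {N : ℕ} {α β p : Fin N → ℝ}

theorem isCompact_box (P : Base N) : IsCompact (box P) := by
  have h : box P = {P.1} ×ˢ Set.pi univ fun i => Icc 0 (P.2 i) := by
    ext q
    simp only [box, mem_ofPred_eq, mem_prod, mem_singleton_iff, mem_univ_pi, mem_Icc]
  rw [h]
  exact isCompact_singleton.prod (isCompact_univ_pi fun i => isCompact_Icc)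

/-- The points `(t, x)` at which the Lie condition is imposed. -/
def interiorBase (I : Set ℝ) (b : Fin N → EReal) : Set (Base N) :=
  {P | P.1 ∈ I ∧ ∀ i, 0 < P.2 i ∧ ((P.2 i : ℝ) : EReal) < b i}

theorem mem_domain_of_mem_box {I : Set ℝ} {b : Fin N → EReal} {U : Set ℝ} {P q : Base N}
    (hP : P ∈ interiorBase I b) (hq : q ∈ box P) {w : ℝ} (hw : w ∈ U) :
    ((q, w) : Total N) ∈ domain I b U :=
  ⟨by rw [hq.1]; exact hP.1, fun i => ⟨(hq.2 i).1,
    lt_of_le_of_lt (EReal.coe_le_coe_iff.2 (hq.2 i).2) (hP.2 i).2⟩, hw⟩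

theorem eventually_perturb_mem {P : Base N} {U : Set ℝ} (hU : IsOpen U) {u η : Base N → ℝ}
    (hu : AnalyticOnNhd ℝ u (box P)) (hη : AnalyticOnNhd ℝ η (box P)) (huU : ∀ q ∈ box P, u q ∈ U) :
    ∀ᶠ ε : ℝ in 𝓝 0, ∀ q ∈ box P, u q + ε * η q ∈ U := by
  refine (isCompact_box P).eventually_forall_of_forall_eventually
    (P := fun (ε : ℝ) q => u q + ε * η q ∈ U) fun q hq => ?_
  have h1 : ContinuousAt (fun z : ℝ × Base N => u z.2 + z.1 * η z.2) (0, q) := by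
    have h2 : ContinuousAt (fun z : ℝ × Base N => u z.2) (0, q) :=
      (hu q hq).continuousAt.comp (f := fun z : ℝ × Base N => z.2) continuousAt_snd
    have h3 : ContinuousAt (fun z : ℝ × Base N => η z.2) (0, q) :=
      (hη q hq).continuousAt.comp (f := fun z : ℝ × Base N => z.2) continuousAt_snd
    exact h2.add (continuousAt_fst.mul h3)
  refine h1.eventually (hU.mem_nhds ?_)
  simpa using huU q hq

section transverse

variable {I : Set ℝ} {b : Fin N → EReal} {U : Set ℝ} {V : Total N → Total N} {P : Base N}

/-- Replace a solution `u` by `u + ε ρ(x_i) l(q - P)`. The perturbation vanishes on all segments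
through `P`, along `x_i` because `l` kills `∂_{x_i}` and along the others because `ρ` vanishes at
the endpoint, and its differential vanishes on all of them except the one along `x_i`. Hence the new
function also solves the equation at `P`, and in the difference of the two Lie conditions only the
remainder along `x_i` survives. -/
theorem riemannLiouville_transverse (hS : IsPointSymmetry (diffusion α β p) I b U V)
    (hα : ∀ i, α i ≠ 0) (hp : ∀ i, 0 ≤ p i) (hU : IsOpen U) (hU0 : U ⊆ Ioi 0)
    (hP : P ∈ interiorBase I b) {u : Base N → ℝ} (hu : AnalyticOnNhd ℝ u (box P))
    (huU : ∀ q ∈ box P, u q ∈ U) (hE : diffusion α β p u P = 0) (i : Fin N)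
    (l : Base N →L[ℝ] ℝ) (hl : l (dir i) = 0) {ρ : ℝ → ℝ}
    (hρ : AnalyticOnNhd ℝ ρ (Icc 0 (P.2 i))) (hρ0 : ρ (P.2 i) = 0) (hρ1 : deriv ρ (P.2 i) = 0) :
    riemannLiouville 0 (p i) (fun s => ρ s * (l (V (seg P i s, u (seg P i s))).1
      - l (V (P, u P)).1)) (P.2 i) = 0 := by
  have hP0 : ∀ i, 0 < P.2 i := fun i => (hP.2 i).1
  have hPb := self_mem_box hP0
  set η : Base N → ℝ := fun q => ρ (q.2 i) * l (q - P) with hη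
  have hηd : ∀ q : Base N, AnalyticAt ℝ ρ (q.2 i) → AnalyticAt ℝ η q := fun q hq => by
    have h1 : AnalyticAt ℝ (fun q : Base N => ρ (q.2 i)) q :=
      hq.comp (f := fun q : Base N => q.2 i) (by fun_prop)
    have h2 : AnalyticAt ℝ (fun q : Base N => l (q - P)) q :=
      (l.analyticAt _).comp (f := fun q => q - P) (by fun_prop)
    exact h1.mul h2
  have hηan : AnalyticOnNhd ℝ η (box P) := fun q hq => hηd q (hρ _ (hq.2 i))
  have hηseg : ∀ j s, η (seg P j s) = 0 := by
    intro j s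
    rcases eq_or_ne i j with rfl | h
    · simp [hη, seg_eq, hl]
    · simp [hη, seg_snd_of_ne P h, hρ0]
  have hηf : ∀ q : Base N, AnalyticAt ℝ ρ (q.2 i) → ∀ v, fderiv ℝ η q v =
      ρ (q.2 i) * l v + l (q - P) * (deriv ρ (q.2 i) * v.2 i) := by
    intro q hq v
    have h1 : HasFDerivAt (fun q : Base N => q.2 i)
        ((ContinuousLinearMap.proj (R := ℝ) (φ := fun _ : Fin N => ℝ) i).comp
          (ContinuousLinearMap.snd ℝ ℝ (Fin N → ℝ))) q :=
      ((ContinuousLinearMap.proj (R := ℝ) (φ := fun _ : Fin N => ℝ) i).comp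
          (ContinuousLinearMap.snd ℝ ℝ (Fin N → ℝ))).hasFDerivAt
    have h2 := hq.differentiableAt.hasDerivAt.comp_hasFDerivAt q h1
    have h3 : HasFDerivAt (fun q => l (q - P)) l q :=
      l.hasFDerivAt.comp q (f := fun q => q - P) ((hasFDerivAt_id q).sub_const P)
    have h4 : HasFDerivAt η _ q := h2.mul h3
    rw [h4.fderiv]
    simp
  obtain ⟨ε, hεU, hε⟩ : ∃ ε : ℝ, (∀ q ∈ box P, u q + ε * η q ∈ U) ∧ ε ≠ 0 := by
    have h1 := (eventually_perturb_mem hU hu hηan huU).filter_mono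
      (nhdsWithin_le_nhds (s := {0}ᶜ))
    exact (h1.and eventually_mem_nhdsWithin).exists
  set u' : Base N → ℝ := fun q => u q + ε * η q with hu'
  have hu'an : AnalyticOnNhd ℝ u' (box P) := fun q hq =>
    (hu q hq).add (analyticAt_const.mul (hηan q hq))
  have hseg : ∀ j s, u' (seg P j s) = u (seg P j s) := fun j s => by simp [hu', hηseg]
  have hu'P : u' P = u P := by simpa using hseg i (P.2 i)
  have hfd : ∀ q, AnalyticAt ℝ u q → AnalyticAt ℝ ρ (q.2 i) → ∀ v, fderiv ℝ u' q v =
      fderiv ℝ u q v + ε * (ρ (q.2 i) * l v + l (q - P) * (deriv ρ (q.2 i) * v.2 i)) := by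
    intro q h1 h2 v
    rw [← hηf q h2, hu', fderiv_fun_add h1.differentiableAt
      ((hηd q h2).differentiableAt.const_mul ε), fderiv_const_mul (hηd q h2).differentiableAt]
    simp
  have hρP : AnalyticAt ℝ ρ (P.2 i) := hρ _ ⟨(hP0 i).le, le_rfl⟩
  have hfdP : fderiv ℝ u' P = fderiv ℝ u P := by
    refine ContinuousLinearMap.ext fun v => ?_
    rw [hfd P (hu P hPb) hρP]; simp [hρ0]
  have hrl : ∀ q j, rlDeriv q j u' P = rlDeriv q j u P := fun q j => by
    unfold rlDeriv; simp only [hseg]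
  have hE' : diffusion α β p u' P = 0 := by
    rw [diffusion_eq, (hasDerivAt_time (hu _ hPb).differentiableAt).deriv] at hE
    rw [diffusion_eq, (hasDerivAt_time (hu'an _ hPb).differentiableAt).deriv]
    simp only [hfdP, hrl, hu'P, hE]
  have hVu : ∀ q ∈ box P, AnalyticAt ℝ V (q, u q) := fun q hq =>
    hS.analytic _ (mem_domain_of_mem_box hP hq (huU q hq))
  have hVu' : ∀ q ∈ box P, AnalyticAt ℝ V (q, u' q) := fun q hq =>
    hS.analytic _ (mem_domain_of_mem_box hP hq (hεU q hq))
  have h1 := hS.lie P hP.1 hP.2 u hu huU hE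
  have h2 := hS.lie P hP.1 hP.2 u' hu'an hεU hE'
  have hu0 : 0 < u P := hU0 (huU P hPb)
  rw [prolong_diffusion hp hP0 hu hu0 hVu,
    fderiv_characteristic_time (hu _ hPb) (hVu _ hPb)] at h1
  rw [prolong_diffusion hp hP0 hu'an (by rw [hu'P]; exact hu0) hVu',
    fderiv_characteristic_time (hu'an _ hPb) (hVu' _ hPb)] at h2
  simp only [hfdP, hrl, hu'P] at h2
  -- along the other segments the remainder does not change
  have hrem : ∀ j, j ≠ i → riemannLiouville 0 (p j) (segRemainder V u' P j) (P.2 j) =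
      riemannLiouville 0 (p j) (segRemainder V u P j) (P.2 j) := by
    intro j hj
    refine riemannLiouville_congr (hP0 j) ?_
    filter_upwards [eventually_analyticAt_seg hP0 hu j] with y hy s hs
    have := hfd (seg P j s) (hy s ⟨hs.1.le, hs.2.le⟩) (by rwa [seg_snd_of_ne P hj.symm])
    simp only [segRemainder, hseg, hu'P, this, seg_snd_of_ne P hj.symm, hρ0, hρ1]
    ring
  have han : AnalyticOnNhd ℝ (segRemainder V u P i) (Icc 0 (P.2 i)) := by
    intro s hs
    have hq := seg_mem_box hP0 i hs
    have hs' := analyticAt_seg P i s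
    have h3 : AnalyticAt ℝ (fun q => V (q, u q)) (seg P i s) := analyticAt_graph (hu _ hq)
        (hVu _ hq)
    have h4 := h3.comp (f := seg P i) hs'
    have h5 : AnalyticAt ℝ (fun s => fderiv ℝ u (seg P i s)) s :=
      (hu _ hq).fderiv.comp (f := seg P i) hs'
    exact h4.prodSnd.sub (analyticAt_clm_apply h5 ((h4.prodFst.sub analyticAt_const).add
      analyticAt_const))
  have hhan : AnalyticOnNhd ℝ (fun s => ρ s * (l (V (seg P i s, u (seg P i s))).1
      - l (V (P, u P)).1)) (Icc 0 (P.2 i)) := by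
    intro s hs
    have hq := seg_mem_box hP0 i hs
    have h3 : AnalyticAt ℝ (fun q => V (q, u q)) (seg P i s) := analyticAt_graph (hu _ hq)
        (hVu _ hq)
    have h4 := h3.comp (f := seg P i) (analyticAt_seg P i s)
    exact (hρ s hs).mul (((l.analyticAt _).comp (f := fun s => (V (seg P i s, u (seg P i s))).1)
      h4.prodFst).sub analyticAt_const)
  -- along `x_i` it changes by the term to be shown to vanish
  have hremi : riemannLiouville 0 (p i) (segRemainder V u' P i) (P.2 i) =
      riemannLiouville 0 (p i) (segRemainder V u P i) (P.2 i) - ε *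
      riemannLiouville 0 (p i) (fun s => ρ s * (l (V (seg P i s, u (seg P i s))).1
        - l (V (P, u P)).1)) (P.2 i) := by
    rw [← riemannLiouville_const_mul, ← riemannLiouville_sub (hp i) (hP0 i) han
      (g := fun s => ε * (ρ s * (l (V (seg P i s, u (seg P i s))).1 - l (V (P,
          u P)).1))) (fun s hs => analyticAt_const.mul (hhan s hs))]
    refine riemannLiouville_congr (hP0 i) ?_
    filter_upwards [eventually_analyticAt_seg hP0 hu i, eventually_analyticOnNhd_Icc (hP0 i) hρ]
      with y hy hy' s hs
    have hs' : s ∈ Icc 0 y := ⟨hs.1.le, hs.2.le⟩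
    have := hfd (seg P i s) (hy s hs') (by rw [seg_snd_self]; exact hy' s hs')
    have hlP : l (seg P i s - P) = 0 := by simp [seg_eq, hl]
    simp only [segRemainder, hseg, hu'P, this, seg_snd_self, hlP]
    simp only [map_add, map_sub, map_smul, hl]
    simp only [smul_eq_mul]
    ring
  have h3 := sub_right_injective (h1.trans h2.symm)
  rw [← Finset.add_sum_erase _ _ (Finset.mem_univ i),
    ← Finset.add_sum_erase _ (fun x => α x * (β x * u P ^ (β x - 1) * (V (P, u P)).2 *
      rlDeriv (p x) x u P + u P ^ β x * (riemannLiouville 0 (p x) (segRemainder V u' P x) (P.2 x) +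
      (V (P, u P)).1.2 x * rlDeriv (p x + 1) x u P))) (Finset.mem_univ i)] at h3
  rw [Finset.sum_congr rfl fun j hj => by rw [← hrem j (Finset.ne_of_mem_erase hj)],
    add_left_inj, hremi] at h3
  have h4 : α i * u P ^ β i * ε * riemannLiouville 0 (p i) (fun s => ρ s *
      (l (V (seg P i s, u (seg P i s))).1 - l (V (P, u P)).1)) (P.2 i) = 0 := by
    linear_combination h3
  have h5 : α i * u P ^ β i * ε ≠ 0 :=
    mul_ne_zero (mul_ne_zero (hα i) (Real.rpow_pos_of_pos hu0 _).ne') hε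
  exact (mul_eq_zero.1 h4).resolve_left h5

/-- Components of the field transverse to `x_i` are constant along the segment in direction `x_i`:
if `h` is the deviation from the value at `P`, the weight `ρ = (x - s)^([p] + 3) h` makes
`riemannLiouville_transverse` the vanishing of the integral of `((x - s) h)²`. -/
theorem transverse_eq_of_solution (hS : IsPointSymmetry (diffusion α β p) I b U V)
    (hα : ∀ i, α i ≠ 0) (hp : ∀ i, 0 < p i ∧ ∀ n : ℕ, p i ≠ n) (hU : IsOpen U) (hU0 : U ⊆ Ioi 0)
    (hP : P ∈ interiorBase I b) {u : Base N → ℝ} (hu : AnalyticOnNhd ℝ u (box P))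
    (huU : ∀ q ∈ box P, u q ∈ U) (hE : diffusion α β p u P = 0) (i : Fin N)
    (l : Base N →L[ℝ] ℝ) (hl : l (dir i) = 0) {s : ℝ} (hs : s ∈ Icc 0 (P.2 i)) :
    l (V (seg P i s, u (seg P i s))).1 = l (V (P, u P)).1 := by
  have hP0 : ∀ i, 0 < P.2 i := fun i => (hP.2 i).1
  set x := P.2 i with hx
  set h : ℝ → ℝ := fun s => l (V (seg P i s, u (seg P i s))).1 - l (V (P, u P)).1 with hh
  have han : AnalyticOnNhd ℝ h (Icc 0 x) := by
    intro s hs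
    have hq := seg_mem_box hP0 i hs
    have h3 : AnalyticAt ℝ (fun q => V (q, u q)) (seg P i s) := analyticAt_graph (hu _ hq)
      (hS.analytic _ (mem_domain_of_mem_box hP hq (huU _ hq)))
    have h4 := h3.comp (f := seg P i) (analyticAt_seg P i s)
    exact ((l.analyticAt _).comp (f := fun s => (V (seg P i s, u (seg P i s))).1)
      h4.prodFst).sub analyticAt_const
  have hρan : AnalyticOnNhd ℝ (fun s => (x - s) ^ (rlOrd (p i) + 2) * h s) (Icc 0 x) := by
    intro s hs
    have := han s hs
    fun_prop
  have hρ1 : deriv (fun s => (x - s) ^ (rlOrd (p i) + 2) * h s) x = 0 := by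
    have h1 : HasDerivAt (fun s : ℝ => (x - s) ^ (rlOrd (p i) + 2)) _ x :=
      ((hasDerivAt_id x).const_sub x).fun_pow (rlOrd (p i) + 2)
    rw [(h1.fun_mul (han x ⟨(hP0 i).le, le_rfl⟩).differentiableAt.hasDerivAt).deriv]
    simp
  have h1 := riemannLiouville_transverse hS hα (fun i => (hp i).1.le) hU hU0 hP hu huU hE i l hl
    hρan (by rw [← hx]; simp) hρ1
  obtain ⟨c, hc, hcrl⟩ := riemannLiouville_sub_pow_mul (hp i)
  have h2 := (hcrl (hP0 i) (g := fun s => ((x - s) * h s) * ((x - s) * h s)) (fun s hs => by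
    have := han s hs
    fun_prop)).1
  rw [show (fun s => (x - s) ^ rlOrd (p i) * ((x - s) * h s * ((x - s) * h s))) =
    fun s => (x - s) ^ (rlOrd (p i) + 2) * h s * h s by funext s; ring, h1] at h2
  have h3 := eqOn_zero_of_abel_sq (rlExp_gt (hp i).1.le) (hP0 i) (g := fun s => (x - s) * h s)
    (fun s hs => ((by fun_prop : ContinuousAt (fun s => x - s) s).mul
      (han s hs).continuousAt).continuousWithinAt) ((mul_eq_zero.1 h2.symm).resolve_left hc) s hs
  rcases eq_or_ne s x with h4 | h4
  · rw [h4, hx, seg_self]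
  · have := (mul_eq_zero.1 h3).resolve_left (sub_ne_zero.2 h4.symm)
    exact sub_eq_zero.1 this

/-- The function `f(x_i) + κ (t - t_P)`. Its Riemann-Liouville derivatives at `P` do not depend on
`κ`, so that `κ` can be chosen to make it a solution at `P`. -/
def testFun (P : Base N) (i : Fin N) (f : ℝ → ℝ) (κ : ℝ) (q : Base N) : ℝ :=
  f (q.2 i) + κ * (q.1 - P.1)

@[simp] theorem testFun_seg (P : Base N) (i : Fin N) (f : ℝ → ℝ) (κ s : ℝ) :
    testFun P i f κ (seg P i s) = f s := by simp [testFun]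

@[simp] theorem testFun_self (P : Base N) (i : Fin N) (f : ℝ → ℝ) (κ : ℝ) :
    testFun P i f κ P = f (P.2 i) := by simp [testFun]

theorem testFun_seg_of_ne (P : Base N) {i j : Fin N} (h : i ≠ j) (f : ℝ → ℝ) (κ s : ℝ) :
    testFun P i f κ (seg P j s) = f (P.2 i) := by simp [testFun, seg_snd_of_ne P h]

theorem analyticAt_testFun {P : Base N} {i : Fin N} {f : ℝ → ℝ} {κ : ℝ} {q : Base N}
    (hf : AnalyticAt ℝ f (q.2 i)) : AnalyticAt ℝ (testFun P i f κ) q := by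
  have h1 : AnalyticAt ℝ (fun q : Base N => f (q.2 i)) q :=
    hf.comp (f := fun q : Base N => q.2 i) (by fun_prop)
  have h2 : AnalyticAt ℝ (fun q : Base N => κ * (q.1 - P.1)) q := by fun_prop
  exact h1.add h2

theorem testFun_mem {f : ℝ → ℝ} {i : Fin N} (hf : ∀ s ∈ Icc 0 (P.2 i), f s ∈ U) (κ : ℝ) :
    ∀ q ∈ box P, testFun P i f κ q ∈ U := fun q hq => by
  simpa [testFun, hq.1] using hf _ (hq.2 i)

theorem fderiv_testFun {i : Fin N} {f : ℝ → ℝ} {κ : ℝ} {q : Base N}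
    (hf : AnalyticAt ℝ f (q.2 i)) (v : Base N) :
    fderiv ℝ (testFun P i f κ) q v = deriv f (q.2 i) * v.2 i + κ * v.1 := by
  have h1 : HasFDerivAt (fun q : Base N => q.2 i)
      ((ContinuousLinearMap.proj (R := ℝ) (φ := fun _ : Fin N => ℝ) i).comp
        (ContinuousLinearMap.snd ℝ ℝ (Fin N → ℝ))) q :=
    ((ContinuousLinearMap.proj (R := ℝ) (φ := fun _ : Fin N => ℝ) i).comp
        (ContinuousLinearMap.snd ℝ ℝ (Fin N → ℝ))).hasFDerivAt
  have h2 := hf.differentiableAt.hasDerivAt.comp_hasFDerivAt q h1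
  have h3 : HasFDerivAt (testFun P i f κ) _ q :=
    h2.add ((((ContinuousLinearMap.fst ℝ ℝ (Fin N → ℝ)).hasFDerivAt (x := q)).sub_const
      P.1).const_mul κ)
  rw [h3.fderiv]
  simp

/-- A test function solves the equation at `P` for exactly one slope `κ`. -/
theorem diffusion_testFun {i : Fin N} {f : ℝ → ℝ} {κ : ℝ} (hf : AnalyticAt ℝ f (P.2 i)) :
    diffusion α β p (testFun P i f κ) P = κ -
      ∑ j, α j * f (P.2 i) ^ β j * rlDeriv (p j) j (testFun P i f 0) P := by
  have h : ∀ j, rlDeriv (p j) j (testFun P i f κ) P = rlDeriv (p j) j (testFun P i f 0) P := by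
    intro j
    simp [rlDeriv, testFun]
  rw [diffusion_eq, (hasDerivAt_time (analyticAt_testFun hf).differentiableAt).deriv,
    fderiv_testFun hf]
  simp [h]

theorem add_mul_mem {U : Set ℝ} (hU : U.OrdConnected) {w w' θ : ℝ} (hw : w ∈ U) (hw' : w' ∈ U)
    (h0 : 0 ≤ θ) (h1 : θ ≤ 1) : w' + (w - w') * θ ∈ U := by
  have := hU.convex hw' hw (show 0 ≤ 1 - θ by linarith) h0 (by ring)
  simp only [smul_eq_mul] at this
  convert this using 1
  ring

theorem seg_mem_interiorBase {P : Base N} {i : Fin N} {s : ℝ} (hP : P ∈ interiorBase I b)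
    (hs : 0 < s)
    (hsb : (s : EReal) < b i) : seg P i s ∈ interiorBase I b := by
  refine ⟨hP.1, fun j => ?_⟩
  rcases eq_or_ne j i with rfl | h
  · simpa using ⟨hs, hsb⟩
  · simpa [seg_snd_of_ne P h] using hP.2 j

/-- A component transverse to `x_i` has the same value at `P` as on the face `x_i = 0`, even for
different values of `u`: join the two points by the graph of an affine function. -/
theorem transverse_eq_zero_face (hS : IsPointSymmetry (diffusion α β p) I b U V)
    (hα : ∀ i, α i ≠ 0) (hp : ∀ i, 0 < p i ∧ ∀ n : ℕ, p i ≠ n) (hU : IsOpen U)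
    (hUc : U.OrdConnected) (hU0 : U ⊆ Ioi 0) (hP : P ∈ interiorBase I b) (i : Fin N)
    (l : Base N →L[ℝ] ℝ) (hl : l (dir i) = 0) {w w' : ℝ} (hw : w ∈ U) (hw' : w' ∈ U) :
    l (V (seg P i 0, w')).1 = l (V (P, w)).1 := by
  have hx := (hP.2 i).1
  set f : ℝ → ℝ := fun σ => w' + (w - w') * (σ / P.2 i) with hf
  have hfan : ∀ s, AnalyticAt ℝ f s := fun s => by fun_prop (disch := exact hx.ne')
  have hfU : ∀ s ∈ Icc 0 (P.2 i), f s ∈ U := fun s hs =>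
    add_mul_mem hUc hw hw' (div_nonneg hs.1 hx.le) ((div_le_one hx).2 hs.2)
  have h := transverse_eq_of_solution hS hα hp hU hU0 hP
    (u := testFun P i f (∑ j, α j * f (P.2 i) ^ β j * rlDeriv (p j) j (testFun P i f 0) P))
    (fun q _ => analyticAt_testFun (hfan _)) (testFun_mem hfU _)
    (by rw [diffusion_testFun (hfan _), sub_self]) i l hl (s := 0) ⟨le_rfl, hx.le⟩
  rw [testFun_seg, testFun_self] at h
  simpa [hf, hx.ne'] using h

/-- A component transverse to `x_i` depends neither on `x_i` nor on `u`. -/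
theorem transverse_eq (hS : IsPointSymmetry (diffusion α β p) I b U V)
    (hα : ∀ i, α i ≠ 0) (hp : ∀ i, 0 < p i ∧ ∀ n : ℕ, p i ≠ n) (hU : IsOpen U)
    (hUc : U.OrdConnected) (hU0 : U ⊆ Ioi 0) (hP : P ∈ interiorBase I b) (i : Fin N)
    (l : Base N →L[ℝ] ℝ) (hl : l (dir i) = 0) {w w' : ℝ} (hw : w ∈ U) (hw' : w' ∈ U)
    {s : ℝ} (hs : 0 < s) (hsb : (s : EReal) < b i) :
    l (V (seg P i s, w')).1 = l (V (P, w)).1 := by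
  -- both sides equal the value on the common face `x_i = 0`
  rw [← transverse_eq_zero_face hS hα hp hU hUc hU0 hP i l hl hw hw,
    ← transverse_eq_zero_face hS hα hp hU hUc hU0 (seg_mem_interiorBase hP hs hsb) i l hl hw' hw,
        seg_seg]

end transverse

end

/-! ### Determining equations along a segment -/

section

variable {N : ℕ} {α β p : Fin N → ℝ}

/-- Integration by parts turns the linearised Lie condition on a segment, tested against functions
vanishing to high order at the endpoint, into a pointwise identity. -/
theorem segment_determining {p : ℝ} (hp : 0 < p ∧ ∀ n : ℕ, p ≠ n) {x : ℝ} (hx : 0 < x)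
    {m X : ℝ → ℝ} (hm : AnalyticOnNhd ℝ m (Icc 0 x)) (hX : AnalyticOnNhd ℝ X (Icc 0 x))
    (hX0 : X 0 = 0) (XP : ℝ)
    (h : ∀ η : ℝ → ℝ, AnalyticOnNhd ℝ η (Icc 0 x) → η x = 0 → deriv η x = 0 →
      riemannLiouville 0 p (fun s => m s * η s + X s * deriv η s) x =
        XP * riemannLiouville 0 (p + 1) η x) :
    ∀ s ∈ Icc 0 x, (m s - deriv X s) * (x - s) + (p + 1) * (XP - X s) = 0 := by
  have ha := rlExp_gt hp.1.le
  have hord := rlOrd_cast hp.1.le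
  set a := rlExp p with hadef
  set n := rlOrd p with hn
  -- `B` is the expression to vanish; the test function is `η = (x - s)^(n + 1) B`
  set B : ℝ → ℝ := fun s => (m s - deriv X s) * (x - s) + (p + 1) * (XP - X s) with hB
  have hBan : AnalyticOnNhd ℝ B (Icc 0 x) := fun s hs => by
    have h1 := hm s hs
    have h2 := hX s hs
    fun_prop
  have hηd : ∀ s, AnalyticAt ℝ B s → HasDerivAt (fun s => (x - s) ^ (n + 1) * B s)
      ((x - s) ^ n * (-(n + 1) * B s + (x - s) * deriv B s)) s := by
    intro s hs
    have h1 : HasDerivAt (fun s : ℝ => (x - s) ^ (n + 1)) _ s :=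
      ((hasDerivAt_id s).const_sub x).fun_pow (n + 1)
    refine (h1.fun_mul hs.differentiableAt.hasDerivAt).congr_deriv ?_
    simp only [id, Nat.add_sub_cancel]
    push_cast
    ring
  have hn0 : n ≠ 0 := (rlOrd_pos hp.1.le).ne'
  obtain ⟨c, hc, hcrl⟩ := riemannLiouville_sub_pow_mul hp
  have h1 := h (fun s => (x - s) ^ (n + 1) * B s)
    (fun s hs => by have := hBan s hs; fun_prop) (by simp)
    (by rw [(hηd x (hBan x ⟨hx.le, le_rfl⟩)).deriv]; simp [hn0])
  have hgan : AnalyticOnNhd ℝ (fun s => m s * (x - s) * B s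
      + X s * (-(n + 1) * B s + (x - s) * deriv B s)) (Icc 0 x) := fun s hs => by
    have h2 := hm s hs
    have h3 := hX s hs
    have h4 := hBan s hs
    fun_prop
  have h2 : riemannLiouville 0 p (fun s => m s * ((x - s) ^ (n + 1) * B s)
      + X s * deriv (fun s => (x - s) ^ (n + 1) * B s) s) x =
      riemannLiouville 0 p (fun s => (x - s) ^ n * (m s * (x - s) * B s
      + X s * (-(n + 1) * B s + (x - s) * deriv B s))) x := by
    refine riemannLiouville_congr hx ?_
    filter_upwards [eventually_analyticOnNhd_Icc hx hBan] with y hy s hs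
    rw [(hηd s (hy s ⟨hs.1.le, hs.2.le⟩)).deriv]
    ring
  rw [h2, (hcrl hx hgan).1, (hcrl hx hBan).2] at h1
  have hXB : AnalyticOnNhd ℝ (fun s => X s * B s) (Icc 0 x) := fun s hs => (hX s hs).mul (hBan s hs)
  have h3 := integral_deriv_mul_rpow ha hx hXB
  have h4 : abel (a + 1) (deriv fun s => X s * B s) x =
      abel a (fun s => (x - s) * (deriv X s * B s + X s * deriv B s)) x := by
    have h5 := abel_succ_apply ha hx.le (g := fun s => deriv X s * B s + X s * deriv B s)
      (ContinuousOn.add ((AnalyticOnNhd.deriv hX).continuousOn.mul hBan.continuousOn)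
        (hX.continuousOn.mul (AnalyticOnNhd.deriv hBan).continuousOn)) x
    rw [h5, sub_self, zero_mul, zero_add]
    refine intervalIntegral.integral_congr fun s hs => ?_
    rw [uIcc_of_le hx.le] at hs
    simp only
    rw [((hX s hs).differentiableAt.hasDerivAt.fun_mul
      (hBan s hs).differentiableAt.hasDerivAt).deriv]
  rw [h4, hX0] at h3
  have hi : ∀ g : ℝ → ℝ, AnalyticOnNhd ℝ g (Icc 0 x) →
      IntervalIntegrable (fun s : ℝ => (x - s) ^ a * g s) volume 0 x := fun g hg =>
    intervalIntegrable_abel ha hx.le hg.continuousOn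
  -- the integral of `B²` as a combination of integrals known to cancel
  have hlin : abel a (fun s => B s * B s) x =
      abel a (fun s => m s * (x - s) * B s + X s * (-(n + 1) * B s + (x - s) * deriv B s)) x
      + (p + 1) * XP * abel a B x + (a + 1) * abel a (fun s => X s * B s) x
      - abel a (fun s => (x - s) * (deriv X s * B s + X s * deriv B s)) x := by
    unfold abel
    rw [← intervalIntegral.integral_const_mul, ← intervalIntegral.integral_const_mul,
      ← intervalIntegral.integral_add (hi _ hgan) ((hi _ hBan).const_mul _),
      ← intervalIntegral.integral_add ((hi _ hgan).add ((hi _ hBan).const_mul _))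
        ((hi _ hXB).const_mul _),
      ← intervalIntegral.integral_sub (((hi _ hgan).add ((hi _ hBan).const_mul _)).add
        ((hi _ hXB).const_mul _)) (hi _ fun s hs => ?_)]
    · refine intervalIntegral.integral_congr fun s _ => ?_
      simp only
      rw [hord]
      simp only [hB]
      ring
    · have h2 := hX s hs
      have h4 := hBan s hs
      fun_prop
  refine eqOn_zero_of_abel_sq ha hx hBan.continuousOn ?_
  have h6 : abel a (fun s => m s * (x - s) * B s
      + X s * (-(n + 1) * B s + (x - s) * deriv B s)) x = -(p + 1) * XP * abel a B x := by
    apply mul_left_cancel₀ hc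
    rw [h1]; ring
  rw [hlin, h6, h3]
  ring

section lie

variable {I : Set ℝ} {b : Fin N → EReal} {U : Set ℝ} {V : Total N → Total N} {P : Base N}

theorem eventually_lt_bound (hP : P ∈ interiorBase I b) (i : Fin N) :
    ∀ᶠ y : ℝ in 𝓝 (P.2 i), (y : EReal) < b i :=
  continuous_coe_real_ereal.continuousAt.eventually (gt_mem_nhds (hP.2 i).2)

/-- Components transverse to some `x_i`, among them the time component, do not depend on `u`. -/
theorem fderiv_vertical_time (hS : IsPointSymmetry (diffusion α β p) I b U V)
    (hα : ∀ i, α i ≠ 0) (hp : ∀ i, 0 < p i ∧ ∀ n : ℕ, p i ≠ n) (hU : IsOpen U)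
    (hUc : U.OrdConnected) (hU0 : U ⊆ Ioi 0) (hP : P ∈ interiorBase I b) (i : Fin N)
    (l : Base N →L[ℝ] ℝ) (hl : l (dir i) = 0) {w : ℝ} (hw : w ∈ U) :
    l (fderiv ℝ V (P, w) (0, 1)).1 = 0 := by
  have hV : AnalyticAt ℝ V (P, w) := hS.analytic _
    (mem_domain_of_mem_box hP (self_mem_box fun i => (hP.2 i).1) hw)
  have h1 : HasDerivAt (fun w => V (P, w)) (fderiv ℝ V (P, w) (0, 1)) w :=
    hV.differentiableAt.hasFDerivAt.comp_hasDerivAt (f := fun w => (P, w)) w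
      ((hasDerivAt_const w P).prodMk (hasDerivAt_id w))
  have h2 : HasDerivAt (fun w => l (V (P, w)).1) (l (fderiv ℝ V (P, w) (0, 1)).1) w :=
    l.hasFDerivAt.comp_hasDerivAt w h1.fst
  refine h2.unique ((hasDerivAt_const w (l (V (P, w)).1)).congr_of_eventuallyEq ?_)
  filter_upwards [hU.mem_nhds hw] with w' hw'
  have := transverse_eq hS hα hp hU hUc hU0 hP i l hl hw hw' (hP.2 i).1 (hP.2 i).2
  rwa [seg_self] at this

/-- The constant multiplying `D^p η` in the linearised Lie condition. -/
def lieConst (β : Fin N → ℝ) (V : Total N → Total N) (P : Base N) (i : Fin N) (w w' : ℝ) : ℝ :=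
  (fderiv ℝ V (P, w) (0, 1)).2 - (fderiv ℝ V (P, w) ((1, 0), 0)).1.1
    - w' * (fderiv ℝ V (P, w) (0, 1)).1.2 i - β i * (V (P, w)).2 / w

/-- The Lie condition holds along every `f + ε η` on the segment, extended as a test function whose
time slope keeps the equation valid at `P`. Since `η` vanishes to second order at the endpoint, the
value and the slope there do not depend on `ε`, and the derivative at `ε = 0` involves `η` only
through the segment along `x_i`. -/
theorem linearised_lie (hS : IsPointSymmetry (diffusion α β p) I b U V)
    (hα : ∀ i, α i ≠ 0) (hp : ∀ i, 0 < p i ∧ ∀ n : ℕ, p i ≠ n) (hU : IsOpen U)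
    (hUc : U.OrdConnected) (hU0 : U ⊆ Ioi 0) (hP : P ∈ interiorBase I b) (i : Fin N) {f η : ℝ → ℝ}
    (hf : AnalyticOnNhd ℝ f (Icc 0 (P.2 i))) (hfU : ∀ s ∈ Icc 0 (P.2 i), f s ∈ U)
    (hη : AnalyticOnNhd ℝ η (Icc 0 (P.2 i))) (hη0 : η (P.2 i) = 0) (hη1 : deriv η (P.2 i) = 0) :
    riemannLiouville 0 (p i) (fun s => (lieConst β V P i (f (P.2 i)) (deriv f (P.2 i))
        - (fderiv ℝ V (seg P i s, f s) (0, 1)).2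
        + (fderiv ℝ V (seg P i s, f s) (0, 1)).1.2 i * deriv f s) * η s
        + (V (seg P i s, f s)).1.2 i * deriv η s) (P.2 i) =
      (V (P, f (P.2 i))).1.2 i * riemannLiouville 0 (p i + 1) η (P.2 i) := by
  have hP0 : ∀ i, 0 < P.2 i := fun i => (hP.2 i).1
  have hpn : ∀ i, 0 ≤ p i := fun i => (hp i).1.le
  have hPb := self_mem_box hP0
  have hxm : P.2 i ∈ Icc 0 (P.2 i) := ⟨(hP0 i).le, le_rfl⟩
  have hfx := hfU _ hxm
  have hu0 : 0 < f (P.2 i) := hU0 hfx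
  set D := riemannLiouville 0 (p i) η (P.2 i) with hD
  set κ₀ := ∑ j, α j * f (P.2 i) ^ β j * rlDeriv (p j) j (testFun P i f 0) P with hκ₀
  set F : ℝ → ℝ → ℝ := fun ε s => f s + ε * η s with hF
  set κ : ℝ → ℝ := fun ε => κ₀ + ε * (α i * f (P.2 i) ^ β i * D) with hκ
  set u : ℝ → Base N → ℝ := fun ε => testFun P i (F ε) (κ ε) with hu
  have hu' : ∀ ε, u ε = testFun P i (F ε) (κ ε) := fun _ => rfl
  have hFan : ∀ ε, AnalyticOnNhd ℝ (F ε) (Icc 0 (P.2 i)) := fun ε s hs =>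
    (hf s hs).add (analyticAt_const.mul (hη s hs))
  have hFx : ∀ ε, F ε (P.2 i) = f (P.2 i) := fun ε => by simp [hF, hη0]
  have hFd : ∀ ε s, AnalyticAt ℝ f s → AnalyticAt ℝ η s →
      deriv (F ε) s = deriv f s + ε * deriv η s := fun ε s h1 h2 =>
    (h1.differentiableAt.hasDerivAt.fun_add (h2.differentiableAt.hasDerivAt.const_mul ε)).deriv
  have hFdx : ∀ ε, deriv (F ε) (P.2 i) = deriv f (P.2 i) := fun ε => by
    rw [hFd ε _ (hf _ hxm) (hη _ hxm), hη1, mul_zero, add_zero]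
  have hrli : ∀ (ε κ q : ℝ), 0 ≤ q → rlDeriv q i (testFun P i (F ε) κ) P =
      riemannLiouville 0 q f (P.2 i) + ε * riemannLiouville 0 q η (P.2 i) := by
    intro ε κ q hq
    simp only [rlDeriv, testFun_seg, hF]
    rw [riemannLiouville_add hq (hP0 i) hf (g := fun s => ε * η s)
      (fun s hs => analyticAt_const.mul (hη s hs)), riemannLiouville_const_mul]
  have hrlj : ∀ (g : ℝ → ℝ) (κ q : ℝ) (j : Fin N), i ≠ j → rlDeriv q j (testFun P i g κ) P =
      riemannLiouville 0 q (fun _ => g (P.2 i)) (P.2 j) := by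
    intro g κ q j hj
    simp only [rlDeriv, testFun_seg_of_ne P hj]
  have hE : ∀ ε, diffusion α β p (u ε) P = 0 := by
    intro ε
    rw [hu', diffusion_testFun (hFan ε _ hxm), hFx, sub_eq_zero, hκ, hκ₀]
    rw [← Finset.add_sum_erase _ _ (Finset.mem_univ i),
      ← Finset.add_sum_erase _ (fun j => α j * f (P.2 i) ^ β j *
        rlDeriv (p j) j (testFun P i (F ε) 0) P) (Finset.mem_univ i)]
    have h1 : ∀ j ∈ Finset.univ.erase i, α j * f (P.2 i) ^ β j *
        rlDeriv (p j) j (testFun P i (F ε) 0) P = α j * f (P.2 i) ^ β j *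
        rlDeriv (p j) j (testFun P i f 0) P := fun j hj => by
      rw [hrlj _ _ _ _ (Finset.ne_of_mem_erase hj).symm,
        hrlj _ _ _ _ (Finset.ne_of_mem_erase hj).symm, hFx]
    have h2 := hrli 0 0 (p i) (hpn i)
    simp only [hF, zero_mul, add_zero] at h2
    rw [Finset.sum_congr rfl h1, hrli _ _ _ (hpn i), h2]
    ring
  have huan : ∀ ε, AnalyticOnNhd ℝ (u ε) (box P) := fun ε q hq =>
    analyticAt_testFun (hFan ε _ (hq.2 i))
  have huU : ∀ᶠ ε in 𝓝 (0 : ℝ), ∀ q ∈ box P, u ε q ∈ U := by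
    filter_upwards [eventually_perturb_mem hU (u := testFun P i f 0) (η := testFun P i η 0)
      (fun q hq => analyticAt_testFun (hf _ (hq.2 i)))
      (fun q hq => analyticAt_testFun (hη _ (hq.2 i))) (testFun_mem hfU 0)] with ε hε q hq
    have := hε q hq
    simpa [testFun, hu, hF, hq.1] using this
  set A₀ := fderiv ℝ V (P, f (P.2 i)) ((1, 0), 0) with hA₀
  set A₁ := fderiv ℝ V (P, f (P.2 i)) (0, 1) with hA₁
  have hA₁t : A₁.1.1 = 0 := fderiv_vertical_time hS hα hp hU hUc hU0 hP i
    (ContinuousLinearMap.fst ℝ ℝ (Fin N → ℝ)) (by simp [dir]) hfx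
  -- `W (ε, s)` is the remainder along `x_i`, and `R j` the term of index `j ≠ i` in the
  -- prolongation, which does not depend on `ε`
  set W : ℝ × ℝ → ℝ := fun q => (V (seg P i q.2, f q.2 + q.1 * η q.2)).2
    - (V (seg P i q.2, f q.2 + q.1 * η q.2)).1.2 i * (deriv f q.2 + q.1 * deriv η q.2) with hW
  set R : Fin N → ℝ := fun j => α j * (β j * f (P.2 i) ^ (β j - 1) * (V (P, f (P.2 i))).2 *
      riemannLiouville 0 (p j) (fun _ => f (P.2 i)) (P.2 j) + f (P.2 i) ^ β j *
      (riemannLiouville 0 (p j) (fun s => (V (seg P j s, f (P.2 i))).2 - deriv f (P.2 i) *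
        ((V (seg P j s, f (P.2 i))).1.2 i - (V (P, f (P.2 i))).1.2 i)) (P.2 j)
        + (V (P, f (P.2 i))).1.2 j *
          riemannLiouville 0 (p j + 1) (fun _ => f (P.2 i)) (P.2 j))) with hR
  have htime : ∀ (j : Fin N) {w : ℝ}, w ∈ U → ∀ {s : ℝ}, 0 < s → (s : EReal) < b j →
      (V (seg P j s, w)).1.1 = (V (P, f (P.2 i))).1.1 := fun j w hw s hs hsb =>
    transverse_eq hS hα hp hU hUc hU0 hP j (ContinuousLinearMap.fst ℝ ℝ (Fin N → ℝ))
      (by simp [dir]) hfx hw hs hsb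
  -- the Lie condition along the perturbed solution, as an explicit function of the parameter
  have hexpr : ∀ᶠ ε in 𝓝 (0 : ℝ), A₀.2 + κ ε * A₁.2 - (deriv f (P.2 i) *
      (A₀.1.2 i + κ ε * A₁.1.2 i) + κ ε * A₀.1.1) -
      (α i * (β i * f (P.2 i) ^ (β i - 1) * (V (P, f (P.2 i))).2 *
        (riemannLiouville 0 (p i) f (P.2 i) + ε * D) + f (P.2 i) ^ β i *
        (riemannLiouville 0 (p i) (fun s => W (ε, s)) (P.2 i) + (V (P, f (P.2 i))).1.2 i *
        (riemannLiouville 0 (p i + 1) f (P.2 i) + ε * riemannLiouville 0 (p i + 1) η (P.2 i))))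
      + ∑ j ∈ Finset.univ.erase i, R j) = 0 := by
    filter_upwards [huU] with ε hε
    have huP : u ε P = f (P.2 i) := by rw [hu', testFun_self, hFx]
    have hVu : ∀ q ∈ box P, AnalyticAt ℝ V (q, u ε q) := fun q hq =>
      hS.analytic _ (mem_domain_of_mem_box hP hq (hε q hq))
    have h1 := hS.lie P hP.1 hP.2 (u ε) (huan ε) hε (hE ε)
    rw [prolong_diffusion hpn hP0 (huan ε) (by rwa [huP]) hVu,
      fderiv_characteristic_time (huan ε _ hPb) (hVu _ hPb), huP] at h1
    have hfdP : ∀ v, fderiv ℝ (u ε) P v = deriv f (P.2 i) * v.2 i + κ ε * v.1 := fun v => by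
      rw [hu', fderiv_testFun (hFan ε _ hxm), hFdx]
    have hA : fderiv ℝ V (P, f (P.2 i)) ((1, 0), κ ε) = A₀ + κ ε • A₁ := by
      rw [hA₀, hA₁, ← map_smul, ← map_add]; simp
    rw [hfdP, hfdP, show deriv f (P.2 i) * ((1, 0) : Base N).2 i + κ ε * ((1, 0) : Base N).1 = κ ε
      by simp, hA, ← Finset.add_sum_erase _ _ (Finset.mem_univ i)] at h1
    have hremi : riemannLiouville 0 (p i) (segRemainder V (u ε) P i) (P.2 i) =
        riemannLiouville 0 (p i) (fun s => W (ε, s)) (P.2 i) := by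
      refine riemannLiouville_congr (hP0 i) ?_
      have hFU : ∀ᶠ y in 𝓝 (P.2 i), ∀ s ∈ Icc 0 y, F ε s ∈ U := by
        refine eventually_forall_Icc (fun s hs => ?_) ?_
        · simpa [hu] using hε _ (seg_mem_box hP0 i hs)
        · exact (hFan ε _ hxm).continuousAt.eventually (hU.mem_nhds (by rwa [hFx]))
      filter_upwards [eventually_analyticOnNhd_Icc (hP0 i) hf,
        eventually_analyticOnNhd_Icc (hP0 i) hη, hFU, eventually_lt_bound hP i]
        with y h2 h3 h4 h5 s hs
      have hs' : s ∈ Icc 0 y := ⟨hs.1.le, hs.2.le⟩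
      have h6 : AnalyticAt ℝ (F ε) s := (h2 s hs').add (analyticAt_const.mul (h3 s hs'))
      have h7 : (V (seg P i s, f s + ε * η s)).1.1 = _ := htime i (h4 s hs') hs.1 (lt_trans
          (EReal.coe_lt_coe_iff.2 hs.2) h5)
      simp only [segRemainder, huP]
      rw [show u ε (seg P i s) = F ε s by simp [hu], hu',
        fderiv_testFun (by rwa [seg_snd_self]), seg_snd_self, hFd ε s (h2 s hs') (h3 s hs')]
      simp only [hW, Prod.fst_add, Prod.fst_sub, Prod.snd_add, Prod.snd_sub, Pi.add_apply,
        Pi.sub_apply, Prod.smul_fst, Prod.smul_snd, dir, Pi.smul_apply, Pi.single_eq_same, hF]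
      simp only [smul_eq_mul]
      linear_combination (-κ ε) * h7
    have hremj : ∀ j, i ≠ j → riemannLiouville 0 (p j) (segRemainder V (u ε) P j) (P.2 j) =
        riemannLiouville 0 (p j) (fun s => (V (seg P j s, f (P.2 i))).2 - deriv f (P.2 i) *
        ((V (seg P j s, f (P.2 i))).1.2 i - (V (P, f (P.2 i))).1.2 i)) (P.2 j) := by
      intro j hj
      refine riemannLiouville_congr (hP0 j) ?_
      filter_upwards [eventually_lt_bound hP j] with y h5 s hs
      have h7 := htime j hfx hs.1 (lt_trans (EReal.coe_lt_coe_iff.2 hs.2) h5)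
      simp only [segRemainder, huP]
      rw [show u ε (seg P j s) = f (P.2 i) by rw [hu']; simp only [testFun_seg_of_ne P hj, hFx], hu',
        fderiv_testFun (by rw [seg_snd_of_ne P hj]; exact hFan ε _ hxm), seg_snd_of_ne P hj, hFdx]
      simp [h7, dir, hj]
    rw [Finset.sum_congr rfl (g := R) (fun j hj => by
      have hj' := (Finset.ne_of_mem_erase hj).symm
      rw [hremj j hj', hu', hrlj _ _ _ _ hj', hrlj _ _ _ _ hj', hFx])] at h1
    rw [hremi, hu', hrli _ _ _ (hpn i), hrli _ _ _ (by linarith [hpn i])] at h1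
    refine Eq.trans ?_ h1
    simp [hA₁t, hD]
  have hWan : ∀ s ∈ Icc 0 (P.2 i), AnalyticAt ℝ W (0, s) := by
    intro s hs
    have h1 : AnalyticAt ℝ V (seg P i s, f s) :=
      hS.analytic _ (mem_domain_of_mem_box hP (seg_mem_box hP0 i hs) (hfU s hs))
    have hsnd : AnalyticAt ℝ (fun q : ℝ × ℝ => q.2) (0, s) := by fun_prop
    have h2 : ∀ g : ℝ → ℝ, AnalyticAt ℝ g s → AnalyticAt ℝ (fun q : ℝ × ℝ => g q.2) (0, s) :=
      fun g hg => hg.comp (f := fun q : ℝ × ℝ => q.2) hsnd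
    have h3 : AnalyticAt ℝ (fun q : ℝ × ℝ => seg P i q.2) (0, s) :=
      (analyticAt_seg P i s).comp_of_eq (f := fun q : ℝ × ℝ => q.2) hsnd rfl
    have h4 : AnalyticAt ℝ (fun q : ℝ × ℝ => V (seg P i q.2, f q.2 + q.1 * η q.2)) (0, s) :=
      h1.comp_of_eq (f := fun q : ℝ × ℝ => (seg P i q.2, f q.2 + q.1 * η q.2))
        (AnalyticAt.prod h3 ((h2 f (hf s hs)).add (analyticAt_fst.mul (h2 η (hη s hs))))) (by simp)
    exact h4.prodSnd.sub (((analyticAt_piApply i _).comp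
      (f := fun q : ℝ × ℝ => (V (seg P i q.2, f q.2 + q.1 * η q.2)).1.2) h4.prodFst.prodSnd).mul
      ((h2 _ (hf s hs).deriv).add (analyticAt_fst.mul (h2 _ (hη s hs).deriv))))
  have hWd := hasDerivAt_riemannLiouville_param (hpn i) (hP0 i) hWan
  have hlin : ∀ c d : ℝ, HasDerivAt (fun ε : ℝ => c + ε * d) d 0 := fun c d => by
    simpa using! ((hasDerivAt_id (0 : ℝ)).mul_const d).const_add c
  have hκd : HasDerivAt κ (α i * f (P.2 i) ^ β i * D) 0 := hlin _ _
  have hLHS := (((hκd.mul_const A₁.2).const_add A₀.2).fun_sub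
    ((((hκd.mul_const (A₁.1.2 i)).const_add (A₀.1.2 i)).const_mul (deriv f (P.2 i))).fun_add
      (hκd.mul_const A₀.1.1))).fun_sub
    (((((hlin (riemannLiouville 0 (p i) f (P.2 i)) D).const_mul
        (β i * f (P.2 i) ^ (β i - 1) * (V (P, f (P.2 i))).2)).fun_add
      ((hWd.fun_add ((hlin (riemannLiouville 0 (p i + 1) f (P.2 i))
        (riemannLiouville 0 (p i + 1) η (P.2 i))).const_mul ((V (P, f (P.2 i))).1.2 i))).const_mul
        (f (P.2 i) ^ β i))).const_mul (α i)).add_const (∑ j ∈ Finset.univ.erase i, R j))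
  have hzero := hLHS.unique ((hasDerivAt_const (0 : ℝ) (0 : ℝ)).congr_of_eventuallyEq hexpr)
  have hpow : f (P.2 i) ^ (β i - 1) = f (P.2 i) ^ β i / f (P.2 i) := Real.rpow_sub_one hu0.ne' _
  have hpos : 0 < f (P.2 i) ^ β i := Real.rpow_pos_of_pos hu0 _
  have hWan' : AnalyticOnNhd ℝ (fun s => deriv (fun ε => W (ε, s)) 0) (Icc 0 (P.2 i)) := by
    intro s hs
    have h5 : AnalyticAt ℝ (fun s => fderiv ℝ W (0, s) (1, 0)) s :=
      (analyticAt_fderiv_apply (hWan s hs) (1, 0)).comp (f := fun s : ℝ => ((0 : ℝ), s))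
        (by fun_prop)
    refine h5.congr ?_
    have hc : ContinuousAt (fun s' : ℝ => ((0 : ℝ), s')) s := by fun_prop
    filter_upwards [hc.eventually (hWan s hs).eventually_analyticAt] with s' hs'
    exact (hasDerivAt_fst_of_analyticAt hs').deriv.symm
  have hgoal : riemannLiouville 0 (p i) (fun s => (lieConst β V P i (f (P.2 i)) (deriv f (P.2 i))
        - (fderiv ℝ V (seg P i s, f s) (0, 1)).2
        + (fderiv ℝ V (seg P i s, f s) (0, 1)).1.2 i * deriv f s) * η s
        + (V (seg P i s, f s)).1.2 i * deriv η s) (P.2 i) =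
      riemannLiouville 0 (p i) (fun s => lieConst β V P i (f (P.2 i)) (deriv f (P.2 i)) * η s
        - deriv (fun ε => W (ε, s)) 0) (P.2 i) := by
    refine riemannLiouville_congr (hP0 i) ?_
    have hVev : ∀ᶠ y in 𝓝 (P.2 i), ∀ s ∈ Icc 0 y, AnalyticAt ℝ V (seg P i s, f s) := by
      refine eventually_forall_Icc (fun s hs => hS.analytic _
        (mem_domain_of_mem_box hP (seg_mem_box hP0 i hs) (hfU s hs))) ?_
      have h1 : ContinuousAt (fun s => (seg P i s, f s)) (P.2 i) :=
        (analyticAt_seg P i _).continuousAt.prodMk (hf _ hxm).continuousAt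
      refine h1.eventually ?_
      exact (hS.analytic _ (mem_domain_of_mem_box hP (seg_mem_box hP0 i hxm)
        (hfU _ hxm))).eventually_analyticAt
    filter_upwards [hVev] with y hy s hs
    have h1 := hy s ⟨hs.1.le, hs.2.le⟩
    have h2 : HasDerivAt (fun ε : ℝ => V (seg P i s, f s + ε * η s))
        (fderiv ℝ V (seg P i s, f s) (0, η s)) 0 := by
      have h3 : HasFDerivAt V (fderiv ℝ V (seg P i s, f s)) (seg P i s, f s + 0 * η s) := by
        simpa using h1.differentiableAt.hasFDerivAt
      exact h3.comp_hasDerivAt (f := fun ε : ℝ => (seg P i s, f s + ε * η s)) 0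
        ((hasDerivAt_const (0 : ℝ) (seg P i s)).prodMk (hlin (f s) (η s)))
    have h2s : HasDerivAt (fun ε : ℝ => (V (seg P i s, f s + ε * η s)).2)
        (fderiv ℝ V (seg P i s, f s) (0, η s)).2 0 := h2.snd
    have h4 := h2s.fun_sub
      (((hasDerivAt_pi.1 h2.fst.snd) i).fun_mul (hlin (deriv f s) (deriv η s)))
    rw [show deriv (fun ε => W (ε, s)) 0 = _ from h4.deriv, show ((0 : Base N), η s) = η s • ((0,
        1) : Total N) by simp, map_smul]
    simp
    ring
  rw [hgoal, riemannLiouville_sub (hpn i) (hP0 i)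
    (f := fun s => lieConst β V P i (f (P.2 i)) (deriv f (P.2 i)) * η s)
    (fun s hs => analyticAt_const.mul (hη s hs)) hWan', riemannLiouville_const_mul, ← hD]
  rw [hpow] at hzero
  have hc : α i * f (P.2 i) ^ β i ≠ 0 := mul_ne_zero (hα i) hpos.ne'
  apply mul_left_cancel₀ hc
  simp only [lieConst, ← hA₀, ← hA₁]
  linear_combination hzero

/-- The pointwise determining equation along a segment: `f` is an arbitrary curve of values of `u`,
and `s` an arbitrary point of the segment. -/
theorem segment_equation (hS : IsPointSymmetry (diffusion α β p) I b U V)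
    (hα : ∀ i, α i ≠ 0) (hp : ∀ i, 0 < p i ∧ ∀ n : ℕ, p i ≠ n) (hU : IsOpen U)
    (hUc : U.OrdConnected) (hU0 : U ⊆ Ioi 0) (hP : P ∈ interiorBase I b) (i : Fin N) {f : ℝ → ℝ}
    (hf : AnalyticOnNhd ℝ f (Icc 0 (P.2 i))) (hfU : ∀ s ∈ Icc 0 (P.2 i), f s ∈ U)
    {s : ℝ} (hs : s ∈ Icc 0 (P.2 i)) :
    (lieConst β V P i (f (P.2 i)) (deriv f (P.2 i)) - (fderiv ℝ V (seg P i s, f s) (0, 1)).2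
      - (fderiv ℝ V (seg P i s, f s) (dir i, 0)).1.2 i) * (P.2 i - s)
      + (p i + 1) * ((V (P, f (P.2 i))).1.2 i - (V (seg P i s, f s)).1.2 i) = 0 := by
  have hP0 : ∀ i, 0 < P.2 i := fun i => (hP.2 i).1
  have hVan : ∀ s ∈ Icc 0 (P.2 i), AnalyticAt ℝ V (seg P i s, f s) := fun s hs =>
    hS.analytic _ (mem_domain_of_mem_box hP (seg_mem_box hP0 i hs) (hfU s hs))
  have hcan : ∀ s ∈ Icc 0 (P.2 i), AnalyticAt ℝ (fun s => (seg P i s, f s)) s := fun s hs =>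
    AnalyticAt.prod (analyticAt_seg P i s) (hf s hs)
  have hX : AnalyticOnNhd ℝ (fun s => (V (seg P i s, f s)).1.2 i) (Icc 0 (P.2 i)) := fun s hs => by
    have := (hVan s hs).comp (f := fun s => (seg P i s, f s)) (hcan s hs)
    exact ((analyticAt_piApply i _).comp (f := fun s => (V (seg P i s, f s)).1.2)
      this.prodFst.prodSnd)
  have hd : ∀ s ∈ Icc 0 (P.2 i),
      AnalyticAt ℝ (fun s => fderiv ℝ V (seg P i s, f s) (0, 1)) s := fun s hs => by
    have h1 : AnalyticAt ℝ (fun q => fderiv ℝ V q (0, 1)) (seg P i s, f s) :=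
      (ContinuousLinearMap.apply ℝ (Total N) ((0, 1) : Total N)).analyticAt _ |>.comp
        (hVan s hs).fderiv
    exact h1.comp (f := fun s => (seg P i s, f s)) (hcan s hs)
  have hm : AnalyticOnNhd ℝ (fun s => lieConst β V P i (f (P.2 i)) (deriv f (P.2 i))
        - (fderiv ℝ V (seg P i s, f s) (0, 1)).2
        + (fderiv ℝ V (seg P i s, f s) (0, 1)).1.2 i * deriv f s) (Icc 0 (P.2 i)) := fun s hs =>
    (analyticAt_const.sub (hd s hs).prodSnd).add
      (((analyticAt_piApply i _).comp (f := fun s => (fderiv ℝ V (seg P i s, f s) (0, 1)).1.2)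
        (hd s hs).prodFst.prodSnd).mul (hf s hs).deriv)
  have h := segment_determining (hp i) (hP0 i) hm hX
    (hS.terminal _ (mem_domain_of_mem_box hP (seg_mem_box hP0 i ⟨le_rfl, (hP0 i).le⟩)
      (hfU 0 ⟨le_rfl, (hP0 i).le⟩)) i (by simp)) ((V (P, f (P.2 i))).1.2 i)
    (fun η hη hη0 hη1 => linearised_lie hS hα hp hU hUc hU0 hP i hf hfU hη hη0 hη1) s hs
  have hXd : deriv (fun s => (V (seg P i s, f s)).1.2 i) s =
      (fderiv ℝ V (seg P i s, f s) (dir i, 0)).1.2 i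
      + (fderiv ℝ V (seg P i s, f s) (0, 1)).1.2 i * deriv f s := by
    have h1 : HasDerivAt (fun s => V (seg P i s, f s))
        (fderiv ℝ V (seg P i s, f s) (dir i, deriv f s)) s :=
      (hVan s hs).differentiableAt.hasFDerivAt.comp_hasDerivAt (f := fun s => (seg P i s, f s)) s
        ((hasDerivAt_seg P i s).prodMk (hf s hs).differentiableAt.hasDerivAt)
    rw [((hasDerivAt_pi.1 h1.fst.snd) i).deriv,
      show (dir i, deriv f s) = (dir i, 0) + deriv f s • ((0, 1) : Total N) by simp, map_add, map_smul]
    simp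
    ring
  rw [hXd] at h
  linarith

end lie

end

/-! ### Solving the determining equations along a coordinate line -/

section

variable {N : ℕ} {α β p : Fin N → ℝ}

/-- Small multiples of a bounded function may be added without leaving an open set. -/
theorem exists_ne_zero_add_mul_mem {U : Set ℝ} (hU : IsOpen U) {w : ℝ} (hw : w ∈ U) (C : ℝ) :
    ∃ δ : ℝ, δ ≠ 0 ∧ ∀ r, |r| ≤ C → w + δ * r ∈ U := by
  obtain ⟨ε, hε, hball⟩ := Metric.isOpen_iff.1 hU w hw
  have hC : 0 < |C| + 1 := by positivity
  refine ⟨ε / (|C| + 1), by positivity, fun r hr => hball ?_⟩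
  rw [Metric.mem_ball, Real.dist_eq, add_sub_cancel_left, abs_mul, abs_of_pos (by positivity),
    div_mul_eq_mul_div, div_lt_iff₀ hC]
  exact mul_lt_mul_of_pos_left (by linarith [le_abs_self C]) hε

/-- The functional equations along one coordinate axis force a projective vector field:
`X(y) / y` has difference quotients independent of the upper endpoint, hence is affine. -/
theorem projective_profile {B : EReal} (hB0 : 0 < B) {β p T c₀ : ℝ} (hp : 0 < p) {a X X' : ℝ → ℝ}
    (hX' : ∀ s : ℝ, 0 < s → (s : EReal) < B → HasDerivAt X (X' s) s)
    (hA : ∀ s y : ℝ, 0 < s → s ≤ y → (y : EReal) < B →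
      ((1 - β) * a y - T - a s - X' s) * (y - s) + (p + 1) * (X y - X s) = 0)
    (hB : ∀ y : ℝ, 0 < y → (y : EReal) < B → ((1 - β) * a y - T - c₀) * y + (p + 1) * X y = 0) :
    ∃ c d A : ℝ, (∀ y : ℝ, 0 < y → (y : EReal) < B →
      X y = c * y + d * y ^ 2 ∧ a y = A + (p - 1) * d * y) ∧
      β * A = p * c - T ∧ β * ((p - 1) * d) = 2 * p * d := by
  have hp1 : p + 1 ≠ 0 := by positivity
  obtain ⟨y₁, hy₁, hy₁B⟩ := EReal.lt_iff_exists_real_btwn.1 hB0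
  obtain ⟨y₂, hy₂, hy₂B⟩ := EReal.lt_iff_exists_real_btwn.1 hy₁B
  rw [EReal.coe_pos] at hy₁
  rw [EReal.coe_lt_coe_iff] at hy₂
  -- `m s` is the difference quotient of `g = X / y` from `s` to any `y > s`
  set m : ℝ → ℝ := fun s => (a s + X' s - c₀) / ((p + 1) * s) with hm
  set g : ℝ → ℝ := fun s => X s / s with hg
  have hXg : ∀ s, 0 < s → X s = s * g s := fun s hs => by simp only [hg]; field_simp
  have hg0 : ∀ y : ℝ, 0 < y → (y : EReal) < B → (1 - β) * a y - T = c₀ - (p + 1) * g y := by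
    intro y hy hyB
    have h := hB y hy hyB
    rw [hXg y hy] at h
    apply mul_right_cancel₀ hy.ne'
    linarith
  have hslope : ∀ s y : ℝ, 0 < s → s ≤ y → (y : EReal) < B → g y - g s = m s * (y - s) := by
    intro s y hs hsy hy
    have h := hA s y hs hsy hy
    rw [hg0 y (hs.trans_le hsy) hy, hXg y (hs.trans_le hsy), hXg s hs] at h
    simp only [hm]
    rw [div_mul_eq_mul_div, eq_div_iff (by positivity)]
    linarith
  have hlt : ∀ {s y : ℝ}, s < y → (y : EReal) < B → (s : EReal) < B := fun h h' =>
    (EReal.coe_lt_coe_iff.2 h).trans h'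
  -- below `y₁`, compare the difference quotients from `y` to `y₁` and to a third point `y₂`
  have haff : ∀ y : ℝ, 0 < y → (y : EReal) < B → g y - g y₁ = m y₁ * (y - y₁) := by
    intro y hy hyB
    rcases le_total y₁ y with h | h
    · exact hslope _ _ hy₁ h hyB
    · rcases h.eq_or_lt with rfl | h
      · simp
      have h1 := hslope y y₁ hy h.le hy₁B
      have h2 := hslope y y₂ hy (h.trans hy₂).le hy₂B
      have h3 := hslope y₁ y₂ hy₁ hy₂.le hy₂B
      have h4 : m y = m y₁ := by
        apply mul_right_cancel₀ (sub_ne_zero.2 hy₂.ne')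
        linarith
      rw [h4] at h1
      linarith
  have hms : ∀ s : ℝ, 0 < s → (s : EReal) < B → m s = m y₁ := by
    intro s hs hsB
    obtain ⟨z, hz, hzB⟩ := EReal.lt_iff_exists_real_btwn.1 hsB
    rw [EReal.coe_lt_coe_iff] at hz
    have h1 := hslope s z hs hz.le hzB
    have h2 := haff s hs hsB
    have h3 := haff z (hs.trans hz) hzB
    apply mul_right_cancel₀ (sub_ne_zero.2 hz.ne')
    linarith
  set d := m y₁ with hd
  set c := g y₁ - d * y₁ with hc
  have hXf : ∀ y : ℝ, 0 < y → (y : EReal) < B → X y = c * y + d * y ^ 2 := fun y hy hyB => by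
    rw [hXg y hy, hc]
    linear_combination y * haff y hy hyB
  have hXd : ∀ y : ℝ, 0 < y → (y : EReal) < B → X' y = c + 2 * d * y := by
    intro y hy hyB
    have h1 : HasDerivAt (fun y => c * y + d * y ^ 2) (c + 2 * d * y) y := by
      refine (((hasDerivAt_id y).const_mul c).fun_add
        (((hasDerivAt_id y).fun_pow 2).const_mul d)).congr_deriv ?_
      simp; ring
    refine (hX' y hy hyB).unique (h1.congr_of_eventuallyEq ?_)
    have hev : ∀ᶠ z : ℝ in 𝓝 y, (z : EReal) < B :=
      continuous_coe_real_ereal.continuousAt.eventually (gt_mem_nhds hyB)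
    filter_upwards [lt_mem_nhds hy, hev] with z hz hzB using hXf z hz hzB
  have haf : ∀ y : ℝ, 0 < y → (y : EReal) < B → a y = c₀ - c + (p - 1) * d * y := by
    intro y hy hyB
    have h := hms y hy hyB
    simp only [hm] at h
    rw [div_eq_iff (by positivity), hXd y hy hyB] at h
    linarith
  have hβ : ∀ y : ℝ, 0 < y → (y : EReal) < B →
      β * (c₀ - c) - (p * c - T) + (β * ((p - 1) * d) - 2 * p * d) * y = 0 := by
    intro y hy hyB
    have h := hg0 y hy hyB
    have h1 := haff y hy hyB
    rw [haf y hy hyB] at h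
    have h2 : g y = c + d * y := by rw [hc]; linarith
    rw [h2] at h
    linear_combination -h
  have h1 := hβ y₁ hy₁ hy₁B
  have h2 := hβ y₂ (hy₁.trans hy₂) hy₂B
  have h3 : β * ((p - 1) * d) - 2 * p * d = 0 := by
    apply mul_right_cancel₀ (sub_ne_zero.2 hy₂.ne')
    linarith
  rw [h3] at h1
  exact ⟨c, d, c₀ - c, fun y hy hyB => ⟨hXf y hy hyB, haf y hy hyB⟩, by linarith, by linarith⟩

section interior

variable {I : Set ℝ} {b : Fin N → EReal} {P Q : Base N}

theorem eventually_seg_mem (hP : P ∈ interiorBase I b) (i : Fin N) :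
    ∀ᶠ s in 𝓝 (P.2 i), seg P i s ∈ interiorBase I b := by
  filter_upwards [eventually_lt_bound hP i, lt_mem_nhds (hP.2 i).1] with s hs hs0
    using seg_mem_interiorBase hP hs0 hs

/-- Every interior point is an inner point of a segment along `x_i` ending at an interior point. -/
theorem exists_extension (hQ : Q ∈ interiorBase I b) (i : Fin N) :
    ∃ P ∈ interiorBase I b, Q.2 i < P.2 i ∧ seg P i (Q.2 i) = Q := by
  obtain ⟨y, hy, hyb⟩ := EReal.lt_iff_exists_real_btwn.1 (hQ.2 i).2
  rw [EReal.coe_lt_coe_iff] at hy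
  exact ⟨seg Q i y, seg_mem_interiorBase hQ ((hQ.2 i).1.trans hy) hyb, by simpa using hy, by simp⟩

end interior

/-- The standing assumptions under which the determining equations are solved. -/
structure SymmetrySetting (α β p : Fin N → ℝ) (I : Set ℝ) (b : Fin N → EReal) (U : Set ℝ)
    (V : Total N → Total N) : Prop where
  symm : IsPointSymmetry (diffusion α β p) I b U V
  coeff : ∀ i, α i ≠ 0
  order : ∀ i, 0 < p i ∧ ∀ n : ℕ, p i ≠ n
  isOpen_time : IsOpen I
  ordConnected_time : I.OrdConnected
  bound_pos : ∀ i, 0 < b i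
  isOpen : IsOpen U
  ordConnected : U.OrdConnected
  pos : U ⊆ Ioi 0

namespace SymmetrySetting

variable {I : Set ℝ} {b : Fin N → EReal} {U : Set ℝ} {V : Total N → Total N} {P Q : Base N}
  (h : SymmetrySetting α β p I b U V)
include h

theorem analyticAt (hP : P ∈ interiorBase I b) {w : ℝ} (hw : w ∈ U) : AnalyticAt ℝ V (P, w) :=
  h.symm.analytic _ (mem_domain_of_mem_box hP (self_mem_box fun i => (hP.2 i).1) hw)

theorem hasDerivAt_vertical (hP : P ∈ interiorBase I b) {w : ℝ} (hw : w ∈ U) :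
    HasDerivAt (fun w => V (P, w)) (fderiv ℝ V (P, w) (0, 1)) w :=
  (h.analyticAt hP hw).differentiableAt.hasFDerivAt.comp_hasDerivAt (f := fun w => (P, w)) w
    ((hasDerivAt_const w P).prodMk (hasDerivAt_id w))

theorem hasDerivAt_timeShift (hP : P ∈ interiorBase I b) {w : ℝ} (hw : w ∈ U) :
    HasDerivAt (fun t => V ((t, P.2), w)) (fderiv ℝ V (P, w) ((1, 0), 0)) P.1 :=
  (h.analyticAt hP hw).differentiableAt.hasFDerivAt.comp_hasDerivAt
    (f := fun t : ℝ => (((t, P.2) : Base N), w)) P.1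
    (((hasDerivAt_id P.1).prodMk (hasDerivAt_const _ P.2)).prodMk (hasDerivAt_const _ w))

theorem segment_eq (hP : P ∈ interiorBase I b) (i : Fin N) {f : ℝ → ℝ}
    (hf : AnalyticOnNhd ℝ f (Icc 0 (P.2 i))) (hfU : ∀ s ∈ Icc 0 (P.2 i), f s ∈ U)
    {s : ℝ} (hs : s ∈ Icc 0 (P.2 i)) :
    (lieConst β V P i (f (P.2 i)) (deriv f (P.2 i)) - (fderiv ℝ V (seg P i s, f s) (0, 1)).2
      - (fderiv ℝ V (seg P i s, f s) (dir i, 0)).1.2 i) * (P.2 i - s)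
      + (p i + 1) * ((V (P, f (P.2 i))).1.2 i - (V (seg P i s, f s)).1.2 i) = 0 :=
  segment_equation h.symm h.coeff h.order h.isOpen h.ordConnected h.pos hP i hf hfU hs

/-- The spatial components of a point symmetry do not depend on `u`: in the determining equation
the slope of the solution at the endpoint may be varied freely. -/
theorem fderiv_vertical_space (hP : P ∈ interiorBase I b) (i : Fin N) {w : ℝ} (hw : w ∈ U) :
    (fderiv ℝ V (P, w) (0, 1)).1.2 i = 0 := by
  have hx := (hP.2 i).1
  set x := P.2 i with hxd
  obtain ⟨δ, hδ, hδU⟩ := exists_ne_zero_add_mul_mem h.isOpen hw (x ^ 2)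
  have h0 : (0 : ℝ) ∈ Icc 0 (P.2 i) := ⟨le_rfl, hx.le⟩
  -- adding `δ s (x - s)` to a constant changes the slope at the endpoint but no end value
  have h1 := h.segment_eq hP i (f := fun _ => w) (fun s _ => analyticAt_const) (fun _ _ => hw) h0
  have h2 := h.segment_eq hP i (f := fun s => w + δ * (s * (x - s))) (fun s _ => by fun_prop)
    (fun s hs => hδU _ (by
      have h3 : 0 ≤ x - s := by linarith [hs.2]
      rw [abs_of_nonneg (mul_nonneg hs.1 h3)]
      nlinarith [hs.1, hs.2])) h0
  have hd : deriv (fun s => w + δ * (s * (x - s))) (P.2 i) = -(δ * x) := by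
    have : HasDerivAt (fun s => w + δ * (s * (x - s))) _ x :=
      (((hasDerivAt_id x).fun_mul ((hasDerivAt_id x).const_sub x)).const_mul δ).const_add w
    rw [← hxd, this.deriv]
    simp
  rw [hd] at h2
  simp only [← hxd, sub_self, mul_zero, add_zero, zero_mul, deriv_const] at h1 h2
  simp only [lieConst] at h1 h2
  have h3 : δ * x * (fderiv ℝ V (P, w) (0, 1)).1.2 i * (x - 0) = 0 := by linear_combination h2 - h1
  simpa [hδ, hx.ne'] using h3

/-- The spatial components of a point symmetry take the same value for all `u`. -/
theorem space_eq (hP : P ∈ interiorBase I b) (i : Fin N) {w w' : ℝ} (hw : w ∈ U) (hw' : w' ∈ U) :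
    (V (P, w)).1.2 i = (V (P, w')).1.2 i := by
  have hd : ∀ w ∈ U, HasDerivAt (fun w => (V (P, w)).1.2 i) 0 w := fun w hw => by
    have h1 := h.hasDerivAt_vertical hP hw
    have h2 := (hasDerivAt_pi.1 h1.fst.snd) i
    rwa [show (fderiv ℝ V (P, w) (0, 1)).1.2 i = 0 from h.fderiv_vertical_space hP i hw] at h2
  exact h.isOpen.is_const_of_deriv_eq_zero h.ordConnected.isPreconnected
    (fun w hw => (hd w hw).differentiableAt.differentiableWithinAt) (fun w hw => (hd w hw).deriv)
    hw hw'

theorem hasDerivAt_space (hP : P ∈ interiorBase I b) (i : Fin N) {w : ℝ} (hw : w ∈ U) :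
    HasDerivAt (fun s => (V (seg P i s, w)).1.2 i) ((fderiv ℝ V (P, w) (dir i, 0)).1.2 i)
      (P.2 i) := by
  have h0 : HasFDerivAt V (fderiv ℝ V (P, w)) (seg P i (P.2 i), w) := by
    rw [seg_self]; exact (h.analyticAt hP hw).differentiableAt.hasFDerivAt
  have h1 := h0.comp_hasDerivAt (f := fun s => (seg P i s, w)) (P.2 i)
    ((hasDerivAt_seg P i _).prodMk (hasDerivAt_const _ w))
  exact (hasDerivAt_pi.1 h1.fst.snd) i

theorem fderiv_space_eq (hP : P ∈ interiorBase I b) (i : Fin N) {w w' : ℝ} (hw : w ∈ U)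
    (hw' : w' ∈ U) :
    (fderiv ℝ V (P, w) (dir i, 0)).1.2 i = (fderiv ℝ V (P, w') (dir i, 0)).1.2 i := by
  refine (h.hasDerivAt_space hP i hw).unique ((h.hasDerivAt_space hP i hw').congr_of_eventuallyEq ?_)
  filter_upwards [eventually_seg_mem hP i] with s hs using h.space_eq hs i hw hw'

theorem lieConst_eq (hP : P ∈ interiorBase I b) (i : Fin N) {w w' : ℝ} (hw : w ∈ U) :
    lieConst β V P i w w' = lieConst β V P i w 0 := by
  simp [lieConst, h.fderiv_vertical_space hP i hw]

/-- The determining equation along a constant function. -/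
theorem const_equation (hP : P ∈ interiorBase I b) (i : Fin N) {w : ℝ} (hw : w ∈ U) {s : ℝ}
    (hs : s ∈ Icc 0 (P.2 i)) :
    (lieConst β V P i w 0 - (fderiv ℝ V (seg P i s, w) (0, 1)).2
      - (fderiv ℝ V (seg P i s, w) (dir i, 0)).1.2 i) * (P.2 i - s)
      + (p i + 1) * ((V (P, w)).1.2 i - (V (seg P i s, w)).1.2 i) = 0 := by
  have := h.segment_eq hP i (f := fun _ => w) (fun s _ => analyticAt_const) (fun _ _ => hw) hs
  simpa using this

/-- The determining equation at the terminal, along a function with prescribed end values. -/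
theorem terminal_equation (hP : P ∈ interiorBase I b) (i : Fin N) {w w₀ : ℝ} (hw : w ∈ U)
    (hw₀ : w₀ ∈ U) :
    (lieConst β V P i w 0 - (fderiv ℝ V (seg P i 0, w₀) (0, 1)).2
      - (fderiv ℝ V (seg P i 0, w₀) (dir i, 0)).1.2 i) * P.2 i
      + (p i + 1) * (V (P, w)).1.2 i = 0 := by
  have hx := (hP.2 i).1
  have h0 : (0 : ℝ) ∈ Icc 0 (P.2 i) := ⟨le_rfl, hx.le⟩
  have h1 := h.segment_eq hP i (f := fun σ => w₀ + (w - w₀) * (σ / P.2 i))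
    (fun s _ => by fun_prop (disch := exact hx.ne'))
    (fun s hs => add_mul_mem h.ordConnected hw hw₀ (div_nonneg hs.1 hx.le)
      ((div_le_one hx).2 hs.2)) h0
  have h2 : (V (seg P i 0, w₀)).1.2 i = 0 := h.symm.terminal _
    (mem_domain_of_mem_box hP (seg_mem_box (fun i => (hP.2 i).1) i h0) hw₀) i (by simp)
  simpa [hx.ne', h2, h.lieConst_eq hP i hw] using h1

/-- The time derivative of the time component does not depend on `x_i` and `u`. -/
theorem fderiv_time_eq (hP : P ∈ interiorBase I b) (i : Fin N) {w w' : ℝ} (hw : w ∈ U)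
    (hw' : w' ∈ U)
    {s : ℝ} (hs : 0 < s) (hsb : (s : EReal) < b i) :
    (fderiv ℝ V (seg P i s, w') ((1, 0), 0)).1.1 = (fderiv ℝ V (P, w) ((1, 0), 0)).1.1 := by
  have ht : ∀ {Q : Base N}, Q ∈ interiorBase I b → ∀ {w : ℝ}, w ∈ U →
      HasDerivAt (fun t => (V ((t, Q.2), w)).1.1) (fderiv ℝ V (Q, w) ((1, 0), 0)).1.1 Q.1 :=
    fun hQ _ hw => (h.hasDerivAt_timeShift hQ hw).fst.fst
  refine (ht (seg_mem_interiorBase hP hs hsb) hw').unique ((ht hP hw).congr_of_eventuallyEq ?_)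
  filter_upwards [h.isOpen_time.mem_nhds hP.1] with r hr
  exact transverse_eq h.symm h.coeff h.order h.isOpen h.ordConnected h.pos
    (P := (r, P.2)) ⟨hr, hP.2⟩ i (ContinuousLinearMap.fst ℝ ℝ (Fin N → ℝ)) (by simp [dir])
    hw hw' hs hsb

/-- The `u`-component of a point symmetry is affine in `u`: at an inner point of a segment its
`u`-derivative is determined by quantities that do not depend on `u`. -/
theorem fderiv_vertical_eq (i : Fin N) (hQ : Q ∈ interiorBase I b) {w w' : ℝ} (hw : w ∈ U)
    (hw' : w' ∈ U) : (fderiv ℝ V (Q, w) (0, 1)).2 = (fderiv ℝ V (Q, w') (0, 1)).2 := by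
  obtain ⟨P, hP, hlt, hPQ⟩ := exists_extension hQ i
  have hs : Q.2 i ∈ Icc 0 (P.2 i) := ⟨(hQ.2 i).1.le, hlt.le⟩
  have h1 := h.const_equation hP i hw hs
  have h2 := h.const_equation hP i hw' hs
  have h3 := h.terminal_equation hP i hw hw
  have h4 := h.terminal_equation hP i hw' hw
  rw [h.space_eq hP i hw hw'] at h1 h3
  rw [hPQ, h.space_eq hQ i hw hw', h.fderiv_space_eq hQ i hw hw'] at h1
  rw [hPQ] at h2
  have h5 : lieConst β V P i w 0 = lieConst β V P i w' 0 := by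
    apply mul_right_cancel₀ (hP.2 i).1.ne'
    linarith
  rw [h5] at h1
  apply mul_right_cancel₀ (sub_ne_zero.2 hlt.ne')
  linarith

/-- Where the diffusion coefficient is not constant, the `u`-component is linear in `u`. -/
theorem vertical_eq_mul {i : Fin N} (hi : β i ≠ 0) (hP : P ∈ interiorBase I b) {w w₀ : ℝ}
    (hw : w ∈ U)
    (hw₀ : w₀ ∈ U) : (V (P, w)).2 = (fderiv ℝ V (P, w₀) (0, 1)).2 * w := by
  -- the terminal equation contains `φ / u` with the factor `β i`, and otherwise no value of `u`
  have hdiv : ∀ w ∈ U, (V (P, w)).2 / w = (V (P, w₀)).2 / w₀ := by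
    intro w hw
    have h3 := h.terminal_equation hP i hw hw
    have h4 := h.terminal_equation hP i hw₀ hw
    rw [h.space_eq hP i hw hw₀] at h3
    have h5 : lieConst β V P i w 0 = lieConst β V P i w₀ 0 := by
      apply mul_right_cancel₀ (hP.2 i).1.ne'
      linarith
    have h6 := h.fderiv_time_eq hP i hw₀ hw (hP.2 i).1 (hP.2 i).2
    rw [seg_self] at h6
    simp only [lieConst] at h5
    rw [h6, h.fderiv_vertical_eq i hP hw hw₀] at h5
    apply mul_left_cancel₀ hi
    rw [mul_div_assoc] at h5
    rw [mul_div_assoc] at h5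
    linarith
  have hlin : ∀ w ∈ U, (V (P, w)).2 = (V (P, w₀)).2 / w₀ * w := fun w hw => by
    rw [← hdiv w hw, div_mul_cancel₀ _ (h.pos hw).ne']
  have hd : (fderiv ℝ V (P, w₀) (0, 1)).2 = (V (P, w₀)).2 / w₀ := by
    have h1 : HasDerivAt (fun w => (V (P, w)).2) (fderiv ℝ V (P, w₀) (0, 1)).2 w₀ :=
      (h.hasDerivAt_vertical hP hw₀).snd
    refine h1.unique (((hasDerivAt_id w₀).const_mul ((V (P, w₀)).2 / w₀)).congr_deriv (mul_one _)
      |>.congr_of_eventuallyEq ?_)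
    filter_upwards [h.isOpen.mem_nhds hw₀] with w hw using hlin w hw
  rw [hd, hlin w hw]

end SymmetrySetting

end

/-! ### Classification of the point symmetries -/

section

variable {N : ℕ} {α β p : Fin N → ℝ}

/-- An affine function is determined by its values on a nonempty interval `(0, B)`. -/
theorem affine_unique {B : EReal} (hB : 0 < B) {A d A' d' : ℝ}
    (h : ∀ y : ℝ, 0 < y → (y : EReal) < B → A + d * y = A' + d' * y) : A = A' ∧ d = d' := by
  obtain ⟨y₁, hy₁, hy₁B⟩ := EReal.lt_iff_exists_real_btwn.1 hB
  obtain ⟨y₂, hy₂, hy₂B⟩ := EReal.lt_iff_exists_real_btwn.1 hy₁B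
  rw [EReal.coe_pos] at hy₁
  rw [EReal.coe_lt_coe_iff] at hy₂
  have h1 := h y₁ hy₁ hy₁B
  have h2 := h y₂ (hy₁.trans hy₂) hy₂B
  have h3 : d = d' := by
    apply mul_right_cancel₀ (sub_ne_zero.2 hy₂.ne')
    linarith
  subst h3
  exact ⟨by linarith, rfl⟩

theorem quadratic_unique {B : EReal} (hB : 0 < B) {c d c' d' : ℝ}
    (h : ∀ y : ℝ, 0 < y → (y : EReal) < B → c * y + d * y ^ 2 = c' * y + d' * y ^ 2) :
    c = c' ∧ d = d' :=
  affine_unique hB fun y hy hyB => by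
    apply mul_right_cancel₀ hy.ne'
    linarith [h y hy hyB]

/-- A function that does not change when a coordinate in `S` varies takes the same value at points
that agree in time and in the coordinates outside `S`. -/
theorem eq_of_seg_invariant {X : Type*} {I : Set ℝ} {b : Fin N → EReal} {F : Base N → X}
    {S : Set (Fin N)} (hF : ∀ Q ∈ interiorBase I b, ∀ i ∈ S, ∀ s : ℝ, 0 < s → (s : EReal) < b i →
      F (seg Q i s) = F Q) {Q Q' : Base N} (hQ : Q ∈ interiorBase I b) (hQ' : Q' ∈ interiorBase I b)
    (ht : Q.1 = Q'.1) (hS : ∀ i, i ∉ S → Q.2 i = Q'.2 i) : F Q = F Q' := by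
  classical
  have key : ∀ T : Finset (Fin N), F (Q.1, T.piecewise Q'.2 Q.2) = F Q := by
    intro T
    induction T using Finset.induction_on with
    | empty => simp
    | insert j T hj ih =>
      have hmem : ((Q.1, T.piecewise Q'.2 Q.2) : Base N) ∈ interiorBase I b := by
        refine ⟨hQ.1, fun i => ?_⟩
        by_cases hi : i ∈ T
        · simpa [Finset.piecewise_eq_of_mem _ _ _ hi] using hQ'.2 i
        · simpa [Finset.piecewise_eq_of_notMem _ _ _ hi] using hQ.2 i
      rw [Finset.piecewise_insert, ← ih]
      by_cases hjS : j ∈ S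
      · exact hF _ hmem j hjS _ (hQ'.2 j).1 (hQ'.2 j).2
      · congr 2
        rw [← hS j hjS, ← Finset.piecewise_eq_of_notMem T Q'.2 Q.2 hj, Function.update_eq_self]
  have := key Finset.univ
  rw [Finset.piecewise_univ, ht] at this
  exact this.symm

namespace SymmetrySetting

variable {I : Set ℝ} {b : Fin N → EReal} {U : Set ℝ} {V : Total N → Total N} {P Q : Base N}
  (h : SymmetrySetting α β p I b U V)
include h

/-- Along every coordinate line a point symmetry is projective. -/
theorem exists_profile {k : Fin N} (hk : β k ≠ 0) (hP : P ∈ interiorBase I b) (i : Fin N) {w₀ : ℝ}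
    (hw₀ : w₀ ∈ U) :
    ∃ c d A : ℝ, (∀ y : ℝ, 0 < y → (y : EReal) < b i → ∀ w ∈ U,
      (V (seg P i y, w)).1.2 i = c * y + d * y ^ 2 ∧
      (V (seg P i y, w)).2 = (A + (p i - 1) * d * y) * w) ∧
      β i * A = p i * c - (fderiv ℝ V (P, w₀) ((1, 0), 0)).1.1 ∧
      β i * ((p i - 1) * d) = 2 * p i * d := by
  -- as `φ` is linear in `u`, the constant of the linearised Lie condition is affine in `∂_u φ`
  have hL : ∀ y : ℝ, 0 < y → (y : EReal) < b i → lieConst β V (seg P i y) i w₀ 0 =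
      (1 - β i) * (fderiv ℝ V (seg P i y, w₀) (0, 1)).2
        - (fderiv ℝ V (P, w₀) ((1, 0), 0)).1.1 := by
    intro y hy hyb
    have hQ := seg_mem_interiorBase hP hy hyb
    have hw : w₀ ≠ 0 := ne_of_gt (h.pos hw₀)
    rw [lieConst, h.fderiv_time_eq hP i hw₀ hw₀ hy hyb, h.vertical_eq_mul hk hQ hw₀ hw₀]
    field_simp
    ring
  have hX' : ∀ s : ℝ, 0 < s → (s : EReal) < b i → HasDerivAt (fun y => (V (seg P i y, w₀)).1.2 i)
      ((fderiv ℝ V (seg P i s, w₀) (dir i, 0)).1.2 i) s := fun s hs hsb => by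
    simpa using h.hasDerivAt_space (seg_mem_interiorBase hP hs hsb) i hw₀
  obtain ⟨c, d, A, h1, h2, h3⟩ := projective_profile (h.bound_pos i) (h.order i).1
    (a := fun y => (fderiv ℝ V (seg P i y, w₀) (0, 1)).2)
    (T := (fderiv ℝ V (P, w₀) ((1, 0), 0)).1.1) (β := β i)
    (c₀ := (fderiv ℝ V (seg P i 0, w₀) (0, 1)).2
      + (fderiv ℝ V (seg P i 0, w₀) (dir i, 0)).1.2 i) hX'
    (fun s y hs hsy hyb => by
      have hy := hs.trans_le hsy
      have := h.const_equation (seg_mem_interiorBase hP hy hyb) i hw₀ (s := s)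
        (by simpa using ⟨hs.le, hsy⟩)
      rw [hL y hy hyb] at this
      simpa using this)
    (fun y hy hyb => by
      have := h.terminal_equation (seg_mem_interiorBase hP hy hyb) i hw₀ hw₀
      rw [hL y hy hyb] at this
      simp only [seg_snd_self, seg_seg] at this
      linear_combination this)
  refine ⟨c, d, A, fun y hy hyb w hw => ?_, h2, h3⟩
  have hQ := seg_mem_interiorBase hP hy hyb
  exact ⟨(h.space_eq hQ i hw hw₀).trans (h1 y hy hyb).1, by
    rw [h.vertical_eq_mul hk hQ hw hw₀, (h1 y hy hyb).2]⟩

/-- The spatial and vertical components of a point symmetry do not depend on time: by the profiles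
along the coordinate lines, this is all the Lie condition still says. -/
theorem fderiv_time_eq_zero {k : Fin N} (hk : β k ≠ 0) (hP : P ∈ interiorBase I b) {w : ℝ}
    (hw : w ∈ U) (i : Fin N) : (fderiv ℝ V (P, w) ((1, 0), 0)).2 = 0 ∧
      (fderiv ℝ V (P, w) ((1, 0), 0)).1.2 i = 0 := by
  have hP0 : ∀ i, 0 < P.2 i := fun i => (hP.2 i).1
  have hw0 : 0 < w := h.pos hw
  choose c d A hprof hβ₁ hβ₂ using fun j => h.exists_profile hk hP j hw
  set A₀ := (fderiv ℝ V (P, w) (0, 1)).2 with hA₀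
  set T := (fderiv ℝ V (P, w) ((1, 0), 0)).1.1 with hT
  have hself : ∀ j, (V (P, w)).1.2 j = c j * P.2 j + d j * P.2 j ^ 2 ∧
      A₀ = A j + (p j - 1) * d j * P.2 j := by
    intro j
    have h1 := hprof j (P.2 j) (hP.2 j).1 (hP.2 j).2 w hw
    rw [seg_self, h.vertical_eq_mul hk hP hw hw] at h1
    exact ⟨h1.1, mul_right_cancel₀ hw0.ne' h1.2⟩
  -- the Lie condition along the test function of value `w` and slope `m` at `P`
  have key : ∀ m : ℝ, (∀ s ∈ Icc 0 (P.2 i), w + m * (s - P.2 i) ∈ U) →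
      (fderiv ℝ V (P, w) ((1, 0), 0)).2 - m * (fderiv ℝ V (P, w) ((1, 0), 0)).1.2 i = 0 := by
    intro m hm
    set f : ℝ → ℝ := fun s => w + m * (s - P.2 i) with hf
    have hfan : ∀ s, AnalyticAt ℝ f s := fun s => by fun_prop
    have hfx : f (P.2 i) = w := by simp [hf]
    have hfd : deriv f (P.2 i) = m := by
      have : HasDerivAt f _ (P.2 i) :=
        (((hasDerivAt_id (P.2 i)).sub_const (P.2 i)).const_mul m).const_add w
      simpa using this.deriv
    set κ := ∑ j, α j * f (P.2 i) ^ β j * rlDeriv (p j) j (testFun P i f 0) P with hκ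
    set u := testFun P i f κ with hu
    have huan : AnalyticOnNhd ℝ u (box P) := fun q _ => analyticAt_testFun (hfan _)
    have huU : ∀ q ∈ box P, u q ∈ U := testFun_mem hm κ
    have huP : u P = w := by rw [hu, testFun_self, hfx]
    have hE : diffusion α β p u P = 0 := by rw [hu, diffusion_testFun (hfan _), hκ, sub_self]
    have hVu : ∀ q ∈ box P, AnalyticAt ℝ V (q, u q) := fun q hq =>
      h.symm.analytic _ (mem_domain_of_mem_box hP hq (huU q hq))
    have h1 := prolong_diffusion_of_projective (fun j => (h.order j).1.le) hP0 huan
      (by rwa [huP]) hVu hE (A := A₀) (T := T) (c := c) (a := d)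
      (by rw [huP]; exact h.vertical_eq_mul hk hP hw hw) (by rw [huP]; exact fun j => (hself j).1)
      (fun j => ?_)
      (fun j => by rw [(hself j).2]; linear_combination hβ₁ j + P.2 j * hβ₂ j)
    · rw [h.symm.lie P hP.1 hP.2 u huan huU hE, huP] at h1
      have hsplit : fderiv ℝ V (P, w) ((1, 0), fderiv ℝ u P (1, 0)) =
          fderiv ℝ V (P, w) ((1, 0), 0) + fderiv ℝ u P (1, 0) • fderiv ℝ V (P, w) (0, 1) := by
        rw [← map_smul, ← map_add]; simp
      have hv : ∀ v, fderiv ℝ u P v = m * v.2 i + κ * v.1 := fun v => by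
        rw [hu, fderiv_testFun (hfan _), hfd]
      have hzt : (fderiv ℝ V (P, w) (0, 1)).1.1 = 0 :=
        fderiv_vertical_time h.symm h.coeff h.order h.isOpen h.ordConnected h.pos hP i
          (ContinuousLinearMap.fst ℝ ℝ (Fin N → ℝ)) (by simp [dir]) hw
      rw [hsplit, hv, hv] at h1
      simp only [Prod.fst_add, Prod.snd_add, Prod.smul_fst, Prod.smul_snd, Pi.add_apply,
        Pi.smul_apply, smul_eq_mul, h.fderiv_vertical_space hP i hw, hzt, ← hA₀, ← hT,
        Pi.zero_apply] at h1
      linear_combination -h1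
    · have hU' : ∀ᶠ y in 𝓝 (P.2 j), ∀ s ∈ Icc 0 y, u (seg P j s) ∈ U := by
        refine eventually_forall_Icc (fun s hs => huU _ (seg_mem_box hP0 j hs)) ?_
        have h2 : ContinuousAt (fun s => u (seg P j s)) (P.2 j) :=
          ContinuousAt.comp (g := u) (by rw [seg_self]; exact (huan P (self_mem_box hP0)).continuousAt)
            (analyticAt_seg P j _).continuousAt
        exact h2.eventually (h.isOpen.mem_nhds (by simpa only [seg_self, huP] using hw))
      filter_upwards [hU', eventually_lt_bound hP j] with y hy hyb s hs
      have hwU := hy s ⟨hs.1.le, hs.2.le⟩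
      have hsb : (s : EReal) < b j := lt_trans (EReal.coe_lt_coe_iff.2 hs.2) hyb
      have h2 := hprof j s hs.1 hsb _ hwU
      have htr := fun (l : Base N →L[ℝ] ℝ) (hl : l (dir j) = 0) =>
        transverse_eq h.symm h.coeff h.order h.isOpen h.ordConnected h.pos hP j l hl hw hwU hs.1 hsb
      rw [huP]
      refine Prod.ext (Prod.ext (htr (ContinuousLinearMap.fst ℝ ℝ (Fin N → ℝ)) (by simp [dir]))
        (funext fun n => ?_)) ?_
      · rcases eq_or_ne n j with rfl | hn
        · simpa using h2.1
        · have := htr ((ContinuousLinearMap.proj (R := ℝ) (φ := fun _ : Fin N => ℝ) n).comp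
            (ContinuousLinearMap.snd ℝ ℝ (Fin N → ℝ))) (by simp [dir, hn])
          simpa [hn] using this
      · rw [h2.2, (hself j).2]; ring
  have h0 := key 0 (fun s _ => by simpa using hw)
  rw [zero_mul, sub_zero] at h0
  refine ⟨h0, ?_⟩
  obtain ⟨δ, hδ, hδU⟩ := exists_ne_zero_add_mul_mem h.isOpen hw (P.2 i)
  have h1 := key δ (fun s hs => hδU _ (by
    rw [abs_le]; constructor <;> linarith [hs.1, hs.2, hP0 i]))
  rw [h0, zero_sub, neg_eq_zero] at h1
  exact (mul_eq_zero.1 h1).resolve_left hδ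

/-- The spatial and vertical components of a point symmetry take the same value at all times. -/
theorem eq_of_time {k : Fin N} (hk : β k ≠ 0) {x : Fin N → ℝ} {t t' : ℝ}
    (hP : (t, x) ∈ interiorBase I b) (ht' : t' ∈ I) {w : ℝ} (hw : w ∈ U) :
    (V ((t, x), w)).2 = (V ((t', x), w)).2 ∧
      ∀ i, (V ((t, x), w)).1.2 i = (V ((t', x), w)).1.2 i := by
  have hd : ∀ r ∈ I, HasDerivAt (fun t => V ((t, x), w))
      (fderiv ℝ V ((r, x), w) ((1, 0), 0)) r := fun r hr =>
    h.hasDerivAt_timeShift (P := (r, x)) ⟨hr, hP.2⟩ hw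
  have hz : ∀ r ∈ I, ∀ i, _ := fun r hr i =>
    h.fderiv_time_eq_zero hk (P := (r, x)) ⟨hr, hP.2⟩ hw i
  have hI := h.ordConnected_time.isPreconnected
  constructor
  · have h1 : ∀ r ∈ I, HasDerivAt (fun t => (V ((t, x), w)).2) 0 r := fun r hr => by
      have h2 : HasDerivAt (fun t => (V ((t, x), w)).2)
        (fderiv ℝ V ((r, x), w) ((1, 0), 0)).2 r := (hd r hr).snd
      rwa [(hz r hr k).1] at h2
    exact h.isOpen_time.is_const_of_deriv_eq_zero hI
      (fun r hr => (h1 r hr).differentiableAt.differentiableWithinAt) (fun r hr => (h1 r hr).deriv)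
      hP.1 ht'
  · intro i
    have h1 : ∀ r ∈ I, HasDerivAt (fun t => (V ((t, x), w)).1.2 i) 0 r := fun r hr => by
      have h2 : HasDerivAt (fun t => (V ((t, x), w)).1.2 i)
        ((fderiv ℝ V ((r, x), w) ((1, 0), 0)).1.2 i) r := (hasDerivAt_pi.1 (hd r hr).fst.snd) i
      rwa [(hz r hr i).2] at h2
    exact h.isOpen_time.is_const_of_deriv_eq_zero hI
      (fun r hr => (h1 r hr).differentiableAt.differentiableWithinAt) (fun r hr => (h1 r hr).deriv)
      hP.1 ht'

/-- In the interior a point symmetry is a combination of the generators; `k` is any index with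
`β k ≠ 0`. -/
theorem exists_eq_genSpan {k : Fin N} (hk : β k ≠ 0) (hI : I.Nonempty) (hU : U.Nonempty) :
    ∃ c₁ c₂ c₃ c₄ : ℝ,
      (c₄ = 0 ∨ β k * (p k - 1) = 2 * p k ∧ ∀ j, j ≠ k → β j = 0) ∧
      ∀ P ∈ interiorBase I b, ∀ w ∈ U, V (P, w) = genSpan β p k c₁ c₂ c₃ c₄ (P, w) := by
  obtain ⟨t₀, ht₀⟩ := hI
  obtain ⟨w₀, hw₀⟩ := hU
  have hx : ∀ i, ∃ y : ℝ, 0 < y ∧ (y : EReal) < b i := fun i => by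
    obtain ⟨y, hy, hyb⟩ := EReal.lt_iff_exists_real_btwn.1 (h.bound_pos i)
    exact ⟨y, EReal.coe_pos.1 hy, hyb⟩
  choose x₀ hx₀ using hx
  have hP₀ : ((t₀, x₀) : Base N) ∈ interiorBase I b := ⟨ht₀, hx₀⟩
  choose c d A hprof hβ₁ hβ₂ using fun j => h.exists_profile hk hP₀ j hw₀
  set T := (fderiv ℝ V ((t₀, x₀), w₀) ((1, 0), 0)).1.1 with hT
  -- `ξ^i` depends on `x_i` only, so its profile through the base point determines it
  have hξ : ∀ P ∈ interiorBase I b, ∀ w ∈ U, ∀ i, (V (P, w)).1.2 i =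
      c i * P.2 i + d i * P.2 i ^ 2 := by
    intro P hP w hw i
    have h1 := (h.eq_of_time hk (t := P.1) (x := P.2) hP ht₀ hw).2 i
    have hs := seg_mem_interiorBase hP₀ (hP.2 i).1 (hP.2 i).2
    refine h1.trans (Eq.trans ?_ (hprof i _ (hP.2 i).1 (hP.2 i).2 w hw).1)
    refine eq_of_seg_invariant (F := fun Q => (V (Q, w)).1.2 i) (S := {j | i ≠ j})
      (fun Q hQ j hj s hs hsb => ?_) (Q := (t₀, P.2)) ⟨ht₀, hP.2⟩ hs rfl fun j hj => ?_
    · have hij : i ≠ j := hj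
      exact transverse_eq h.symm h.coeff h.order h.isOpen h.ordConnected h.pos hQ j
        ((ContinuousLinearMap.proj (R := ℝ) (φ := fun _ : Fin N => ℝ) i).comp
            (ContinuousLinearMap.snd ℝ ℝ (Fin N → ℝ))) (by simp [dir, hij]) hw hw hs hsb
    · obtain rfl : i = j := not_not.1 hj
      simp
  have hτ : ∀ P ∈ interiorBase I b, ∀ w ∈ U, (V (P, w)).1.1 = (V ((P.1, x₀), w₀)).1.1 := by
    intro P hP w hw
    have htr := fun Q (hQ : Q ∈ interiorBase I b) w (hw : w ∈ U) j s (hs : 0 < s) hsb =>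
      transverse_eq h.symm h.coeff h.order h.isOpen h.ordConnected h.pos hQ j
        (ContinuousLinearMap.fst ℝ ℝ (Fin N → ℝ)) (by simp [dir]) hw₀ hw (s := s) hs hsb
    refine Eq.trans ?_ (eq_of_seg_invariant (F := fun Q => (V (Q, w₀)).1.1) (S := univ)
      (fun Q hQ j _ s hs hsb => htr Q hQ w₀ hw₀ j s hs hsb) hP (Q' := (P.1, x₀)) ⟨hP.1, hx₀⟩ rfl
        fun i hi => absurd (mem_univ i) hi)
    have := htr P hP w hw k _ (hP.2 k).1 (hP.2 k).2
    rwa [seg_self] at this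
  have hτd : ∀ P ∈ interiorBase I b, HasDerivAt (fun t => (V ((t, x₀), w₀)).1.1)
      (fderiv ℝ V (P, w₀) ((1, 0), 0)).1.1 P.1 := by
    intro P hP
    have h1 : HasDerivAt (fun t => (V ((t, P.2), w₀)).1.1) _ P.1 :=
      (h.hasDerivAt_timeShift hP hw₀).fst.fst
    refine h1.congr_of_eventuallyEq ?_
    filter_upwards [h.isOpen_time.mem_nhds hP.1] with r hr
    exact (hτ (r, P.2) ⟨hr, hP.2⟩ w₀ hw₀).symm
  -- as `β k` is nonzero, `φ` is determined by `ξ^k` and `∂_t τ`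
  have hφ₀ : ∀ P ∈ interiorBase I b, ∀ w ∈ U, β k * (V (P, w)).2 =
      (p k * (c k + 2 * d k * P.2 k) - (fderiv ℝ V (P, w₀) ((1, 0), 0)).1.1) * w := by
    intro P hP w hw
    obtain ⟨c', d', A', h1, h2, h3⟩ := h.exists_profile hk hP k hw₀
    obtain ⟨rfl, rfl⟩ := quadratic_unique (h.bound_pos k) fun y hy hyb =>
      (h1 y hy hyb w₀ hw₀).1.symm.trans (by
        simpa using hξ _ (seg_mem_interiorBase hP hy hyb) w₀ hw₀ k)
    have h4 := (h1 _ (hP.2 k).1 (hP.2 k).2 w hw).2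
    rw [seg_self] at h4
    rw [h4]
    linear_combination w * h2 + P.2 k * w * h3
  -- `φ` and `ξ^k` do not depend on time, hence neither does `∂_t τ`
  have hTc : ∀ P ∈ interiorBase I b, (fderiv ℝ V (P, w₀) ((1, 0), 0)).1.1 = T := by
    intro P hP
    have hP' : ((P.1, x₀) : Base N) ∈ interiorBase I b := ⟨hP.1, hx₀⟩
    rw [(hτd P hP).unique (hτd (P.1, x₀) hP')]
    have h1 := hφ₀ _ hP' w₀ hw₀
    rw [(h.eq_of_time hk hP' ht₀ hw₀).1, hφ₀ _ hP₀ w₀ hw₀] at h1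
    have h2 := mul_right_cancel₀ (h.pos hw₀).ne' h1
    simp only at h2
    linarith
  have hτc : ∀ t ∈ I, (V ((t, x₀), w₀)).1.1 = (V ((t₀, x₀), w₀)).1.1 - T * t₀ + T * t := by
    intro t ht
    have h1 : ∀ r ∈ I, HasDerivAt (fun t => (V ((t, x₀), w₀)).1.1 - T * t) 0 r := fun r hr => by
      have hr' : ((r, x₀) : Base N) ∈ interiorBase I b := ⟨hr, hx₀⟩
      have h2 := hτd _ hr'
      rw [hTc _ hr'] at h2
      exact (h2.fun_sub ((hasDerivAt_id r).const_mul T)).congr_deriv (by simp)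
    have h2 := h.isOpen_time.is_const_of_deriv_eq_zero h.ordConnected_time.isPreconnected
      (fun r hr => (h1 r hr).differentiableAt.differentiableWithinAt) (fun r hr => (h1 r hr).deriv)
      ht ht₀
    linarith
  set c₃ := (p k * c k - T) / β k with hc₃
  have hc₃' : β k * c₃ = p k * c k - T := by rw [hc₃]; field_simp
  have hφ : ∀ P ∈ interiorBase I b, ∀ w ∈ U, (V (P, w)).2 = (c₃ + (p k - 1) * d k * P.2 k) * w := by
    intro P hP w hw
    apply mul_left_cancel₀ hk
    rw [hφ₀ P hP w hw, hTc P hP]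
    linear_combination (-w) * hc₃' - P.2 k * w * hβ₂ k
  have hpi : ∀ i, p i - 1 ≠ 0 := fun i hi => (h.order i).2 1 (by push_cast; linarith)
  -- the other directions: comparing the profile along `x_i` with the known `u`-component
  have hother : ∀ i, i ≠ k → d i = 0 ∧ ∀ y : ℝ, 0 < y → (y : EReal) < b k →
      β i * (c₃ + (p k - 1) * d k * y) = p i * c i - T := by
    intro i hi
    have hgen : ∀ P ∈ interiorBase I b, d i = 0 ∧
        β i * (c₃ + (p k - 1) * d k * P.2 k) = p i * c i - T := by
      intro P hP
      obtain ⟨c', d', A', h1, h2, h3⟩ := h.exists_profile hk hP i hw₀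
      obtain ⟨rfl, rfl⟩ := quadratic_unique (h.bound_pos i) fun y hy hyb =>
        (h1 y hy hyb w₀ hw₀).1.symm.trans (by
          simpa using hξ _ (seg_mem_interiorBase hP hy hyb) w₀ hw₀ i)
      obtain ⟨h4, h5⟩ := affine_unique (h.bound_pos i) (A := A') (d := (p i - 1) * d i)
        (A' := c₃ + (p k - 1) * d k * P.2 k) (d' := 0) fun y hy hyb => by
          have h6 := (h1 y hy hyb w₀ hw₀).2
          rw [hφ _ (seg_mem_interiorBase hP hy hyb) w₀ hw₀, seg_snd_of_ne P hi.symm] at h6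
          have := mul_right_cancel₀ (h.pos hw₀).ne' h6
          linarith
      rw [h4, hTc P hP] at h2
      exact ⟨(mul_eq_zero.1 h5).resolve_left (hpi i), h2⟩
    refine ⟨(hgen _ hP₀).1, fun y hy hyb => ?_⟩
    simpa using (hgen _ (seg_mem_interiorBase hP₀ hy hyb)).2
  have hother' : ∀ i, i ≠ k → β i * c₃ = p i * c i - T ∧ β i * d k = 0 := by
    intro i hi
    obtain ⟨h1, h2⟩ := affine_unique (h.bound_pos k) (A := β i * c₃)
      (d := β i * ((p k - 1) * d k)) (A' := p i * c i - T) (d' := 0) fun y hy hyb => by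
        linarith [(hother i hi).2 y hy hyb]
    refine ⟨h1, (mul_eq_zero.1 (show (p k - 1) * (β i * d k) = 0 by linarith)).resolve_left (hpi k)⟩
  refine ⟨(V ((t₀, x₀), w₀)).1.1 - T * t₀, T, c₃, d k, ?_, fun P hP w hw => ?_⟩
  · by_cases hd : d k = 0
    · exact Or.inl hd
    · refine Or.inr ⟨mul_right_cancel₀ hd (by linarith [hβ₂ k]), fun j hj => ?_⟩
      exact (mul_eq_zero.1 (hother' j hj).2).resolve_right hd
  · rw [genSpan_apply]
    refine Prod.ext (Prod.ext ?_ (funext fun i => ?_)) ?_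
    · rw [hτ P hP w hw, hτc _ hP.1]
    · have hp0 := (h.order i).1.ne'
      rw [hξ P hP w hw]
      rcases eq_or_ne i k with rfl | hi
      · simp only [Pi.single_eq_same]
        have : (T + c₃ * β i) / p i = c i := by rw [div_eq_iff hp0]; linarith
        rw [this]
      · have : (T + c₃ * β i) / p i = c i := by rw [div_eq_iff hp0]; linarith [(hother' i hi).1]
        simp [this, (hother i hi).1, hi]
    · rw [hφ P hP w hw]

end SymmetrySetting

end

/-! ### The algebra of point symmetries -/

section

variable {N : ℕ} {α β p : Fin N → ℝ}

section algebra

variable {I : Set ℝ} {b : Fin N → EReal} {U : Set ℝ} {V : Total N → Total N}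

/-- Two fields that agree in the interior agree on the faces `x_i = 0` as well. -/
theorem eqOn_domain_of_continuousAt {V' : Total N → Total N}
    (hV : ∀ q ∈ domain I b U, ContinuousAt V q) (hV' : ∀ q ∈ domain I b U, ContinuousAt V' q)
    (h : ∀ P ∈ interiorBase I b, ∀ w ∈ U, V (P, w) = V' (P, w)) : EqOn V V' (domain I b U) := by
  intro q hq
  -- approach a point of a face by moving all spatial coordinates inwards
  have hlim : Tendsto (fun δ : ℝ => (((q.1.1, fun i => q.1.2 i + δ), q.2) : Total N))
      (𝓝[>] 0) (𝓝 q) := by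
    have h1 : ContinuousAt (fun δ : ℝ => (((q.1.1, fun i => q.1.2 i + δ), q.2) : Total N)) 0 := by
      fun_prop
    have h2 := h1.tendsto
    simp only [add_zero] at h2
    exact h2.mono_left nhdsWithin_le_nhds
  refine tendsto_nhds_unique ((hV q hq).tendsto.comp hlim)
    (((hV' q hq).tendsto.comp hlim).congr' ?_)
  have hb : ∀ᶠ δ in 𝓝[>] (0 : ℝ), ∀ i, ((q.1.2 i + δ : ℝ) : EReal) < b i := by
    refine eventually_all.2 fun i => nhdsWithin_le_nhds ?_
    have h1 : ContinuousAt (fun δ : ℝ => ((q.1.2 i + δ : ℝ) : EReal)) 0 :=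
      continuous_coe_real_ereal.continuousAt.comp (f := fun δ : ℝ => q.1.2 i + δ) (by fun_prop)
    exact h1.eventually (gt_mem_nhds (by simpa using (hq.2.1 i).2))
  filter_upwards [hb, self_mem_nhdsWithin] with δ hδb hδ
  exact (h (q.1.1, fun i => q.1.2 i + δ) ⟨hq.1, fun i => ⟨add_pos_of_nonneg_of_pos
      (hq.2.1 i).1 hδ, hδb i⟩⟩ _ hq.2.2).symm

theorem SymmetrySetting.exists_eqOn_genSpan (h : SymmetrySetting α β p I b U V) {k : Fin N}
    (hk : β k ≠ 0) (hI : I.Nonempty) (hU : U.Nonempty) :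
    ∃ c₁ c₂ c₃ c₄ : ℝ,
      (c₄ = 0 ∨ β k * (p k - 1) = 2 * p k ∧ ∀ j, j ≠ k → β j = 0) ∧
      EqOn V (genSpan β p k c₁ c₂ c₃ c₄) (domain I b U) := by
  obtain ⟨c₁, c₂, c₃, c₄, h4, heq⟩ := h.exists_eq_genSpan hk hI hU
  exact ⟨c₁, c₂, c₃, c₄, h4, eqOn_domain_of_continuousAt
    (fun q hq => (h.symm.analytic q hq).continuousAt)
    (fun q _ => (analyticAt_genSpan β p k c₁ c₂ c₃ c₄ q).continuousAt) heq⟩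

/-- The generators are linearly independent on the domain; `p k ≠ 1` keeps the `u`-component of `v₄`
from vanishing. -/
theorem genSpan_eqOn_zero (hIo : IsOpen I) (hI : I.Nonempty) (hb : ∀ i, 0 < b i)
    (hU : U.Nonempty) (hU0 : U ⊆ Ioi 0) {k : Fin N} (hpk : p k ≠ 1) {c₁ c₂ c₃ c₄ : ℝ}
    (h : ∀ q ∈ domain I b U, genSpan β p k c₁ c₂ c₃ c₄ q = 0) :
    c₁ = 0 ∧ c₂ = 0 ∧ c₃ = 0 ∧ c₄ = 0 := by
  obtain ⟨t, ht⟩ := hI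
  obtain ⟨w, hw⟩ := hU
  have hw0 : 0 < w := hU0 hw
  have hval : ∀ t ∈ I, ∀ y : ℝ, 0 < y → (y : EReal) < b k →
      c₁ + c₂ * t = 0 ∧ c₃ + (p k - 1) * c₄ * y = 0 := by
    intro t ht y hy hyb
    have h1 := h ((t, Pi.single k y), w) ⟨ht, fun i => ?_, hw⟩
    · rw [genSpan_apply] at h1
      have h2 := congrArg (fun q : Total N => q.1.1) h1
      have h3 := congrArg (fun q : Total N => q.2) h1
      simp only [Pi.single_eq_same, Prod.fst_zero, Prod.snd_zero] at h2 h3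
      exact ⟨h2, (mul_eq_zero.1 h3).resolve_right hw0.ne'⟩
    · rcases eq_or_ne i k with rfl | hi
      · simpa using ⟨hy.le, hyb⟩
      · simpa [hi] using hb i
  obtain ⟨y, hy, hyb⟩ := EReal.lt_iff_exists_real_btwn.1 (hb k)
  have h34 := affine_unique (hb k) (A := c₃) (d := (p k - 1) * c₄) (A' := 0) (d' := 0)
    fun y hy hyb => by linarith [(hval t ht y hy hyb).2]
  obtain ⟨δ, hδ, hδI⟩ := exists_ne_zero_add_mul_mem hIo ht 1
  have h1 := (hval t ht y (EReal.coe_pos.1 hy) hyb).1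
  have h2 := (hval (t + δ * 1) (hδI 1 (by simp)) y (EReal.coe_pos.1 hy) hyb).1
  have hc₂ : c₂ = 0 := (mul_eq_zero.1 (show c₂ * δ = 0 by linarith)).resolve_right hδ
  refine ⟨by rw [hc₂] at h1; linarith, hc₂, h34.1,
    (mul_eq_zero.1 h34.2).resolve_left (sub_ne_zero.2 hpk)⟩

theorem restrict_genSpan (k : Fin N) (c₁ c₂ c₃ c₄ : ℝ) :
    (domain I b U).domRestrict (genSpan β p k c₁ c₂ c₃ c₄) =
      c₁ • (domain I b U).domRestrict gen₁ + c₂ • (domain I b U).domRestrict (gen₂ p) +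
      c₃ • (domain I b U).domRestrict (gen₃ β p) + c₄ • (domain I b U).domRestrict (gen₄ p k) :=
  rfl

/-- Both cases at once: the coefficient of `v₄` must vanish unless the exceptional relation
holds. -/
theorem symmetryAlgebra_eq (hα : ∀ i, α i ≠ 0) (hp : ∀ i, 0 < p i ∧ ∀ n : ℕ, p i ≠ n)
    (hIo : IsOpen I) (hIc : I.OrdConnected) (hI : I.Nonempty) (hb : ∀ i, 0 < b i)
    (hUo : IsOpen U) (hUc : U.OrdConnected) (hU : U.Nonempty) (hU0 : U ⊆ Ioi 0) {k : Fin N}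
    (hk : β k ≠ 0) : symmetryAlgebra (diffusion α β p) I b U =
      {W | ∃ c₁ c₂ c₃ c₄ : ℝ,
        (c₄ = 0 ∨ β k * (p k - 1) = 2 * p k ∧ ∀ j, j ≠ k → β j = 0) ∧
        (domain I b U).domRestrict (genSpan β p k c₁ c₂ c₃ c₄) = W} := by
  ext W
  constructor
  · rintro ⟨V, hV, rfl⟩
    obtain ⟨c₁, c₂, c₃, c₄, h4, heq⟩ := SymmetrySetting.exists_eqOn_genSpan
      ⟨hV, hα, hp, hIo, hIc, hb, hUo, hUc, hU0⟩ hk hI hU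
    exact ⟨c₁, c₂, c₃, c₄, h4, funext fun q => (heq q.2).symm⟩
  · rintro ⟨c₁, c₂, c₃, c₄, h4, rfl⟩
    exact ⟨_, isPointSymmetry_genSpan (fun i => (hp i).1) hU0 k c₁ c₂ c₃ c₄ h4, rfl⟩

theorem symmetryAlgebra_generic (hα : ∀ i, α i ≠ 0) (hβ : ∃ i, β i ≠ 0)
    (hp : ∀ i, 0 < p i ∧ ∀ n : ℕ, p i ≠ n)
    (hIo : IsOpen I) (hIc : I.OrdConnected) (hI : I.Nonempty) (hb : ∀ i, 0 < b i)
    (hUo : IsOpen U) (hUc : U.OrdConnected) (hU : U.Nonempty) (hU0 : U ⊆ Ioi 0)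
    (hgen : ¬ ∃ k, β k * (p k - 1) = 2 * p k ∧ ∀ j, j ≠ k → β j = 0) :
    symmetryAlgebra (diffusion α β p) I b U =
      (Submodule.span ℝ (Set.range ![(domain I b U).domRestrict gen₁,
        (domain I b U).domRestrict (gen₂ p), (domain I b U).domRestrict (gen₃ β p)]) :
        Set (domain I b U → Total N)) ∧
    LinearIndependent ℝ ![(domain I b U).domRestrict gen₁,
      (domain I b U).domRestrict (gen₂ p), (domain I b U).domRestrict (gen₃ β p)] := by
  obtain ⟨k, hk⟩ := hβ
  have hpk : p k ≠ 1 := fun hi => (hp k).2 1 (by simpa using hi)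
  constructor
  · rw [symmetryAlgebra_eq hα hp hIo hIc hI hb hUo hUc hU hU0 hk]
    ext W
    simp only [SetLike.mem_coe, Submodule.mem_span_range_iff_exists_fun, Fin.sum_univ_three]
    constructor
    · rintro ⟨c₁, c₂, c₃, c₄, h4, rfl⟩
      obtain rfl : c₄ = 0 := h4.resolve_right fun h => hgen ⟨k, h⟩
      exact ⟨![c₁, c₂, c₃], by rw [restrict_genSpan, zero_smul, add_zero]; rfl⟩
    · rintro ⟨c, rfl⟩
      exact ⟨c 0, c 1, c 2, 0, Or.inl rfl, by rw [restrict_genSpan, zero_smul, add_zero]; rfl⟩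
  · rw [Fintype.linearIndependent_iff]
    intro c hc
    rw [Fin.sum_univ_three] at hc
    have h1 : (domain I b U).domRestrict (genSpan β p k (c 0) (c 1) (c 2) 0) = 0 := by
      rw [restrict_genSpan, zero_smul, add_zero]; exact hc
    obtain ⟨h1, h2, h3, -⟩ := genSpan_eqOn_zero hIo hI hb hU hU0 hpk
      fun q hq => congrFun h1 ⟨q, hq⟩
    intro i
    fin_cases i
    exacts [h1, h2, h3]

theorem symmetryAlgebra_exceptional (hα : ∀ i, α i ≠ 0)
    (hp : ∀ i, 0 < p i ∧ ∀ n : ℕ, p i ≠ n)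
    (hIo : IsOpen I) (hIc : I.OrdConnected) (hI : I.Nonempty) (hb : ∀ i, 0 < b i)
    (hUo : IsOpen U) (hUc : U.OrdConnected) (hU : U.Nonempty) (hU0 : U ⊆ Ioi 0) {k : Fin N}
    (hk : β k * (p k - 1) = 2 * p k) (hj : ∀ j, j ≠ k → β j = 0) :
    symmetryAlgebra (diffusion α β p) I b U =
      (Submodule.span ℝ (Set.range ![(domain I b U).domRestrict gen₁,
        (domain I b U).domRestrict (gen₂ p), (domain I b U).domRestrict (gen₃ β p),
        (domain I b U).domRestrict (gen₄ p k)]) : Set (domain I b U → Total N)) ∧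
    LinearIndependent ℝ ![(domain I b U).domRestrict gen₁,
      (domain I b U).domRestrict (gen₂ p), (domain I b U).domRestrict (gen₃ β p),
      (domain I b U).domRestrict (gen₄ p k)] := by
  have hpk : p k ≠ 1 := fun hi => (hp k).2 1 (by simpa using hi)
  have hβk : β k ≠ 0 := fun h0 => by
    rw [h0, zero_mul] at hk
    linarith [(hp k).1]
  constructor
  · rw [symmetryAlgebra_eq hα hp hIo hIc hI hb hUo hUc hU hU0 hβk]
    ext W
    simp only [SetLike.mem_coe, Submodule.mem_span_range_iff_exists_fun, Fin.sum_univ_four]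
    constructor
    · rintro ⟨c₁, c₂, c₃, c₄, -, rfl⟩
      exact ⟨![c₁, c₂, c₃, c₄], by rw [restrict_genSpan]; rfl⟩
    · rintro ⟨c, rfl⟩
      exact ⟨c 0, c 1, c 2, c 3, Or.inr ⟨hk, hj⟩, by rw [restrict_genSpan]; rfl⟩
  · rw [Fintype.linearIndependent_iff]
    intro c hc
    rw [Fin.sum_univ_four] at hc
    have h1 : (domain I b U).domRestrict (genSpan β p k (c 0) (c 1) (c 2) (c 3)) = 0 := by
      rw [restrict_genSpan]; exact hc
    obtain ⟨h1, h2, h3, h4⟩ := genSpan_eqOn_zero hIo hI hb hU hU0 hpk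
      fun q hq => congrFun h1 ⟨q, hq⟩
    intro i
    fin_cases i
    exacts [h1, h2, h3, h4]

end algebra

end

/-! ### Invariant functions -/

section

variable {N : ℕ} {α β p : Fin N → ℝ}

theorem isOpen_orthant (ι : Type) [Finite ι] : IsOpen (orthant ι) := by
  simp only [orthant, ofPred_forall]
  exact isOpen_iInter_of_finite fun i => isOpen_lt continuous_const (continuous_apply i)

/-- Along a curve `c` whose velocity is `w` at time `r`, a differentiable function changes at the
rate given by its derivative in the direction `w`. -/
theorem hasDerivAt_along {S : Set (Base N)} (hS : IsOpen S) {u : Base N → ℝ}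
    (hu : DifferentiableOn ℝ u S) {c : ℝ → Base N} {r : ℝ} {w : Base N} (hc : HasDerivAt c w r)
    (hr : c r ∈ S) : HasDerivAt (fun r => u (c r)) (fderiv ℝ u (c r) w) r :=
  ((hu _ hr).differentiableAt (hS.mem_nhds hr)).hasFDerivAt.comp_hasDerivAt (f := c) r hc

theorem isOpen_prod_orthant {S : Set ℝ} (hS : IsOpen S) : IsOpen (S ×ˢ orthant (Fin N)) :=
  hS.prod (isOpen_orthant _)

theorem eq_of_hasDerivAt_zero {f : ℝ → ℝ} (h : ∀ r, HasDerivAt f 0 r) (r r' : ℝ) : f r = f r' :=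
  is_const_of_deriv_eq_zero (fun r => (h r).differentiableAt) (fun r => (h r).deriv) r r'

theorem invariant_gen₁_iff {u : Base N → ℝ}
    (hu : DifferentiableOn ℝ u (univ ×ˢ orthant (Fin N))) :
    (∀ P ∈ univ ×ˢ orthant (Fin N), characteristic gen₁ u P = 0) ↔
      ∃ v : (Fin N → ℝ) → ℝ, ∀ P ∈ univ ×ˢ orthant (Fin N), u P = v P.2 := by
  have hd : ∀ P ∈ (univ : Set ℝ) ×ˢ orthant (Fin N), ∀ r : ℝ,
      HasDerivAt (fun r => u (r, P.2)) (fderiv ℝ u (r, P.2) (1, 0)) r := fun P hP r =>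
    hasDerivAt_along (isOpen_prod_orthant isOpen_univ) hu (c := fun r : ℝ => (r, P.2))
      ((hasDerivAt_id r).prodMk (hasDerivAt_const r P.2)) ⟨mem_univ _, hP.2⟩
  constructor
  · intro h
    refine ⟨fun x => u (0, x), fun P hP => eq_of_hasDerivAt_zero (f := fun r => u (r, P.2))
      (fun r => ?_) P.1 0⟩
    have h1 := h (r, P.2) ⟨mem_univ _, hP.2⟩
    simp only [characteristic, gen₁, zero_sub, neg_eq_zero] at h1
    simpa [h1] using hd P hP r
  · rintro ⟨v, hv⟩ P hP
    have h1 : HasDerivAt (fun r => u (r, P.2)) 0 P.1 := by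
      rw [show (fun r => u (r, P.2)) = fun _ => v P.2 from
        funext fun r => hv (r, P.2) ⟨mem_univ _, hP.2⟩]
      exact hasDerivAt_const _ _
    have h2 := (hd P hP P.1).unique h1
    simpa [characteristic, gen₁] using h2

theorem hasDerivAt_exp_mul (a x r : ℝ) :
    HasDerivAt (fun r => Real.exp (r * a) * x) (a * (Real.exp (r * a) * x)) r := by
  have h := (((hasDerivAt_id r).mul_const a).exp.mul_const x)
  refine h.congr_deriv ?_
  simp only [id]; ring

/-- The flow of `v₂`. -/
def flow₂ (p : Fin N → ℝ) (P : Base N) (r : ℝ) : Base N :=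
  (Real.exp (r * 1) * P.1, fun i => Real.exp (r * (1 / p i)) * P.2 i)

theorem hasDerivAt_flow₂ (p : Fin N → ℝ) (P : Base N) (r w : ℝ) :
    HasDerivAt (flow₂ p P) (gen₂ p (flow₂ p P r, w)).1 r := by
  refine ((hasDerivAt_exp_mul 1 P.1 r).prodMk
    (hasDerivAt_pi.2 fun i => hasDerivAt_exp_mul (1 / p i) (P.2 i) r)).congr_deriv ?_
  refine Prod.ext (by simp [gen₂, flow₂]) (funext fun i => ?_)
  simp [gen₂, flow₂]; ring

theorem flow₂_mem {P : Base N} (hP : P ∈ Ioi (0 : ℝ) ×ˢ orthant (Fin N)) (r : ℝ) :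
    flow₂ p P r ∈ Ioi (0 : ℝ) ×ˢ orthant (Fin N) :=
  ⟨mul_pos (Real.exp_pos _) hP.1, fun i => mul_pos (Real.exp_pos _) (hP.2 i)⟩

theorem exp_log_mul {t : ℝ} (ht : 0 < t) (a : ℝ) : Real.exp (-Real.log t * a) = t ^ (-a) := by
  rw [Real.rpow_def_of_pos ht]; ring_nf

theorem invariant_gen₂_iff {u : Base N → ℝ}
    (hu : DifferentiableOn ℝ u (Ioi 0 ×ˢ orthant (Fin N))) :
    (∀ P ∈ Ioi (0 : ℝ) ×ˢ orthant (Fin N), characteristic (gen₂ p) u P = 0) ↔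
      ∃ v : (Fin N → ℝ) → ℝ, ∀ P ∈ Ioi (0 : ℝ) ×ˢ orthant (Fin N),
        u P = similarityAnsatz p v P := by
  have hd : ∀ P ∈ Ioi (0 : ℝ) ×ˢ orthant (Fin N), ∀ r : ℝ, HasDerivAt (fun r => u (flow₂ p P r))
      (fderiv ℝ u (flow₂ p P r) (gen₂ p (flow₂ p P r, u (flow₂ p P r))).1) r := fun P hP r =>
    hasDerivAt_along (isOpen_prod_orthant isOpen_Ioi) hu (hasDerivAt_flow₂ p P r _)
      (flow₂_mem hP r)
  have h0 : ∀ P : Base N, flow₂ p P 0 = P := fun P => by simp [flow₂]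
  constructor
  · intro h
    -- the flow takes `P` to the cross-section `t = 1` at time `-log t`
    refine ⟨fun z => u (1, z), fun P hP => ?_⟩
    have ht : 0 < P.1 := hP.1
    have h1 := eq_of_hasDerivAt_zero (f := fun r => u (flow₂ p P r)) (fun r => by
      have h1 := h _ (flow₂_mem (p := p) hP r)
      have h2 : fderiv ℝ u (flow₂ p P r) (gen₂ p (flow₂ p P r, u (flow₂ p P r))).1 = 0 := by
        simpa only [characteristic, show (gen₂ p (flow₂ p P r, u (flow₂ p P r))).2 = 0 from rfl,
          zero_sub, neg_eq_zero] using h1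
      have h3 := hd P hP r
      rwa [h2] at h3) 0 (-Real.log P.1)
    simp only [h0] at h1
    rw [h1, flow₂, similarityAnsatz]
    congr 2
    · rw [exp_log_mul ht, Real.rpow_neg_one, inv_mul_cancel₀ ht.ne']
    · exact funext fun i => by rw [exp_log_mul ht]
  · rintro ⟨v, hv⟩ P hP
    have ht : 0 < P.1 := hP.1
    have h1 : HasDerivAt (fun r => u (flow₂ p P r)) 0 0 := by
      rw [show (fun r => u (flow₂ p P r)) = fun _ => u P from funext fun r => ?_]
      · exact hasDerivAt_const _ _
      · rw [hv _ (flow₂_mem hP r), hv P hP]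
        simp only [similarityAnsatz, flow₂]
        congr 1
        funext i
        rw [Real.mul_rpow (Real.exp_pos _).le ht.le, ← Real.exp_mul]
        have h2 : Real.exp (r * 1 * -(1 / p i)) * Real.exp (r * (1 / p i)) = 1 := by
          rw [← Real.exp_add, show r * 1 * -(1 / p i) + r * (1 / p i) = 0 by ring, Real.exp_zero]
        linear_combination (P.1 ^ (-(1 / p i)) * P.2 i) * h2
    have h2 := (hd P hP 0).unique h1
    rw [h0] at h2
    simpa only [characteristic, show (gen₂ p (P, u P)).2 = 0 from rfl, zero_sub, neg_eq_zero]
      using h2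

/-- The flow of `v₃` on the base. -/
def flow₃ (β p : Fin N → ℝ) (P : Base N) (r : ℝ) : Base N :=
  (P.1, fun i => Real.exp (r * (β i / p i)) * P.2 i)

theorem hasDerivAt_flow₃ (β p : Fin N → ℝ) (P : Base N) (r w : ℝ) :
    HasDerivAt (flow₃ β p P) (gen₃ β p (flow₃ β p P r, w)).1 r := by
  refine ((hasDerivAt_const r P.1).prodMk
    (hasDerivAt_pi.2 fun i => hasDerivAt_exp_mul (β i / p i) (P.2 i) r)).congr_deriv ?_
  refine Prod.ext (by simp [gen₃]) (funext fun i => ?_)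
  simp [gen₃, flow₃]; ring

theorem flow₃_mem {P : Base N} (hP : P ∈ (univ : Set ℝ) ×ˢ orthant (Fin N)) (r : ℝ) :
    flow₃ β p P r ∈ (univ : Set ℝ) ×ˢ orthant (Fin N) :=
  ⟨mem_univ _, fun i => mul_pos (Real.exp_pos _) (hP.2 i)⟩

theorem invariant_gen₃_iff (hp : ∀ i, 0 < p i) {k : Fin N} (hk : β k ≠ 0) {u : Base N → ℝ}
    (hu : DifferentiableOn ℝ u (univ ×ˢ orthant (Fin N))) :
    (∀ P ∈ univ ×ˢ orthant (Fin N), characteristic (gen₃ β p) u P = 0) ↔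
      ∃ v : ℝ × ({i : Fin N // i ≠ k} → ℝ) → ℝ, ∀ P ∈ univ ×ˢ orthant (Fin N),
        u P = scalingAnsatz β p k v P := by
  have hd : ∀ P ∈ (univ : Set ℝ) ×ˢ orthant (Fin N), ∀ r : ℝ,
      HasDerivAt (fun r => u (flow₃ β p P r)) (fderiv ℝ u (flow₃ β p P r)
        (gen₃ β p (flow₃ β p P r, u (flow₃ β p P r))).1) r := fun P hP r =>
    hasDerivAt_along (isOpen_prod_orthant isOpen_univ) hu (hasDerivAt_flow₃ β p P r _)
      (flow₃_mem hP r)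
  have h0 : ∀ P : Base N, flow₃ β p P 0 = P := fun P => by simp [flow₃]
  have hpk := (hp k).ne'
  constructor
  · intro h
    -- the flow takes `P` to the cross-section `x_k = 1` at time `-(p_k / β_k) log x_k`, and
    -- `u` grows exponentially along it
    refine ⟨fun q => u (q.1, fun i => if hi : i ≠ k then q.2 ⟨i, hi⟩ else 1), fun P hP => ?_⟩
    have hx : 0 < P.2 k := hP.2 k
    have h1 := eq_of_hasDerivAt_zero (f := fun r => Real.exp (r * (-1)) * u (flow₃ β p P r))
      (fun r => by
        have h1 := h _ (flow₃_mem (β := β) (p := p) hP r)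
        simp only [characteristic, show (gen₃ β p (flow₃ β p P r, u (flow₃ β p P r))).2 =
          u (flow₃ β p P r) from rfl] at h1
        have h3 := (((hasDerivAt_id r).mul_const (-1)).exp).fun_mul (hd P hP r)
        refine h3.congr_deriv ?_
        simp only [id]
        linear_combination (-Real.exp (r * (-1))) * h1) 0 (-Real.log (P.2 k) * (p k / β k))
    simp only [h0, zero_mul, Real.exp_zero, one_mul] at h1
    rw [h1, scalingAnsatz, mul_assoc, exp_log_mul hx]
    congr 1
    · ring_nf
    · rw [flow₃]
      congr 2
      funext i
      rw [mul_assoc, exp_log_mul hx]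
      by_cases hi : i = k
      · subst hi
        rw [dif_neg (by simp), div_mul_div_cancel₀ hk, div_self hpk, Real.rpow_neg_one,
          inv_mul_cancel₀ hx.ne']
      · rw [dif_pos hi, mul_comm]
        simp only [scalingExp]
        congr 2
        have := (hp i).ne'
        field_simp
  · rintro ⟨v, hv⟩ P hP
    have hx : 0 < P.2 k := hP.2 k
    have h1 : HasDerivAt (fun r => u (flow₃ β p P r)) (u P) 0 := by
      rw [show (fun r => u (flow₃ β p P r)) = fun r => Real.exp (r * 1) * u P from
        funext fun r => ?_]
      · exact (hasDerivAt_exp_mul 1 (u P) 0).congr_deriv (by simp)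
      · rw [hv _ (flow₃_mem hP r), hv P hP]
        simp only [scalingAnsatz, flow₃]
        have he : (Real.exp (r * (β k / p k)) * P.2 k) ^ (p k / β k) =
            Real.exp (r * 1) * P.2 k ^ (p k / β k) := by
          rw [Real.mul_rpow (Real.exp_pos _).le hx.le, ← Real.exp_mul]
          congr 2
          field_simp
        rw [he, mul_assoc]
        congr 4
        funext i
        have hpi := (hp i.1).ne'
        rw [Real.mul_rpow (Real.exp_pos _).le hx.le, ← Real.exp_mul]
        have h2 : Real.exp (r * (β i / p i)) *
            Real.exp (r * (β k / p k) * -scalingExp β p k i) = 1 := by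
          rw [← Real.exp_add, Real.exp_eq_one_iff, scalingExp]
          field_simp
          ring
        linear_combination (P.2 i * P.2 k ^ (-scalingExp β p k i)) * h2
    have h2 := (hd P hP 0).unique h1
    rw [h0] at h2
    simp only [characteristic, show (gen₃ β p (P, u P)).2 = u P from rfl, h2, sub_self]

/-! ### Reduction by time translations and by the scaling of time -/

theorem diffusion_stationary (v : (Fin N → ℝ) → ℝ) (P : Base N) :
    diffusion α β p (fun q => v q.2) P = -stationaryReduced α β p v P.2 := by
  simp [diffusion, stationaryReduced]

theorem stationary_reduction (v : (Fin N → ℝ) → ℝ) :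
    (∀ P ∈ (univ : Set ℝ) ×ˢ orthant (Fin N), diffusion α β p (fun q => v q.2) P = 0) ↔
      ∀ x ∈ orthant (Fin N), stationaryReduced α β p v x = 0 := by
  simp only [diffusion_stationary, neg_eq_zero]
  exact ⟨fun h x hx => h (0, x) ⟨mem_univ _, hx⟩, fun h P hP => h P.2 hP.2⟩

theorem iteratedDeriv_comp_mul_left (c : ℝ) (n : ℕ) (f : ℝ → ℝ) (x : ℝ) :
    iteratedDeriv n (fun y => f (c * y)) x = c ^ n * iteratedDeriv n f (c * x) := by
  induction n generalizing x with
  | zero => simp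
  | succ n ih =>
    rw [iteratedDeriv_succ, show iteratedDeriv n (fun y => f (c * y)) =
      fun x => c ^ n * iteratedDeriv n f (c * x) from funext ih, deriv_const_mul_field,
      deriv_comp_mul_left c (iteratedDeriv n f), iteratedDeriv_succ, smul_eq_mul, pow_succ,
          mul_assoc]

/-- Riemann-Liouville derivatives scale with their order. -/
theorem riemannLiouville_comp_mul_left {p : ℝ} (hp : 0 ≤ p) {c x : ℝ} (hc : 0 < c) (hx : 0 < x)
    (f : ℝ → ℝ) :
    riemannLiouville 0 p (fun s => f (c * s)) x = c ^ p * riemannLiouville 0 p f (c * x) := by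
  rw [riemannLiouville_eq, riemannLiouville_eq]
  have h1 : abel (rlExp p) (fun s => f (c * s)) =ᶠ[𝓝 x]
      fun y => c ^ (-rlExp p - 1) * abel (rlExp p) f (c * y) := by
    filter_upwards [lt_mem_nhds hx] with y hy
    have h2 : ∀ s ∈ uIcc 0 y, (y - s) ^ rlExp p * f (c * s) =
        c ^ (-rlExp p) * ((c * y - c * s) ^ rlExp p * f (c * s)) := by
      intro s hs
      rw [uIcc_of_le hy.le] at hs
      rw [← mul_sub, Real.mul_rpow hc.le (by linarith [hs.2]), Real.rpow_neg hc.le]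
      have := (Real.rpow_pos_of_pos hc (rlExp p)).ne'
      field_simp
    rw [abel, intervalIntegral.integral_congr h2, intervalIntegral.integral_const_mul,
      intervalIntegral.integral_comp_mul_left (fun r => (c * y - r) ^ rlExp p * f r) hc.ne',
      mul_zero, abel, smul_eq_mul, Real.rpow_sub_one hc.ne']
    ring
  rw [h1.iteratedDeriv_eq, iteratedDeriv_const_mul_field, iteratedDeriv_comp_mul_left]
  have h3 : c ^ (-rlExp p - 1) * c ^ rlOrd p = c ^ p := by
    rw [← Real.rpow_natCast c, ← Real.rpow_add hc, rlOrd_cast hp]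
    congr 1; ring
  rw [← h3]; ring

/-- On the similarity ansatz the diffusion operator is `-t⁻¹` times the reduced operator. -/
theorem diffusion_similarity (hp : ∀ i, 0 < p i) {v : (Fin N → ℝ) → ℝ}
    (hv : DifferentiableOn ℝ v (orthant (Fin N))) {P : Base N}
    (hP : P ∈ Ioi (0 : ℝ) ×ˢ orthant (Fin N)) :
    diffusion α β p (similarityAnsatz p v) P =
      -P.1⁻¹ * similarityReduced α β p v (fun i => P.1 ^ (-(1 / p i)) * P.2 i) := by
  have ht : 0 < P.1 := hP.1
  set z : Fin N → ℝ := fun i => P.1 ^ (-(1 / p i)) * P.2 i with hz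
  have hzm : z ∈ orthant (Fin N) := fun i => mul_pos (Real.rpow_pos_of_pos ht _) (hP.2 i)
  have hvz : HasFDerivAt v (fderiv ℝ v z) z :=
    ((hv z hzm).differentiableAt ((isOpen_orthant _).mem_nhds hzm)).hasFDerivAt
  have htime : HasDerivAt (fun s => similarityAnsatz p v (s, P.2))
      (∑ i, -(1 / p i) * P.1⁻¹ * z i * fderiv ℝ v z (Pi.single i 1)) P.1 := by
    have h1 : HasDerivAt (fun s : ℝ => fun i => s ^ (-(1 / p i)) * P.2 i)
        (fun i => -(1 / p i) * P.1⁻¹ * z i) P.1 := by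
      refine hasDerivAt_pi.2 fun i => ?_
      refine ((Real.hasDerivAt_rpow_const (p := -(1 / p i))
        (Or.inl ht.ne')).mul_const (P.2 i)).congr_deriv ?_
      rw [Real.rpow_sub_one ht.ne', hz]
      ring
    refine (hvz.comp_hasDerivAt (f := fun s : ℝ => fun i => s ^ (-(1 / p i)) * P.2 i) P.1
      h1).congr_deriv ?_
    conv_lhs => rw [pi_eq_sum_univ' (fun i => -(1 / p i) * P.1⁻¹ * z i)]
    rw [map_sum]
    refine Finset.sum_congr rfl fun i _ => ?_
    rw [map_smul, smul_eq_mul]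
  have hspace : ∀ i, partialRL 0 (p i) i (fun y => similarityAnsatz p v (P.1, y)) P.2 =
      P.1⁻¹ * partialRL 0 (p i) i v z := by
    intro i
    have hc := Real.rpow_pos_of_pos ht (-(1 / p i))
    have h1 : (fun s => similarityAnsatz p v (P.1, Function.update P.2 i s)) =
        fun s => v (Function.update z i (P.1 ^ (-(1 / p i)) * s)) := by
      funext s
      simp only [similarityAnsatz]
      congr 1
      funext j
      rcases eq_or_ne j i with rfl | hj
      · simp
      · simp [hj, hz]
    rw [partialRL, partialRL, h1, riemannLiouville_comp_mul_left (hp i).le hc (hP.2 i)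
      (fun s => v (Function.update z i s)), ← Real.rpow_mul ht.le]
    have := (hp i).ne'
    rw [show -(1 / p i) * p i = -1 by field_simp, Real.rpow_neg_one]
  have hval : similarityAnsatz p v P = v z := rfl
  rw [diffusion, htime.deriv, similarityReduced, Finset.mul_sum, ← Finset.sum_sub_distrib]
  refine Finset.sum_congr rfl fun i _ => ?_
  rw [hspace, hval]
  ring

theorem similarity_reduction (hp : ∀ i, 0 < p i) {v : (Fin N → ℝ) → ℝ}
    (hv : DifferentiableOn ℝ v (orthant (Fin N))) :
    (∀ P ∈ Ioi (0 : ℝ) ×ˢ orthant (Fin N), diffusion α β p (similarityAnsatz p v) P = 0) ↔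
      ∀ z ∈ orthant (Fin N), similarityReduced α β p v z = 0 := by
  constructor
  · intro h z hz
    have hP : ((1, z) : Base N) ∈ Ioi (0 : ℝ) ×ˢ orthant (Fin N) := ⟨mem_Ioi.2 one_pos, hz⟩
    have h1 := h _ hP
    rw [diffusion_similarity hp hv hP] at h1
    simpa using h1
  · intro h P hP
    have ht : 0 < P.1 := hP.1
    rw [diffusion_similarity hp hv hP,
      h _ fun i => mul_pos (Real.rpow_pos_of_pos ht _) (hP.2 i), mul_zero]

end

/-! ### Products of Euler operators -/

section

variable {N : ℕ} {α β p : Fin N → ℝ}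

theorem differentiableAt_of_contDiffOn {ι : Type} [Fintype ι] {n : ℕ} {g : (ι → ℝ) → ℝ}
    (hg : ContDiffOn ℝ ((n + 1 : ℕ) : WithTop ℕ∞) g (orthant ι)) {z : ι → ℝ}
    (hz : z ∈ orthant ι) : DifferentiableAt ℝ g z :=
  (hg.contDiffAt ((isOpen_orthant ι).mem_nhds hz)).differentiableAt (by simp)

section euler

variable {ι : Type} [Fintype ι] [DecidableEq ι] {γ : ι → ℝ}

/-- The first-order operator `c - ∑ γ_i z_i ∂_{z_i}`. -/
def eulerStep (γ : ι → ℝ) (c : ℝ) (g : (ι → ℝ) → ℝ) (z : ι → ℝ) : ℝ :=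
  c * g z - ∑ i, γ i * z i * fderiv ℝ g z (Pi.single i 1)

theorem eulerProd_succ (γ : ι → ℝ) (c : ℝ) (m : ℕ) (g : (ι → ℝ) → ℝ) :
    eulerProd γ c (m + 1) g = eulerStep γ (c + m) (eulerProd γ c m g) := rfl

theorem eulerStep_eqOn {c : ℝ} {g g' : (ι → ℝ) → ℝ} (h : EqOn g g' (orthant ι)) :
    EqOn (eulerStep γ c g) (eulerStep γ c g') (orthant ι) := by
  intro z hz
  have h1 : g =ᶠ[𝓝 z] g' := h.eventuallyEq_of_mem ((isOpen_orthant ι).mem_nhds hz)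
  rw [eulerStep, eulerStep, h1.fderiv_eq, h hz]

theorem eulerProd_eqOn {c : ℝ} {g g' : (ι → ℝ) → ℝ} (h : EqOn g g' (orthant ι)) (m : ℕ) :
    EqOn (eulerProd γ c m g) (eulerProd γ c m g') (orthant ι) := by
  induction m with
  | zero => exact h
  | succ m ih => exact eulerStep_eqOn ih

theorem contDiffOn_eulerStep {c : ℝ} {m : ℕ} {g : (ι → ℝ) → ℝ}
    (hg : ContDiffOn ℝ ((m + 1 : ℕ) : WithTop ℕ∞) g (orthant ι)) :
    ContDiffOn ℝ (m : WithTop ℕ∞) (eulerStep γ c g) (orthant ι) := by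
  have h1 : ContDiffOn ℝ (m : WithTop ℕ∞) (fderiv ℝ g) (orthant ι) :=
    hg.fderiv_of_isOpen (isOpen_orthant ι) (by push_cast; exact le_rfl)
  have h2 : ContDiffOn ℝ (m : WithTop ℕ∞) g (orthant ι) :=
    hg.of_le (by exact_mod_cast Nat.le_succ m)
  refine (contDiffOn_const.mul h2).sub (ContDiffOn.sum fun i _ => ?_)
  exact ((contDiff_const.mul (contDiff_apply ℝ ℝ i)).contDiffOn).mul
    (h1.clm_apply contDiffOn_const)

theorem contDiffOn_eulerProd {c : ℝ} {n : ℕ} {g : (ι → ℝ) → ℝ} (m : ℕ)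
    (hg : ContDiffOn ℝ ((n + m : ℕ) : WithTop ℕ∞) g (orthant ι)) :
    ContDiffOn ℝ (n : WithTop ℕ∞) (eulerProd γ c m g) (orthant ι) := by
  induction m generalizing n with
  | zero => exact hg
  | succ m ih =>
    exact contDiffOn_eulerStep (ih (n := n + 1) (by rwa [show n + 1 + m = n + (m + 1) by ring]))

/-- The first-order factors commute. -/
theorem eulerStep_comm {c c' : ℝ} {g : (ι → ℝ) → ℝ}
    (hg : ContDiffOn ℝ ((2 : ℕ) : WithTop ℕ∞) g (orthant ι)) :
    EqOn (eulerStep γ c (eulerStep γ c' g)) (eulerStep γ c' (eulerStep γ c g)) (orthant ι) := by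
  intro z hz
  have hgd := differentiableAt_of_contDiffOn hg hz
  set E : (ι → ℝ) → ℝ := fun z => ∑ i, γ i * z i * fderiv ℝ g z (Pi.single i 1) with hE
  have hEd : DifferentiableAt ℝ E z := by
    have h1 := differentiableAt_of_contDiffOn (contDiffOn_eulerStep (γ := γ) (c := 0) hg) hz
    have h2 : E = fun z => -eulerStep γ 0 g z := by
      funext z; simp [eulerStep, hE]
    rw [h2]; exact h1.neg
  have hstep : ∀ c v, fderiv ℝ (eulerStep γ c g) z v = c * fderiv ℝ g z v - fderiv ℝ E z v := by
    intro c v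
    have h1 : HasFDerivAt (eulerStep γ c g) _ z :=
      (hgd.hasFDerivAt.const_mul c).sub hEd.hasFDerivAt
    rw [h1.fderiv]; simp
  have hexp : ∀ c c', eulerStep γ c (eulerStep γ c' g) z = c * c' * g z - (c + c') * E z +
      ∑ i, γ i * z i * fderiv ℝ E z (Pi.single i 1) := by
    intro c c'
    rw [eulerStep]
    simp only [hstep, mul_sub, Finset.sum_sub_distrib]
    have h1 : ∑ i, γ i * z i * (c' * fderiv ℝ g z (Pi.single i 1)) = c' * E z := by
      rw [hE, Finset.mul_sum]
      exact Finset.sum_congr rfl fun i _ => by ring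
    rw [h1, eulerStep]
    simp only [hE]
    ring
  rw [hexp, hexp]
  ring

/-- The factor of lowest index may be moved to the front of the product. -/
theorem eulerProd_succ' {c : ℝ} (m : ℕ) {g : (ι → ℝ) → ℝ}
    (hg : ContDiffOn ℝ ((m + 1 : ℕ) : WithTop ℕ∞) g (orthant ι)) :
    EqOn (eulerProd γ c (m + 1) g) (eulerStep γ c (eulerProd γ (c + 1) m g)) (orthant ι) := by
  induction m with
  | zero => intro z _; simp [eulerProd, eulerStep]
  | succ m ih =>
    have h1 := ih (hg.of_le (by exact_mod_cast Nat.le_succ (m + 1)))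
    rw [eulerProd_succ]
    refine (eulerStep_eqOn h1).trans ?_
    refine (eulerStep_comm (contDiffOn_eulerProd m
      (by rwa [show 2 + m = m + 1 + 1 by ring]))).trans ?_
    rw [eulerProd_succ, show c + ((m + 1 : ℕ) : ℝ) = c + 1 + m by push_cast; ring]
    exact fun z _ => rfl

theorem hasDerivAt_rpow_mul_comp {e : ℝ} {x : ι → ℝ} {H : (ι → ℝ) → ℝ} {y : ℝ} (hy : 0 < y)
    (hH : DifferentiableAt ℝ H fun i => x i * y ^ (-γ i)) :
    HasDerivAt (fun y => y ^ e * H (fun i => x i * y ^ (-γ i)))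
      (y ^ (e - 1) * eulerStep γ e H (fun i => x i * y ^ (-γ i))) y := by
  set z : ι → ℝ := fun i => x i * y ^ (-γ i) with hz
  have h1 : HasDerivAt (fun y : ℝ => fun i => x i * y ^ (-γ i))
      (fun i => -γ i * z i * y⁻¹) y := by
    refine hasDerivAt_pi.2 fun i => ?_
    refine ((Real.hasDerivAt_rpow_const (p := -γ i) (Or.inl hy.ne')).const_mul
      (x i)).congr_deriv ?_
    rw [Real.rpow_sub_one hy.ne', hz]
    ring
  have h2 := (Real.hasDerivAt_rpow_const (p := e) (Or.inl hy.ne')).fun_mul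
    (hH.hasFDerivAt.comp_hasDerivAt (f := fun y : ℝ => fun i => x i * y ^ (-γ i)) y h1)
  refine h2.congr_deriv ?_
  have h3 : fderiv ℝ H z (fun i => -γ i * z i * y⁻¹) =
      -y⁻¹ * ∑ i, γ i * z i * fderiv ℝ H z (Pi.single i 1) := by
    conv_lhs => rw [pi_eq_sum_univ' (fun i => -γ i * z i * y⁻¹)]
    rw [map_sum, Finset.mul_sum]
    refine Finset.sum_congr rfl fun i _ => ?_
    rw [map_smul, smul_eq_mul]
    ring
  rw [h3, eulerStep, Real.rpow_sub_one hy.ne', Function.comp]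
  ring

/-- Derivatives of `y^e G(x y^{-γ})` in the variable `y`. Every derivative lowers the power of `y`
by one and so adds a factor of index one below the others. -/
theorem iteratedDeriv_rpow_mul_comp {e : ℝ} {x : ι → ℝ} (hx : x ∈ orthant ι) {n : ℕ}
    {G : (ι → ℝ) → ℝ} (hG : ContDiffOn ℝ (n : WithTop ℕ∞) G (orthant ι)) {m : ℕ} (hm : m ≤ n)
    {y : ℝ} (hy : 0 < y) :
    iteratedDeriv m (fun y => y ^ e * G (fun i => x i * y ^ (-γ i))) y =
      y ^ (e - m) * eulerProd γ (e - m + 1) m G (fun i => x i * y ^ (-γ i)) := by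
  induction m generalizing y with
  | zero => simp [eulerProd]
  | succ m ih =>
    have hz : ∀ {y : ℝ}, 0 < y → (fun i => x i * y ^ (-γ i)) ∈ orthant ι := fun hy i =>
      mul_pos (hx i) (Real.rpow_pos_of_pos hy _)
    have hGm : ContDiffOn ℝ ((m + 1 : ℕ) : WithTop ℕ∞) G (orthant ι) :=
      hG.of_le (by exact_mod_cast hm)
    have hev : iteratedDeriv m (fun y => y ^ e * G (fun i => x i * y ^ (-γ i))) =ᶠ[𝓝 y]
        fun y => y ^ (e - m) * eulerProd γ (e - m + 1) m G (fun i => x i * y ^ (-γ i)) := by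
      filter_upwards [lt_mem_nhds hy] with y hy using ih (by omega) hy
    have hd : DifferentiableAt ℝ (eulerProd γ (e - m + 1) m G) fun i => x i * y ^ (-γ i) :=
      differentiableAt_of_contDiffOn (n := 0)
        (contDiffOn_eulerProd m (by rwa [show 0 + 1 + m = m + 1 by ring])) (hz hy)
    rw [iteratedDeriv_succ, hev.deriv_eq, (hasDerivAt_rpow_mul_comp hy hd).deriv,
      show e - ((m + 1 : ℕ) : ℝ) = e - m - 1 by push_cast; ring,
      eulerProd_succ' m hGm (hz hy), sub_add_cancel]

/-- Conjugation by a power of one variable shifts the constants of the factors. -/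
theorem eulerProd_rpow_mul {c c' s : ℝ} (l : ι) (hs : γ l * s = c) (m : ℕ) {G : (ι → ℝ) → ℝ}
    (hG : ContDiffOn ℝ (m : WithTop ℕ∞) G (orthant ι)) :
    EqOn (eulerProd γ c' m fun z => z l ^ (-s) * G z)
      (fun z => z l ^ (-s) * eulerProd γ (c' + c) m G z) (orthant ι) := by
  induction m with
  | zero => exact fun z _ => rfl
  | succ m ih =>
    have h1 := ih (hG.of_le (by exact_mod_cast Nat.le_succ m))
    rw [eulerProd_succ, eulerProd_succ]
    refine (eulerStep_eqOn h1).trans fun z hz => ?_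
    set H := eulerProd γ (c' + c) m G with hH
    have hHd : DifferentiableAt ℝ H z := differentiableAt_of_contDiffOn (n := 0)
      (contDiffOn_eulerProd m (by rwa [show 0 + 1 + m = m + 1 by ring])) hz
    have hl : HasFDerivAt (fun z : ι → ℝ => z l)
        (ContinuousLinearMap.proj (R := ℝ) (φ := fun _ : ι => ℝ) l) z :=
      (ContinuousLinearMap.proj (R := ℝ) (φ := fun _ : ι => ℝ) l).hasFDerivAt
    have hpow := (Real.hasDerivAt_rpow_const (p := -s) (Or.inl (hz l).ne')).comp_hasFDerivAt z hl
    have hprod : HasFDerivAt (fun z : ι → ℝ => z l ^ (-s) * H z) _ z :=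
      hpow.mul hHd.hasFDerivAt
    simp only [eulerStep]
    rw [hprod.fderiv]
    have hterm : ∀ i, γ i * z i * ((z l ^ (-s) • fderiv ℝ H z + H z • (-s * z l ^ (-s - 1)) •
        (ContinuousLinearMap.proj (R := ℝ) (φ := fun _ : ι => ℝ) l)) (Pi.single i 1)) =
        z l ^ (-s) * (γ i * z i * fderiv ℝ H z (Pi.single i 1)) +
          (if i = l then -c * z l ^ (-s) * H z else 0) := by
      intro i
      rcases eq_or_ne i l with rfl | hi
      · have hzi := (hz i).ne'
        simp [Real.rpow_sub_one hzi]
        rw [← hs]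
        field_simp
      · simp [hi, hi.symm]
        ring
    refine Eq.trans (congrArg _ (Finset.sum_congr rfl fun i _ => hterm i)) ?_
    rw [Finset.sum_add_distrib, ← Finset.mul_sum, Finset.sum_ite_eq' Finset.univ l]
    simp
    ring

end euler

/-! ### The Erdélyi-Kober operator -/

/-- The substitution `s = y / r` in an Abel integral. -/
theorem abel_eq_integral_Ioi (a : ℝ) (f : ℝ → ℝ) {y : ℝ} (hy : 0 < y) :
    abel a f y = ∫ r in Ioi (1 : ℝ), y ^ (a + 1) * ((r - 1) ^ a * r ^ (-a - 2) * f (y / r)) := by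
  have himg : (fun r : ℝ => y / r) '' Ioi 1 = Ioo 0 y := by
    ext s
    constructor
    · rintro ⟨r, hr, rfl⟩
      have h0 : 0 < r := zero_lt_one.trans hr
      exact ⟨div_pos hy h0, (div_lt_iff₀ h0).2 (lt_mul_of_one_lt_right hy hr)⟩
    · rintro ⟨h0, h1⟩
      exact ⟨y / s, (one_lt_div h0).2 h1, by field_simp⟩
  have hd : ∀ r ∈ Ioi (1 : ℝ), HasDerivWithinAt (fun r : ℝ => y / r) (-y / r ^ 2) (Ioi 1) r := by
    intro r hr
    have h0 : r ≠ 0 := (zero_lt_one.trans hr).ne'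
    have h1 := ((hasDerivAt_inv h0).const_mul y)
    refine (h1.congr_deriv ?_).hasDerivWithinAt
    ring
  have hinj : InjOn (fun r : ℝ => y / r) (Ioi 1) := by
    intro r hr r' hr' h
    have h0 : r ≠ 0 := (zero_lt_one.trans hr).ne'
    have h0' : r' ≠ 0 := (zero_lt_one.trans hr').ne'
    simp only at h
    field_simp at h
    exact h.symm
  rw [abel, intervalIntegral.integral_of_le hy.le, integral_Ioc_eq_integral_Ioo, ← himg,
    integral_image_eq_integral_abs_deriv_smul measurableSet_Ioi hd hinj]
  refine setIntegral_congr_fun measurableSet_Ioi fun r hr => ?_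
  have h1 : (1 : ℝ) < r := hr
  have h0 : 0 < r := zero_lt_one.trans h1
  have h2 : y - y / r = y * (r - 1) / r := by field_simp
  simp only [smul_eq_mul]
  rw [h2, Real.div_rpow (mul_nonneg hy.le (by linarith)) h0.le, Real.mul_rpow hy.le (by linarith),
    Real.rpow_add_one hy.ne', Real.rpow_sub h0, Real.rpow_neg h0.le, abs_div, abs_neg,
    abs_of_pos hy, abs_of_pos (by positivity), Real.rpow_two]
  have h3 := (Real.rpow_pos_of_pos h0 a).ne'
  field_simp

theorem rlExp_eq_floor {p : ℝ} (hp : 0 ≤ p) : rlExp p = (⌊p⌋ : ℝ) - p := by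
  simp [rlExp, rlFloor, hp]

/-- The Abel integral of a power times a function of `x y^{-γ}` is an Erdélyi-Kober integral. -/
theorem abel_rpow_mul_comp {ι : Type} {p : ℝ} (hp : 0 ≤ p) (c : ℝ) (γ : ι → ℝ)
    (f : (ι → ℝ) → ℝ) (x : ι → ℝ) {y : ℝ} (hy : 0 < y) :
    abel (rlExp p) (fun s => s ^ c * f (fun i => x i * s ^ (-γ i))) y =
      Real.Gamma (rlExp p + 1) *
        (y ^ (rlExp p + 1 + c) * erdelyiKober p c γ f (fun i => x i * y ^ (-γ i))) := by
  rw [abel_eq_integral_Ioi _ _ hy, erdelyiKober, ← mul_assoc, ← integral_const_mul]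
  refine setIntegral_congr_fun measurableSet_Ioi fun r hr => ?_
  have h1 : (1 : ℝ) < r := hr
  have h0 : 0 < r := zero_lt_one.trans h1
  have hG := (gamma_rlExp_pos hp).ne'
  have hz : (fun i => x i * (y / r) ^ (-γ i)) = fun i => x i * y ^ (-γ i) * r ^ γ i := by
    funext i
    rw [Real.div_rpow hy.le h0.le, Real.rpow_neg h0.le, div_inv_eq_mul, mul_assoc]
  rw [hz, ← rlExp_eq_floor hp, show (⌊p⌋ : ℝ) + 1 - p = rlExp p + 1 by
    rw [rlExp_eq_floor hp]; ring, show p - (⌊p⌋ : ℝ) - 2 - c = -rlExp p - 2 + -c by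
    rw [rlExp_eq_floor hp]; ring, Real.rpow_add h0 (-rlExp p - 2) (-c),
        Real.rpow_add hy (rlExp p + 1) c, Real.div_rpow hy.le h0.le,
    Real.rpow_neg h0.le c]
  field_simp

/-- The Riemann-Liouville derivative in the variable `x_k` of a function of the scaling form. -/
theorem riemannLiouville_rpow_mul_comp {ι : Type} [Fintype ι] [DecidableEq ι] {p : ℝ}
    (hp : 0 ≤ p) (c : ℝ) (γ : ι → ℝ) {f : (ι → ℝ) → ℝ} {x : ι → ℝ} (hx : x ∈ orthant ι)
    (hK : ContDiffOn ℝ ((⌊p⌋₊ + 1 : ℕ) : WithTop ℕ∞) (erdelyiKober p c γ f) (orthant ι))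
    {y : ℝ} (hy : 0 < y) :
    riemannLiouville 0 p (fun s => s ^ c * f (fun i => x i * s ^ (-γ i))) y =
      y ^ (c - p) * eulerProd γ (1 - p + c) (⌊p⌋₊ + 1) (erdelyiKober p c γ f)
        (fun i => x i * y ^ (-γ i)) := by
  rw [riemannLiouville_eq]
  have h1 : abel (rlExp p) (fun s => s ^ c * f (fun i => x i * s ^ (-γ i))) =ᶠ[𝓝 y]
      fun y => Real.Gamma (rlExp p + 1) *
        (y ^ (rlExp p + 1 + c) * erdelyiKober p c γ f (fun i => x i * y ^ (-γ i))) := by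
    filter_upwards [lt_mem_nhds hy] with y hy using abel_rpow_mul_comp hp c γ f x hy
  have hord := rlOrd_cast hp
  rw [rlOrd_eq hp] at hord
  rw [h1.iteratedDeriv_eq, iteratedDeriv_const_mul_field, rlOrd_eq hp,
    iteratedDeriv_rpow_mul_comp hx hK le_rfl hy, inv_mul_cancel_left₀ (gamma_rlExp_pos hp).ne',
    hord]
  congr 2 <;> ring_nf

/-! ### Reduction by the scaling of the dependent variable -/

section scaling

variable {k : Fin N}

/-- On the scaling ansatz the diffusion operator is a power of `x_k` times the reduced operator:
every term carries the same power of `x_k`. -/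
theorem diffusion_scaling (hp : ∀ i, 0 < p i) (hk : β k ≠ 0)
    {v : ℝ × ({i : Fin N // i ≠ k} → ℝ) → ℝ}
    (hv0 : ∀ q ∈ (univ : Set ℝ) ×ˢ orthant {i : Fin N // i ≠ k}, 0 < v q)
    (hK : ∀ t : ℝ, ContDiffOn ℝ ((⌊p k⌋₊ + 1 : ℕ) : WithTop ℕ∞)
      (erdelyiKober (p k) (p k / β k) (scalingExp β p k) (fun y => v (t, y)))
      (orthant {i : Fin N // i ≠ k}))
    {P : Base N} (hP : P.2 ∈ orthant (Fin N)) :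
    diffusion α β p (scalingAnsatz β p k v) P = P.2 k ^ (p k / β k) *
      scalingReduced α β p k v P.1 (fun i => P.2 i * P.2 k ^ (-scalingExp β p k i)) := by
  have hy : 0 < P.2 k := hP k
  set y := P.2 k with hyd
  set γ := scalingExp β p k with hγ
  set c := p k / β k with hc
  set z : {i : Fin N // i ≠ k} → ℝ := fun i => P.2 i * y ^ (-γ i) with hz
  have hzm : z ∈ orthant {i : Fin N // i ≠ k} := fun i =>
    mul_pos (hP i) (Real.rpow_pos_of_pos hy _)
  have hvz : 0 < v (P.1, z) := hv0 _ ⟨mem_univ _, hzm⟩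
  have hval : scalingAnsatz β p k v P = y ^ c * v (P.1, z) := rfl
  have hpow : ∀ i, (y ^ c * v (P.1, z)) ^ β i = y ^ (c * β i) * v (P.1, z) ^ β i := fun i => by
    rw [Real.mul_rpow (Real.rpow_nonneg hy.le _) hvz.le, ← Real.rpow_mul hy.le]
  have htime : deriv (fun s => scalingAnsatz β p k v (s, P.2)) P.1 =
      y ^ c * deriv (fun s => v (s, z)) P.1 :=
    deriv_const_mul_field (y ^ c) (v := fun s => v (s, z))
  have hsk : partialRL 0 (p k) k (fun x => scalingAnsatz β p k v (P.1, x)) P.2 =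
      y ^ (c - p k) * eulerProd γ (1 - p k + c) (⌊p k⌋₊ + 1)
        (erdelyiKober (p k) c γ (fun y => v (P.1, y))) z := by
    have h1 : (fun s => scalingAnsatz β p k v (P.1, Function.update P.2 k s)) =
        fun s => s ^ c * v (P.1, fun i => P.2 i * s ^ (-γ i)) := by
      funext s
      simp only [scalingAnsatz, Function.update_self]
      congr 3
      funext i
      rw [Function.update_of_ne i.2]
    rw [partialRL, h1]
    exact riemannLiouville_rpow_mul_comp (hp k).le c γ (f := fun y => v (P.1, y))
      (x := fun i => P.2 i) (fun i => hP i) (hK P.1) hy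
  have hsi : ∀ i : {i : Fin N // i ≠ k},
      partialRL 0 (p i) (i : Fin N) (fun x => scalingAnsatz β p k v (P.1, x)) P.2 =
      y ^ c * (y ^ (-(c * β i)) * partialRL 0 (p i) i (fun x => v (P.1, x)) z) := by
    intro i
    have hyi := Real.rpow_pos_of_pos hy (-γ i)
    have h1 : (fun s => scalingAnsatz β p k v (P.1, Function.update P.2 (i : Fin N) s)) =
        fun s => y ^ c * v (P.1, Function.update z i (y ^ (-γ i) * s)) := by
      funext s
      simp only [scalingAnsatz, Function.update_of_ne i.2.symm]
      congr 3
      funext j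
      rcases eq_or_ne j i with rfl | hj
      · simp [mul_comm, hγ, hyd]
      · have hj' : (j : Fin N) ≠ i := fun h => hj (Subtype.ext h)
        simp [hj, hj', hz, hyd, hγ]
    rw [partialRL, partialRL, h1, riemannLiouville_const_mul,
      riemannLiouville_comp_mul_left (hp i).le hyi (hP i)
      (fun s => v (P.1, Function.update z i s)), ← Real.rpow_mul hy.le]
    have h2 : -γ i * p i = -(c * β i) := by
      have := (hp i).ne'
      rw [hγ, hc, scalingExp]
      field_simp
    have h3 : y ^ (-γ i) * P.2 i = z i := mul_comm _ _
    rw [h2, h3]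
  rw [diffusion, htime, hval, scalingReduced,
    ← Finset.add_sum_erase _ _ (Finset.mem_univ k), hsk, hpow]
  have hsum : ∑ i ∈ Finset.univ.erase k, α i * (y ^ c * v (P.1, z)) ^ β i *
      partialRL 0 (p i) i (fun x => scalingAnsatz β p k v (P.1, x)) P.2 =
      y ^ c * ∑ i : {i : Fin N // i ≠ k},
        α i * v (P.1, z) ^ β i * partialRL 0 (p i) i (fun x => v (P.1, x)) z := by
    rw [Finset.mul_sum, Finset.sum_subtype (Finset.univ.erase k) (p := fun i => i ≠ k)
      (fun i => by simp)]
    refine Finset.sum_congr rfl fun i _ => ?_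
    rw [hsi, hpow, Real.rpow_neg hy.le]
    have := (Real.rpow_pos_of_pos hy (c * β i)).ne'
    field_simp
  have hck : c * β k = p k := by rw [hc]; field_simp
  rw [hsum, hck, Real.rpow_sub hy, ← hγ, ← hc]
  have := (Real.rpow_pos_of_pos hy (p k)).ne'
  field_simp
  ring

/-- Pulling the power of `z_l` out of the unweighted operator restores the weight. -/
theorem erdelyiKober_rpow_mul (hp : ∀ i, 0 < p i) {l : {i : Fin N // i ≠ k}}
    (hl : β l ≠ 0) (f : ({i : Fin N // i ≠ k} → ℝ) → ℝ) :
    EqOn (erdelyiKober (p k) 0 (scalingExp β p k) fun y => y l ^ (-(p l / β l)) * f y)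
      (fun z => z l ^ (-(p l / β l)) * erdelyiKober (p k) (p k / β k) (scalingExp β p k) f z)
      (orthant {i : Fin N // i ≠ k}) := by
  intro z hz
  simp only [erdelyiKober]
  rw [← integral_const_mul]
  refine setIntegral_congr_fun measurableSet_Ioi fun r hr => ?_
  have h0 : 0 < r := zero_lt_one.trans hr
  have h1 : scalingExp β p k l * -(p l / β l) = -(p k / β k) := by
    have := (hp l).ne'
    rw [scalingExp]
    field_simp
  rw [Real.mul_rpow (hz l).le (Real.rpow_nonneg h0.le _), ← Real.rpow_mul h0.le, h1, sub_zero,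
    Real.rpow_sub h0 (p k - ⌊p k⌋ - 2) (p k / β k), Real.rpow_neg h0.le (p k / β k)]
  field_simp

/-- The two forms of the reduced equation agree, since the power of `z_l` may be moved first through
the integral operator and then through the Euler factors. -/
theorem scalingReduced'_eq (hp : ∀ i, 0 < p i)
    {l : {i : Fin N // i ≠ k}} (hl : β l ≠ 0) {v : ℝ × ({i : Fin N // i ≠ k} → ℝ) → ℝ} {t : ℝ}
    (hK : ContDiffOn ℝ ((⌊p k⌋₊ + 1 : ℕ) : WithTop ℕ∞)
      (erdelyiKober (p k) (p k / β k) (scalingExp β p k) (fun y => v (t, y)))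
      (orthant {i : Fin N // i ≠ k})) {z : {i : Fin N // i ≠ k} → ℝ}
    (hz : z ∈ orthant {i : Fin N // i ≠ k}) :
    scalingReduced' α β p k l v t z = scalingReduced α β p k v t z := by
  have h1 : scalingExp β p k l * (p l / β l) = p k / β k := by
    have := (hp l).ne'
    rw [scalingExp]
    field_simp
  have h2 := (eulerProd_eqOn (γ := scalingExp β p k) (c := 1 - p k)
    (erdelyiKober_rpow_mul hp hl fun y => v (t, y)) (⌊p k⌋₊ + 1)).trans
    (eulerProd_rpow_mul l h1 (⌊p k⌋₊ + 1) hK) hz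
  have h3 := (Real.rpow_pos_of_pos (hz l) (p l / β l)).ne'
  rw [scalingReduced', scalingReduced, h2, Real.rpow_neg (hz l).le, mul_inv_cancel_left₀ h3]

theorem scaling_reduction (hp : ∀ i, 0 < p i) (hk : β k ≠ 0)
    {v : ℝ × ({i : Fin N // i ≠ k} → ℝ) → ℝ}
    (hv0 : ∀ q ∈ (univ : Set ℝ) ×ˢ orthant {i : Fin N // i ≠ k}, 0 < v q)
    (hK : ∀ t : ℝ, ContDiffOn ℝ ((⌊p k⌋₊ + 1 : ℕ) : WithTop ℕ∞)
      (erdelyiKober (p k) (p k / β k) (scalingExp β p k) (fun y => v (t, y)))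
      (orthant {i : Fin N // i ≠ k})) :
    (∀ P ∈ (univ : Set ℝ) ×ˢ orthant (Fin N), diffusion α β p (scalingAnsatz β p k v) P = 0) ↔
      ∀ t : ℝ, ∀ z ∈ orthant {i : Fin N // i ≠ k}, scalingReduced α β p k v t z = 0 := by
  constructor
  · intro h t z hz
    -- the point with `x_k = 1` whose similarity variables are `z`
    set x : Fin N → ℝ := fun i => if hi : i ≠ k then z ⟨i, hi⟩ else 1 with hx
    have hxk : x k = 1 := by simp [hx]
    have hxm : x ∈ orthant (Fin N) := fun i => by
      by_cases hi : i ≠ k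
      · simpa [hx, hi] using hz ⟨i, hi⟩
      · simp only [hx, dif_neg hi, one_pos]
    have h1 := h (t, x) ⟨mem_univ _, hxm⟩
    rw [diffusion_scaling hp hk hv0 hK (P := (t, x)) hxm] at h1
    simp only [hxk, Real.one_rpow, one_mul, mul_one] at h1
    rwa [show (fun i : {i : Fin N // i ≠ k} => x i) = z from funext fun i => by
      simp [hx, i.2]] at h1
  · intro h P hP
    have hy : 0 < P.2 k := hP.2 k
    rw [diffusion_scaling hp hk hv0 hK hP.2,
      h _ _ fun i => mul_pos (hP.2 i) (Real.rpow_pos_of_pos hy _), mul_zero]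

end scaling

end

end FracDiff

end

theorem mainTheorem5 {N : ℕ} (α β p : Fin N → ℝ)
    (hα : ∀ i, α i ≠ 0) (hβ : ∃ i, β i ≠ 0) (hp : ∀ i, 0 < p i ∧ ∀ n : ℕ, p i ≠ n) :
    -- the algebra of point symmetries
    (∀ (I : Set ℝ) (b : Fin N → EReal) (U : Set ℝ),
      IsOpen I → I.OrdConnected → I.Nonempty → (∀ i, 0 < b i) →
      IsOpen U → U.OrdConnected → U.Nonempty → U ⊆ Set.Ioi 0 →
      ((¬ ∃ k, β k * (p k - 1) = 2 * p k ∧ ∀ j, j ≠ k → β j = 0) →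
        symmetryAlgebra (diffusion α β p) I b U =
          (Submodule.span ℝ (Set.range ![(domain I b U).domRestrict gen₁,
            (domain I b U).domRestrict (gen₂ p), (domain I b U).domRestrict (gen₃ β p)]) :
            Set (domain I b U → Total N)) ∧
        LinearIndependent ℝ ![(domain I b U).domRestrict gen₁,
          (domain I b U).domRestrict (gen₂ p), (domain I b U).domRestrict (gen₃ β p)]) ∧
      (∀ k, β k * (p k - 1) = 2 * p k → (∀ j, j ≠ k → β j = 0) →
        symmetryAlgebra (diffusion α β p) I b U =
          (Submodule.span ℝ (Set.range ![(domain I b U).domRestrict gen₁,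
            (domain I b U).domRestrict (gen₂ p), (domain I b U).domRestrict (gen₃ β p),
            (domain I b U).domRestrict (gen₄ p k)]) : Set (domain I b U → Total N)) ∧
        LinearIndependent ℝ ![(domain I b U).domRestrict gen₁,
          (domain I b U).domRestrict (gen₂ p), (domain I b U).domRestrict (gen₃ β p),
          (domain I b U).domRestrict (gen₄ p k)])) ∧
    -- reduction by `gen₁`
    (∀ u : Base N → ℝ, DifferentiableOn ℝ u (Set.univ ×ˢ orthant (Fin N)) →
      ((∀ P ∈ Set.univ ×ˢ orthant (Fin N), characteristic gen₁ u P = 0) ↔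
        ∃ v : (Fin N → ℝ) → ℝ, ∀ P ∈ Set.univ ×ˢ orthant (Fin N), u P = v P.2)) ∧
    (∀ v : (Fin N → ℝ) → ℝ, DifferentiableOn ℝ v (orthant (Fin N)) →
      (∀ x ∈ orthant (Fin N), 0 < v x) →
      ((∀ P ∈ Set.univ ×ˢ orthant (Fin N), diffusion α β p (fun q => v q.2) P = 0) ↔
        ∀ x ∈ orthant (Fin N), stationaryReduced α β p v x = 0)) ∧
    -- reduction by `gen₂`
    (∀ u : Base N → ℝ, DifferentiableOn ℝ u (Set.Ioi 0 ×ˢ orthant (Fin N)) →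
      ((∀ P ∈ Set.Ioi 0 ×ˢ orthant (Fin N), characteristic (gen₂ p) u P = 0) ↔
        ∃ v : (Fin N → ℝ) → ℝ, ∀ P ∈ Set.Ioi 0 ×ˢ orthant (Fin N),
          u P = similarityAnsatz p v P)) ∧
    (∀ v : (Fin N → ℝ) → ℝ, DifferentiableOn ℝ v (orthant (Fin N)) →
      (∀ z ∈ orthant (Fin N), 0 < v z) →
      ((∀ P ∈ Set.Ioi 0 ×ˢ orthant (Fin N),
          diffusion α β p (similarityAnsatz p v) P = 0) ↔
        ∀ z ∈ orthant (Fin N), similarityReduced α β p v z = 0)) ∧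
    -- reduction by `gen₃`
    (∀ k, β k ≠ 0 →
      (∀ u : Base N → ℝ, DifferentiableOn ℝ u (Set.univ ×ˢ orthant (Fin N)) →
        ((∀ P ∈ Set.univ ×ˢ orthant (Fin N), characteristic (gen₃ β p) u P = 0) ↔
          ∃ v : ℝ × ({i : Fin N // i ≠ k} → ℝ) → ℝ, ∀ P ∈ Set.univ ×ˢ orthant (Fin N),
            u P = scalingAnsatz β p k v P)) ∧
      (∀ v : ℝ × ({i : Fin N // i ≠ k} → ℝ) → ℝ,
        DifferentiableOn ℝ v (Set.univ ×ˢ orthant {i : Fin N // i ≠ k}) →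
        (∀ q ∈ Set.univ ×ˢ orthant {i : Fin N // i ≠ k}, 0 < v q) →
        (∀ t : ℝ, ContDiffOn ℝ ((⌊p k⌋₊ + 1 : ℕ) : WithTop ℕ∞)
          (erdelyiKober (p k) (p k / β k) (scalingExp β p k) (fun y => v (t, y)))
          (orthant {i : Fin N // i ≠ k})) →
        ((∀ P ∈ Set.univ ×ˢ orthant (Fin N),
            diffusion α β p (scalingAnsatz β p k v) P = 0) ↔
          ∀ t : ℝ, ∀ z ∈ orthant {i : Fin N // i ≠ k}, scalingReduced α β p k v t z = 0) ∧
        (∀ l : {i : Fin N // i ≠ k}, β l ≠ 0 →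
          ((∀ P ∈ Set.univ ×ˢ orthant (Fin N),
              diffusion α β p (scalingAnsatz β p k v) P = 0) ↔
            ∀ t : ℝ, ∀ z ∈ orthant {i : Fin N // i ≠ k},
              scalingReduced' α β p k l v t z = 0)))) := by
  have hp0 : ∀ i, 0 < p i := fun i => (hp i).1
  refine ⟨fun I b U hIo hIc hI hb hUo hUc hU hU0 => ⟨fun hgen => ?_, fun k hk hj => ?_⟩,
    fun u hu => invariant_gen₁_iff hu, fun v _ _ => stationary_reduction v,
    fun u hu => invariant_gen₂_iff hu, fun v hv _ => similarity_reduction hp0 hv,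
    fun k hk => ⟨fun u hu => invariant_gen₃_iff hp0 hk hu, fun v _ hv0 hK =>
      ⟨scaling_reduction hp0 hk hv0 hK, fun l hl => ?_⟩⟩⟩
  · exact symmetryAlgebra_generic hα hβ hp hIo hIc hI hb hUo hUc hU hU0 hgen
  · exact symmetryAlgebra_exceptional hα hp hIo hIc hI hb hUo hUc hU hU0 hk hj
  · rw [scaling_reduction hp0 hk hv0 hK]
    refine forall_congr' fun t => forall₂_congr fun z hz => ?_
    rw [scalingReduced'_eq hp0 hl (hK t) hz]
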